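/- Let $C$ be a smooth manifold (finite-dimensional, Hausdorff, second countable, without boundary), $E\to C$ a smooth vector bundle of finite rank, $U\subset E$ an open neighbourhood of the zero section and $\Omega$ a symplectic form on $U$ such that the zero section $C\subset U$ is coisotropic, i.e. $TC^{\perp}\subset TC$ along $C$. (A local symplectic model of a coisotropic submanifold is of this form.) Let $K\subset TC$ be the kernel of the pullback $\omega_C$ of $\Omega$ to $C$, let $\Omega^1_{\mathfrak F}(C)=\Gamma(K^*)$ with $d_{\mathfrak F}f=df|_K$ and $d_{\mathfrak F}\alpha(X,Y)=X(\alpha(Y))-Y(\alpha(X))-\alpha([X,Y])$ for $X,Y\in\Gamma(K)$, let $H^1_{\mathfrak F}(C)$ be the space of $d_{\mathfrak F}$-closed elements of $\Omega^1_{\mathfrak F}(C)$ modulo the exact ones $d_{\mathfrak F}f$, $f\in C^\infty(C)$, and let $r:H^1(C)\to H^1_{\mathfrak F}(C)$ be induced by restricting forms to $K$. Then $K$ is involutive and $e\mapsto\Omega(e,\cdot)|_K$ induces an isomorphism $\Gamma(E)\cong\Omega^1_{\mathfrak F}(C)$, which is used as an identification below. A section of $E$ is called coisotropic if its graph lies in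 $U$ and is coisotropic; $\mathsf{Def}_U(C)$ is the set of coisotropic sections. A symplectic isotopy is a smooth family of injective maps $\phi_t:V\to U$ on an open set $V\subset U$, preserving $\Omega$, with $\phi_0$ the inclusion. It is Hamiltonian if its generating vector fields $X_t$ on $\phi_t(V)$ satisfy $\Omega(X_t,\cdot)=dH_t$ for a smooth family of functions $H_t$ on $\phi_t(V)$. A family $(s_t)$ of coisotropic sections with $s_0=0$ is trivial under symplectic (Hamiltonian) equivalence if there is a symplectic (Hamiltonian) isotopy, defined on a neighbourhood $V$ of the zero section, with $\phi_t(C)=\mathrm{graph}(s_t)$ for all $t$. 1. If a smooth family $(s_t)_{t\in[0,1]}$ of coisotropic sections with $s_0=0$ is trivial under symplectic equivalence, then $\frac{\partial s_t}{\partial t}|_{t=0}$ is a $d_{\mathfrak F}$-closed foliated one-form and its class in $H^1_{\mathfrak F}(C)$ lies in the image of $r$. 2. If such a family is trivial under Hamiltonian equivalence, then $\frac{\partial s_t}{\partial t}|_{t=0}$ is $d_{\mathfrak F}$-closed and its class in $H^1_{\mathfrak F}(C)$ is zero. 3. Let $\Pi$ be the Poisson bivector of $\Omega$, $\psi_{-s}(x,e)=(x,e-s_x)$,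 $P$ the restriction of multivector fields to $C$ followed by the projection $\wedge TE|_C\to\wedge E$, and $\mu(s)=P((\psi_{-s})_*\Pi)\in\Gamma(\wedge^2E)$. A section $s$ with graph in $U$ is coisotropic if and only if $\mu(s)=0$. The formal tangent space of $\mathsf{Def}_U(C)$ at $0$, i.e. the set of $\sigma\in\Gamma(E)$ with $\frac{d}{dt}|_{t=0}\mu(t\sigma)=0$ pointwise on $C$, is the space of $d_{\mathfrak F}$-closed foliated one-forms. 4. The sections of $E\cong TE|_C/TC$ induced along $C$ by Hamiltonian vector fields defined near $C$ (the formal tangent space at $0$ to the set of sections that are trivial under Hamiltonian equivalence) are exactly the exact foliated one-forms $d_{\mathfrak F}f$. Those induced by symplectic vector fields defined near $C$ are exactly the elements of $r(\Omega^1_{\mathrm{closed}}(C))$. If $C$ is compact, then these are also exactly the velocities $\frac{\partial s_t}{\partial t}|_{t=0}$ of smooth families $(s_t)_{t\in[0,\varepsilon)}$, for some $\varepsilon>0$, of coisotropic sections with $s_0=0$ that are trivial under Hamiltonian, respectively symplectic, equivalence. 5. Consequently, passing to classes induces isomorphisms from the formal tangent spaces at $0$ of the moduli spaces of coisotropic sections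 modulo Hamiltonian and modulo symplectic equivalence (the space in 3 modulo the first, respectively the second, space in 4) onto $H^1_{\mathfrak F}(C)$ and $\operatorname{coker}(r)=H^1_{\mathfrak F}(C)/r(H^1(C))$ respectively. -/

import Mathlib

open Bundle Set VectorField
open scoped Manifold ContDiff Topology

set_option linter.unusedSectionVars false

noncomputable section

namespace Coiso

/-! ### Forms on manifolds -/

section Forms

variable {B H : Type*} [NormedAddCommGroup B] [NormedSpace ℝ B] [TopologicalSpace H]
  (I : ModelWithCorners ℝ B H)
  {N : Type*} [TopologicalSpace N] [ChartedSpace H N]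

/-- The derivative `df_p(v)` of a real function in the direction of a tangent vector. -/
def dirDeriv (f : N → ℝ) (p : N) (v : TangentSpace I p) : ℝ :=
  mfderiv I 𝓘(ℝ, ℝ) f p v

variable [IsManifold I ∞ N]

/-- A vector field is smooth on a set. -/
def SmoothFieldOn (W : Set N) (X : ∀ p : N, TangentSpace I p) : Prop :=
  ContMDiffOn I I.tangent ∞ (fun p => (⟨p, X p⟩ : TangentBundle I N)) W

/-- A one-form is smooth on a set, as a section of the cotangent bundle. -/
def SmoothOneFormOn (W : Set N) (α : ∀ p : N, TangentSpace I p →L[ℝ] ℝ) : Prop :=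
  ContMDiffOn I (I.prod 𝓘(ℝ, B →L[ℝ] ℝ)) ∞
    (fun p => TotalSpace.mk' (B →L[ℝ] ℝ) p (α p)) W

/-- A field of bilinear forms is smooth on a set, as a section of the bundle `Hom(T, Hom(T, ℝ))`. -/
def SmoothBilinOn (W : Set N) (Ω : ∀ p : N, TangentSpace I p →L[ℝ] TangentSpace I p →L[ℝ] ℝ) :
    Prop :=
  ContMDiffOn I (I.prod 𝓘(ℝ, B →L[ℝ] B →L[ℝ] ℝ)) ∞
    (fun p => TotalSpace.mk' (B →L[ℝ] B →L[ℝ] ℝ) p (Ω p)) W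

/-- `dα = 0` on `W`, by the formula `dα(X,Y) = X(α(Y)) - Y(α(X)) - α([X,Y])`. -/
def OneFormClosedOn (W : Set N) (α : ∀ p : N, TangentSpace I p →L[ℝ] ℝ) : Prop :=
  ∀ W' : Set N, IsOpen W' → W' ⊆ W → ∀ X Y : ∀ p : N, TangentSpace I p,
    SmoothFieldOn I W' X → SmoothFieldOn I W' Y → ∀ p ∈ W',
      dirDeriv I (fun q => α q (Y q)) p (X p) - dirDeriv I (fun q => α q (X q)) p (Y p)
        - α p (mlieBracket I X Y p) = 0

/-- `dΩ = 0` on `W`, by the formula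
`dΩ(X,Y,Z) = X(Ω(Y,Z)) - Y(Ω(X,Z)) + Z(Ω(X,Y)) - Ω([X,Y],Z) + Ω([X,Z],Y) - Ω([Y,Z],X)`. -/
def TwoFormClosedOn (W : Set N)
    (Ω : ∀ p : N, TangentSpace I p →L[ℝ] TangentSpace I p →L[ℝ] ℝ) : Prop :=
  ∀ W' : Set N, IsOpen W' → W' ⊆ W → ∀ X Y Z : ∀ p : N, TangentSpace I p,
    SmoothFieldOn I W' X → SmoothFieldOn I W' Y → SmoothFieldOn I W' Z → ∀ p ∈ W',
      dirDeriv I (fun q => Ω q (Y q) (Z q)) p (X p)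
        - dirDeriv I (fun q => Ω q (X q) (Z q)) p (Y p)
        + dirDeriv I (fun q => Ω q (X q) (Y q)) p (Z p)
        - Ω p (mlieBracket I X Y p) (Z p) + Ω p (mlieBracket I X Z p) (Y p)
        - Ω p (mlieBracket I Y Z p) (X p) = 0

/-- `Ω` is a symplectic form on the open set `U`. -/
structure IsSymplecticOn (U : Set N)
    (Ω : ∀ p : N, TangentSpace I p →L[ℝ] TangentSpace I p →L[ℝ] ℝ) : Prop where
  isOpen : IsOpen U
  smooth : SmoothBilinOn I U Ω
  alternating : ∀ p ∈ U, ∀ v, Ω p v v = 0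
  nondegenerate : ∀ p ∈ U, ∀ v, (∀ w, Ω p v w = 0) → v = 0
  closed : TwoFormClosedOn I U Ω

end Forms

section DeRham

variable {B : Type*} [NormedAddCommGroup B] [NormedSpace ℝ B]
  {C : Type*} [TopologicalSpace C] [ChartedSpace B C]

theorem dirDeriv_add {f g : C → ℝ} {p : C} {v : TangentSpace 𝓘(ℝ, B) p}
    (hf : MDifferentiableAt 𝓘(ℝ, B) 𝓘(ℝ, ℝ) f p) (hg : MDifferentiableAt 𝓘(ℝ, B) 𝓘(ℝ, ℝ) g p) :
    dirDeriv 𝓘(ℝ, B) (fun q => f q + g q) p v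
      = dirDeriv 𝓘(ℝ, B) f p v + dirDeriv 𝓘(ℝ, B) g p v := by
  have h := (hf.hasMFDerivAt.add hg.hasMFDerivAt).mfderiv
  unfold dirDeriv
  erw [h]
  rfl

theorem dirDeriv_smul {f : C → ℝ} {p : C} {v : TangentSpace 𝓘(ℝ, B) p} (c : ℝ)
    (hf : MDifferentiableAt 𝓘(ℝ, B) 𝓘(ℝ, ℝ) f p) :
    dirDeriv 𝓘(ℝ, B) (fun q => c * f q) p v = c * dirDeriv 𝓘(ℝ, B) f p v := by
  have h := (hf.hasMFDerivAt.const_smul c).mfderiv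
  unfold dirDeriv
  erw [h]
  rfl

theorem dirDeriv_zero {p : C} {v : TangentSpace 𝓘(ℝ, B) p} :
    dirDeriv 𝓘(ℝ, B) (fun _ => (0 : ℝ)) p v = 0 := by
  unfold dirDeriv
  rw [mfderiv_const]
  rfl

theorem mdiffAt_of_contMDiffOn {f : C → ℝ} {W : Set C} (hW : IsOpen W)
    (hf : ContMDiffOn 𝓘(ℝ, B) 𝓘(ℝ, ℝ) ∞ f W) {p : C} (hp : p ∈ W) :
    MDifferentiableAt 𝓘(ℝ, B) 𝓘(ℝ, ℝ) f p :=
  (hf.contMDiffAt (hW.mem_nhds hp)).mdifferentiableAt (by simp)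

variable [IsManifold 𝓘(ℝ, B) ∞ C]

variable (C) in
/-- The space `Ω¹(C)` of smooth one-forms. -/
abbrev OneForm : Type _ :=
  Cₛ^∞⟮𝓘(ℝ, B); B →L[ℝ] ℝ, fun x : C => TangentSpace 𝓘(ℝ, B) x →L[ℝ] ℝ⟯

theorem OneForm.apply_smooth (α : OneForm (B := B) C) {W : Set C}
    {X : ∀ p : C, TangentSpace 𝓘(ℝ, B) p} (hX : SmoothFieldOn 𝓘(ℝ, B) W X) :
    ContMDiffOn 𝓘(ℝ, B) 𝓘(ℝ, ℝ) ∞ (fun q => α q (X q)) W := by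
  have h1 : ContMDiffOn 𝓘(ℝ, B) (𝓘(ℝ, B).prod 𝓘(ℝ, B →L[ℝ] ℝ)) ∞
    (fun p => TotalSpace.mk' (B →L[ℝ] ℝ) p (α p)) W := α.contMDiff.contMDiffOn
  have h2 : ContMDiffOn 𝓘(ℝ, B) (𝓘(ℝ, B).prod 𝓘(ℝ, ℝ)) ∞
    (fun m => TotalSpace.mk' ℝ (E := Bundle.Trivial C ℝ) m (α m (X m))) W :=
    h1.clm_bundle_apply (E₁ := fun x : C => TangentSpace 𝓘(ℝ, B) x) (E₂ := Bundle.Trivial C ℝ)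
      (b := fun x => x) hX
  exact fun x hx => (Bundle.contMDiffWithinAt_totalSpace.1 (h2 x hx)).2

variable (B C) in
/-- The space `Z¹(C)` of closed one-forms. -/
def closedOneForms : Submodule ℝ (OneForm (B := B) C) where
  carrier := {α | OneFormClosedOn 𝓘(ℝ, B) univ (fun p => α p)}
  zero_mem' := by
    intro W' _ _ X Y _ _ p _
    have h1 : ∀ Z : (∀ p : C, TangentSpace 𝓘(ℝ, B) p),
        (fun q => (0 : OneForm (B := B) C) q (Z q)) = fun _ => (0 : ℝ) := fun Z => rfl
    have h2 : (0 : OneForm (B := B) C) p (mlieBracket 𝓘(ℝ, B) X Y p) = 0 := rfl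
    simp only [h1, h2, dirDeriv_zero, sub_self]
  add_mem' := by
    intro α β hα hβ W' hW' hsub X Y hX hY p hp
    have h1 : ∀ Z : (∀ p : C, TangentSpace 𝓘(ℝ, B) p),
        (fun q => (α + β) q (Z q)) = fun q => α q (Z q) + β q (Z q) := fun Z => rfl
    have h2 : (α + β) p (mlieBracket 𝓘(ℝ, B) X Y p)
      = α p (mlieBracket 𝓘(ℝ, B) X Y p) + β p (mlieBracket 𝓘(ℝ, B) X Y p) := rfl
    have d (γ : OneForm (B := B) C) (Z) (hZ : SmoothFieldOn 𝓘(ℝ, B) W' Z) :=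
      mdiffAt_of_contMDiffOn hW' (γ.apply_smooth hZ) hp
    simp only [h1, h2]
    rw [dirDeriv_add (d α Y hY) (d β Y hY), dirDeriv_add (d α X hX) (d β X hX)]
    linarith [hα W' hW' hsub X Y hX hY p hp, hβ W' hW' hsub X Y hX hY p hp]
  smul_mem' := by
    intro c α hα W' hW' hsub X Y hX hY p hp
    have h1 : ∀ Z : (∀ p : C, TangentSpace 𝓘(ℝ, B) p),
        (fun q => (c • α) q (Z q)) = fun q => c * α q (Z q) := fun Z => rfl
    have h2 : (c • α) p (mlieBracket 𝓘(ℝ, B) X Y p)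
      = c * α p (mlieBracket 𝓘(ℝ, B) X Y p) := rfl
    have d (γ : OneForm (B := B) C) (Z) (hZ : SmoothFieldOn 𝓘(ℝ, B) W' Z) :=
      mdiffAt_of_contMDiffOn hW' (γ.apply_smooth hZ) hp
    simp only [h1, h2]
    rw [dirDeriv_smul c (d α Y hY), dirDeriv_smul c (d α X hX), ← mul_sub, ← mul_sub,
      hα W' hW' hsub X Y hX hY p hp, mul_zero]

variable (B C) in
/-- The space of exact one-forms `df`. -/
def exactOneForms : Submodule ℝ (OneForm (B := B) C) where
  carrier := {α | ∃ f : C → ℝ, ContMDiff 𝓘(ℝ, B) 𝓘(ℝ, ℝ) ∞ f ∧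
    ∀ p v, α p v = dirDeriv 𝓘(ℝ, B) f p v}
  zero_mem' := ⟨fun _ => 0, contMDiff_const, fun p v => by rw [dirDeriv_zero]; rfl⟩
  add_mem' := by
    rintro α β ⟨f, hf, hf'⟩ ⟨g, hg, hg'⟩
    refine ⟨fun x => f x + g x, hf.add hg, fun p v => ?_⟩
    rw [dirDeriv_add (hf.mdifferentiableAt (by simp)) (hg.mdifferentiableAt (by simp)),
      ← hf', ← hg']
    rfl
  smul_mem' := by
    rintro c α ⟨f, hf, hf'⟩
    refine ⟨fun x => c * f x, contMDiff_const.mul hf, fun p v => ?_⟩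
    rw [dirDeriv_smul c (hf.mdifferentiableAt (by simp)), ← hf']
    rfl

variable (B C) in
/-- The first de Rham cohomology `H¹(C)`. -/
abbrev H1 : Type _ :=
  closedOneForms B C ⧸ (exactOneForms B C).submoduleOf (closedOneForms B C)

/-! ### Foliated forms

`K` is a family of subspaces of the tangent spaces of `C` (below: the kernel of the presymplectic
form). A foliated one-form is a smooth section of `K^*`. -/

variable (K : ∀ x : C, Submodule ℝ (TangentSpace 𝓘(ℝ, B) x))

/-- A section of `K`, smooth on `W`. -/
def SmoothKFieldOn (W : Set C) (X : ∀ x, K x) : Prop :=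
  SmoothFieldOn 𝓘(ℝ, B) W (fun x => (X x : TangentSpace 𝓘(ℝ, B) x))

/-- A family of linear forms on the spaces `K x`. -/
def KForm : Type _ := ∀ x : C, K x →ₗ[ℝ] ℝ

instance : AddCommGroup (KForm K) := inferInstanceAs (AddCommGroup (∀ x : C, K x →ₗ[ℝ] ℝ))

instance : Module ℝ (KForm K) := inferInstanceAs (Module ℝ (∀ x : C, K x →ₗ[ℝ] ℝ))

theorem KForm.add_apply (α β : KForm K) (x : C) (v : K x) : (α + β) x v = α x v + β x v := rfl

theorem KForm.smul_apply (c : ℝ) (α : KForm K) (x : C) (v : K x) : (c • α) x v = c * α x v := rfl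

theorem KForm.zero_apply (x : C) (v : K x) : (0 : KForm K) x v = 0 := rfl

/-- The space `Ω¹_F(C) = Γ(K^*)`: the families of linear forms on `K` whose values on (local)
smooth sections of `K` are smooth. -/
def foliatedOneForms : Submodule ℝ (KForm K) where
  carrier := {α | ∀ W : Set C, IsOpen W → ∀ X : ∀ x, K x, SmoothKFieldOn K W X →
    ContMDiffOn 𝓘(ℝ, B) 𝓘(ℝ, ℝ) ∞ (fun x => α x (X x)) W}
  zero_mem' := fun _ _ _ _ => contMDiffOn_const
  add_mem' := fun hα hβ W hW X hX => (hα W hW X hX).add (hβ W hW X hX)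
  smul_mem' := fun _ _ hα W hW X hX => contMDiffOn_const.mul (hα W hW X hX)

/-- `K` is involutive. -/
def Involutive : Prop :=
  ∀ W : Set C, IsOpen W → ∀ X Y : ∀ x, K x, SmoothKFieldOn K W X → SmoothKFieldOn K W Y →
    ∀ x ∈ W, mlieBracket 𝓘(ℝ, B) (fun y => (X y : TangentSpace 𝓘(ℝ, B) y)) (fun y => Y y) x ∈ K x

/-- The space of foliated one-forms `α` with `d_F α = 0`, where
`d_F α(X,Y) = X(α(Y)) - Y(α(X)) - α([X,Y])` for sections `X`, `Y` of `K`. (The condition that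
`[X,Y]` lies in `K` holds automatically when `K` is involutive.) -/
def closedFoliated : Submodule ℝ (KForm K) where
  carrier := {α | α ∈ foliatedOneForms K ∧
    ∀ W : Set C, IsOpen W → ∀ X Y : ∀ x, K x, SmoothKFieldOn K W X → SmoothKFieldOn K W Y →
      ∀ x ∈ W, ∀ h : mlieBracket 𝓘(ℝ, B) (fun y => (X y : TangentSpace 𝓘(ℝ, B) y))
          (fun y => Y y) x ∈ K x,
        dirDeriv 𝓘(ℝ, B) (fun y => α y (Y y)) x (X x)
          - dirDeriv 𝓘(ℝ, B) (fun y => α y (X y)) x (Y x) - α x ⟨_, h⟩ = 0}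
  zero_mem' := by
    refine ⟨zero_mem _, ?_⟩
    intro W _ X Y _ _ x _ h
    simp only [KForm.zero_apply, dirDeriv_zero, sub_self]
  add_mem' := by
    rintro α β ⟨sα, hα⟩ ⟨sβ, hβ⟩
    refine ⟨add_mem sα sβ, ?_⟩
    intro W hW X Y hX hY x hx h
    have dα (Z) (hZ : SmoothKFieldOn K W Z) := mdiffAt_of_contMDiffOn hW (sα W hW Z hZ) hx
    have dβ (Z) (hZ : SmoothKFieldOn K W Z) := mdiffAt_of_contMDiffOn hW (sβ W hW Z hZ) hx
    simp only [KForm.add_apply]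
    rw [dirDeriv_add (dα Y hY) (dβ Y hY), dirDeriv_add (dα X hX) (dβ X hX)]
    linarith [hα W hW X Y hX hY x hx h, hβ W hW X Y hX hY x hx h]
  smul_mem' := by
    rintro c α ⟨sα, hα⟩
    refine ⟨Submodule.smul_mem _ c sα, ?_⟩
    intro W hW X Y hX hY x hx h
    have dα (Z) (hZ : SmoothKFieldOn K W Z) := mdiffAt_of_contMDiffOn hW (sα W hW Z hZ) hx
    simp only [KForm.smul_apply]
    rw [dirDeriv_smul c (dα Y hY), dirDeriv_smul c (dα X hX), ← mul_sub, ← mul_sub,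
      hα W hW X Y hX hY x hx h, mul_zero]

/-- The space of exact foliated one-forms `d_F f = df|_K`. -/
def exactFoliated : Submodule ℝ (KForm K) where
  carrier := {α | ∃ f : C → ℝ, ContMDiff 𝓘(ℝ, B) 𝓘(ℝ, ℝ) ∞ f ∧
    ∀ x (v : K x), α x v = dirDeriv 𝓘(ℝ, B) f x v}
  zero_mem' := ⟨fun _ => 0, contMDiff_const, fun p v => by rw [dirDeriv_zero]; rfl⟩
  add_mem' := by
    rintro α β ⟨f, hf, hf'⟩ ⟨g, hg, hg'⟩
    refine ⟨fun x => f x + g x, hf.add hg, fun p v => ?_⟩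
    rw [dirDeriv_add (hf.mdifferentiableAt (by simp)) (hg.mdifferentiableAt (by simp)),
      ← hf', ← hg']
    rfl
  smul_mem' := by
    rintro c α ⟨f, hf, hf'⟩
    refine ⟨fun x => c * f x, contMDiff_const.mul hf, fun p v => ?_⟩
    rw [dirDeriv_smul c (hf.mdifferentiableAt (by simp)), ← hf']
    rfl

/-- The first foliated cohomology `H¹_F(C)`. -/
abbrev FoliatedH1 : Type _ :=
  closedFoliated K ⧸ (exactFoliated K).submoduleOf (closedFoliated K)

/-- Restriction of one-forms to `K`. -/
def restrictToK : OneForm (B := B) C →ₗ[ℝ] KForm K where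
  toFun α := fun x => (α x : TangentSpace 𝓘(ℝ, B) x →ₗ[ℝ] ℝ) ∘ₗ (K x).subtype
  map_add' _ _ := rfl
  map_smul' _ _ := rfl

theorem restrictToK_closed (α : OneForm (B := B) C) (h : α ∈ closedOneForms B C) :
    restrictToK K α ∈ closedFoliated K :=
  ⟨fun _ _ _ hX => α.apply_smooth hX,
    fun W hW _ _ hX hY x hx _ => h W hW (subset_univ W) _ _ hX hY x hx⟩

/-- Restriction to `K` on closed one-forms. -/
def restrictClosed : closedOneForms B C →ₗ[ℝ] closedFoliated K :=
  (restrictToK K).restrict (restrictToK_closed K)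

/-- The map `r : H¹(C) → H¹_F(C)` induced by restriction to `K`. -/
def rMap : H1 B C →ₗ[ℝ] FoliatedH1 K :=
  Submodule.mapQ _ _ (restrictClosed K) (by
    rintro α ⟨f, hf, hf'⟩
    exact ⟨f, hf, fun x v => hf' x v⟩)

end DeRham

/-! ### Coisotropic sections -/

section Sections

variable {B : Type*} [NormedAddCommGroup B] [NormedSpace ℝ B]
  {C : Type*} [TopologicalSpace C] [ChartedSpace B C] [IsManifold 𝓘(ℝ, B) ∞ C]
  {F : Type*} [NormedAddCommGroup F] [NormedSpace ℝ F]
  {E : C → Type*} [TopologicalSpace (TotalSpace F E)] [∀ x, AddCommGroup (E x)]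
  [∀ x, Module ℝ (E x)] [∀ x, TopologicalSpace (E x)]
  [FiberBundle F E] [VectorBundle ℝ F E] [ContMDiffVectorBundle ∞ F E 𝓘(ℝ, B)]

variable (B) in
/-- The tangent space of the total space of `E`. -/
abbrev TT (p : TotalSpace F E) : Type _ := TangentSpace (𝓘(ℝ, B).prod 𝓘(ℝ, F)) p

variable (B F E) in
/-- A field of bilinear forms on the total space of `E`; conditions are only imposed on `U`. -/
abbrev BilinField : Type _ := ∀ p : TotalSpace F E, TT B p →L[ℝ] TT B p →L[ℝ] ℝ

variable (B F E) in
/-- The space `Γ(E)` of smooth sections. -/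
abbrev Gam : Type _ := Cₛ^∞⟮𝓘(ℝ, B); F, E⟯

/-- The section `s` as a map to the total space. -/
def graphMap (s : Gam B F E) (x : C) : TotalSpace F E := ⟨x, s x⟩

/-- The graph of a section. -/
def graph (s : Gam B F E) : Set (TotalSpace F E) := range (graphMap s)

/-- The graph of `s` lies in `U` and is coisotropic: at each of its points the symplectic orthogonal
of its tangent space is contained in its tangent space. -/
def IsCoisotropicSection (U : Set (TotalSpace F E)) (Ω : BilinField B F E) (s : Gam B F E) : Prop :=
  graph s ⊆ U ∧ ∀ x : C, ∀ v : TT B (graphMap s x),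
    (∀ w : TangentSpace 𝓘(ℝ, B) x,
      Ω (graphMap s x) v (mfderiv 𝓘(ℝ, B) (𝓘(ℝ, B).prod 𝓘(ℝ, F)) (graphMap s) x w) = 0) →
    ∃ u : TangentSpace 𝓘(ℝ, B) x,
      mfderiv 𝓘(ℝ, B) (𝓘(ℝ, B).prod 𝓘(ℝ, F)) (graphMap s) x u = v

/-- The space `Def_U(C)` of coisotropic sections. -/
def DefU (U : Set (TotalSpace F E)) (Ω : BilinField B F E) : Set (Gam B F E) :=
  {s | IsCoisotropicSection U Ω s}

variable (B F E) in
/-- The derivative of the zero section `C → E` at `x`. -/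
def zeroDeriv (x : C) :
    TangentSpace 𝓘(ℝ, B) x →L[ℝ] TT B (graphMap (0 : Gam B F E) x) :=
  mfderiv 𝓘(ℝ, B) (𝓘(ℝ, B).prod 𝓘(ℝ, F)) (graphMap (0 : Gam B F E)) x

variable (B F E) in
/-- The identification of the fibre `E_x` with the vertical tangent vectors at the zero of `E_x`:
the derivative at zero of the inclusion of the fibre (parametrized by `F ≅ E_x`). -/
def vert (x : C) : E x →L[ℝ] TT B (graphMap (0 : Gam B F E) x) :=
  (mfderiv 𝓘(ℝ, F) (𝓘(ℝ, B).prod 𝓘(ℝ, F))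
    (fun w : F => (⟨x, (trivializationAt F E x).symmL ℝ x w⟩ : TotalSpace F E)) 0 :
      F →L[ℝ] TT B (graphMap (0 : Gam B F E) x)) ∘L
    (trivializationAt F E x).continuousLinearMapAt ℝ x

/-- The kernel `K` of the presymplectic form `ω_C`, the pullback of `Ω` along the zero section. -/
def kernelDist (Ω : BilinField B F E) (x : C) : Submodule ℝ (TangentSpace 𝓘(ℝ, B) x) where
  carrier := {v | ∀ w, Ω (graphMap 0 x) (zeroDeriv B F E x v) (zeroDeriv B F E x w) = 0}
  zero_mem' := by intro w; simp
  add_mem' := by intro a b ha hb w; simp [ha w, hb w]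
  smul_mem' := by intro c a ha w; simp [ha w]

/-- The identification of `Γ(E)` with `Ω¹_F(C)`, induced by `E → K^*`, `e ↦ Ω(e, ·)|_K`. -/
def flat (Ω : BilinField B F E) : Gam B F E →ₗ[ℝ] KForm (kernelDist Ω) where
  toFun σ := fun x =>
    ((Ω (graphMap 0 x) (vert B F E x (σ x)) ∘L zeroDeriv B F E x :
      TangentSpace 𝓘(ℝ, B) x →L[ℝ] ℝ) : TangentSpace 𝓘(ℝ, B) x →ₗ[ℝ] ℝ) ∘ₗ
        (kernelDist Ω x).subtype
  map_add' σ τ := by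
    funext x
    ext v
    simp
    rfl
  map_smul' c σ := by
    funext x
    ext v
    simp
    rfl

/-! ### Families of sections and isotopies; `J` is the time interval, starting at `0` -/

/-- A smooth family of coisotropic sections, starting at the zero section. -/
structure IsCoisotropicFamily (U : Set (TotalSpace F E)) (Ω : BilinField B F E) (J : Set ℝ)
    (s : ℝ → Gam B F E) : Prop where
  smooth : ContMDiffOn (𝓘(ℝ, ℝ).prod 𝓘(ℝ, B)) (𝓘(ℝ, B).prod 𝓘(ℝ, F)) ∞
    (fun q : ℝ × C => graphMap (s q.1) q.2) (J ×ˢ univ)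
  coisotropic : ∀ t ∈ J, s t ∈ DefU U Ω
  start : s 0 = 0

/-- `σ` is the derivative of `s_t` at `t = 0`, taken in each fibre `E_x ≅ F`. -/
def IsInitialVelocity (J : Set ℝ) (s : ℝ → Gam B F E) (σ : Gam B F E) : Prop :=
  ∀ x : C, HasDerivWithinAt
    (fun t => (trivializationAt F E x).continuousLinearMapAt ℝ x (s t x))
    ((trivializationAt F E x).continuousLinearMapAt ℝ x (σ x)) J 0

/-- An isotopy of local symplectomorphisms: a smooth family of injective maps `φ_t : V → U` on an
open set `V` that preserve `Ω`, with `φ_0` the inclusion. (As `Ω` is nondegenerate, each `φ_t` is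
a diffeomorphism onto an open subset of `U`.) -/
structure IsSymplecticIsotopy (U : Set (TotalSpace F E)) (Ω : BilinField B F E) (J : Set ℝ)
    (V : Set (TotalSpace F E)) (φ : ℝ → TotalSpace F E → TotalSpace F E) : Prop where
  isOpen : IsOpen V
  subset : V ⊆ U
  smooth : ContMDiffOn (𝓘(ℝ, ℝ).prod (𝓘(ℝ, B).prod 𝓘(ℝ, F))) (𝓘(ℝ, B).prod 𝓘(ℝ, F)) ∞
    (fun q : ℝ × TotalSpace F E => φ q.1 q.2) (J ×ˢ V)
  start : ∀ p ∈ V, φ 0 p = p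
  mapsTo : ∀ t ∈ J, MapsTo (φ t) V U
  injOn : ∀ t ∈ J, InjOn (φ t) V
  symplectic : ∀ t ∈ J, ∀ p ∈ V, ∀ v w : TT B p,
    Ω (φ t p) (mfderiv (𝓘(ℝ, B).prod 𝓘(ℝ, F)) (𝓘(ℝ, B).prod 𝓘(ℝ, F)) (φ t) p v)
      (mfderiv (𝓘(ℝ, B).prod 𝓘(ℝ, F)) (𝓘(ℝ, B).prod 𝓘(ℝ, F)) (φ t) p w) = Ω p v w

/-- The velocity of the curve `t ↦ φ_t(p)`, i.e. the value at `φ_t(p)` of the time-dependent vector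
field that generates the isotopy. -/
def isotopyVelocity (J : Set ℝ) (φ : ℝ → TotalSpace F E → TotalSpace F E) (t : ℝ)
    (p : TotalSpace F E) : TT B (φ t p) :=
  mfderivWithin 𝓘(ℝ, ℝ) (𝓘(ℝ, B).prod 𝓘(ℝ, F)) (fun τ => φ τ p) J t (1 : ℝ)

/-- A Hamiltonian isotopy: the generating vector fields `X_t` on `φ_t(V)` satisfy
`Ω(X_t, ·) = dH_t` for a smooth family of functions `H_t` on `φ_t(V)`. -/
structure IsHamiltonianIsotopy (U : Set (TotalSpace F E)) (Ω : BilinField B F E) (J : Set ℝ)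
    (V : Set (TotalSpace F E)) (φ : ℝ → TotalSpace F E → TotalSpace F E) : Prop
    extends IsSymplecticIsotopy U Ω J V φ where
  hamiltonian : ∃ H : ℝ → TotalSpace F E → ℝ,
    ContMDiffOn (𝓘(ℝ, ℝ).prod (𝓘(ℝ, B).prod 𝓘(ℝ, F))) 𝓘(ℝ, ℝ) ∞
      (fun q : ℝ × TotalSpace F E => H q.1 q.2) {q | q.1 ∈ J ∧ q.2 ∈ φ q.1 '' V} ∧
    ∀ t ∈ J, ∀ p ∈ V, ∀ w : TT B (φ t p),
      Ω (φ t p) (isotopyVelocity J φ t p) w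
        = dirDeriv (𝓘(ℝ, B).prod 𝓘(ℝ, F)) (H t) (φ t p) w

/-- `s_t` is trivial under symplectic equivalence: there is a symplectic isotopy, defined near the
zero section, that maps the zero section to the graphs of the `s_t`. -/
def SymplecticallyTrivial (U : Set (TotalSpace F E)) (Ω : BilinField B F E) (J : Set ℝ)
    (s : ℝ → Gam B F E) : Prop :=
  ∃ (V : Set (TotalSpace F E)) (φ : ℝ → TotalSpace F E → TotalSpace F E),
    IsSymplecticIsotopy U Ω J V φ ∧ graph (0 : Gam B F E) ⊆ V ∧
      ∀ t ∈ J, φ t '' graph (0 : Gam B F E) = graph (s t)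

/-- `s_t` is trivial under Hamiltonian equivalence. -/
def HamiltonianTrivial (U : Set (TotalSpace F E)) (Ω : BilinField B F E) (J : Set ℝ)
    (s : ℝ → Gam B F E) : Prop :=
  ∃ (V : Set (TotalSpace F E)) (φ : ℝ → TotalSpace F E → TotalSpace F E),
    IsHamiltonianIsotopy U Ω J V φ ∧ graph (0 : Gam B F E) ⊆ V ∧
      ∀ t ∈ J, φ t '' graph (0 : Gam B F E) = graph (s t)

/-! ### The equation for coisotropic sections and its linearization -/

/-- The Poisson bivector `Π` of `Ω`: `Π(a, b) = b(Π^♯ a)`, `Π^♯ = -(Ω^♯)⁻¹`, `Ω^♯ v = Ω(v, ·)`. -/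
def poisson (Ω : BilinField B F E) (p : TotalSpace F E) (a b : TT B p →L[ℝ] ℝ) : ℝ :=
  -b ((Ω p).inverse a)

/-- The diffeomorphism `ψ_{-s} : E → E`, `(x, e) ↦ (x, e - s_x)`. -/
def shift (s : Gam B F E) (p : TotalSpace F E) : TotalSpace F E := ⟨p.1, p.2 - s p.1⟩

/-- The value of the bivector `(ψ_{-s})_* Π` at the zero of `E_x`, on two covectors. -/
def mu (Ω : BilinField B F E) (s : Gam B F E) (x : C)
    (a b : TT B (graphMap (0 : Gam B F E) x) →L[ℝ] ℝ) : ℝ :=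
  poisson Ω (graphMap s x)
    ((show (B × F) →L[ℝ] ℝ from a) ∘L
      (show (B × F) →L[ℝ] (B × F) from
        mfderiv (𝓘(ℝ, B).prod 𝓘(ℝ, F)) (𝓘(ℝ, B).prod 𝓘(ℝ, F)) (shift s) (graphMap s x)))
    ((show (B × F) →L[ℝ] ℝ from b) ∘L
      (show (B × F) →L[ℝ] (B × F) from
        mfderiv (𝓘(ℝ, B).prod 𝓘(ℝ, F)) (𝓘(ℝ, B).prod 𝓘(ℝ, F)) (shift s) (graphMap s x)))

variable (B F E) in
/-- The conormal space of the zero section at `x`, i.e. the dual of `E_x = T_x E / T_x C`. A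
bivector at `x` projects to zero in `∧²E_x` iff it vanishes on pairs of conormal covectors. -/
def IsConormal (x : C) (a : TT B (graphMap (0 : Gam B F E) x) →L[ℝ] ℝ) : Prop :=
  ∀ v : TangentSpace 𝓘(ℝ, B) x, a (zeroDeriv B F E x v) = 0

/-- The equation `μ(s) = P((ψ_{-s})_* Π) = 0` in `Γ(∧²E)`. -/
def MuEqZero (Ω : BilinField B F E) (s : Gam B F E) : Prop :=
  ∀ x a b, IsConormal B F E x a → IsConormal B F E x b → mu Ω s x a b = 0

/-- The solutions `σ` of the linearization at `s = 0` of the equation `μ(s) = 0`. -/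
def linearizedSolutions (Ω : BilinField B F E) : Set (Gam B F E) :=
  {σ | ∀ x a b, IsConormal B F E x a → IsConormal B F E x b →
    HasDerivAt (fun t : ℝ => mu Ω (t • σ) x a b) 0 0}

/-! ### Formal tangent spaces -/

/-- `σ` is the projection of the vector field `X` along the zero section to
`E ≅ T E|_C / T C`. -/
def IsNormalPart (X : ∀ p : TotalSpace F E, TT B p) (σ : Gam B F E) : Prop :=
  ∀ x : C, ∃ u : TangentSpace 𝓘(ℝ, B) x,
    X (graphMap 0 x) = vert B F E x (σ x) + zeroDeriv B F E x u

/-- The infinitesimal action of Hamiltonian vector fields, defined near `C`, on the zero section. -/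
def hamiltonianDirections (U : Set (TotalSpace F E)) (Ω : BilinField B F E) :
    Set (Gam B F E) :=
  {σ | ∃ (V : Set (TotalSpace F E)) (X : ∀ p : TotalSpace F E, TT B p) (H : TotalSpace F E → ℝ),
    IsOpen V ∧ graph (0 : Gam B F E) ⊆ V ∧ V ⊆ U ∧
    SmoothFieldOn (𝓘(ℝ, B).prod 𝓘(ℝ, F)) V X ∧
    ContMDiffOn (𝓘(ℝ, B).prod 𝓘(ℝ, F)) 𝓘(ℝ, ℝ) ∞ H V ∧
    (∀ p ∈ V, ∀ w, Ω p (X p) w = dirDeriv (𝓘(ℝ, B).prod 𝓘(ℝ, F)) H p w) ∧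
    IsNormalPart X σ}

/-- The infinitesimal action of symplectic vector fields, defined near `C`, on the zero section. -/
def symplecticDirections (U : Set (TotalSpace F E)) (Ω : BilinField B F E) :
    Set (Gam B F E) :=
  {σ | ∃ (V : Set (TotalSpace F E)) (X : ∀ p : TotalSpace F E, TT B p),
    IsOpen V ∧ graph (0 : Gam B F E) ⊆ V ∧ V ⊆ U ∧
    SmoothFieldOn (𝓘(ℝ, B).prod 𝓘(ℝ, F)) V X ∧
    OneFormClosedOn (𝓘(ℝ, B).prod 𝓘(ℝ, F)) V (fun p => Ω p (X p)) ∧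
    IsNormalPart X σ}

/-- The velocities at `t = 0` of families `s_t`, `t ∈ [0, ε)`, of coisotropic sections that are
trivial under Hamiltonian equivalence. -/
def hamiltonianVelocities (U : Set (TotalSpace F E)) (Ω : BilinField B F E) :
    Set (Gam B F E) :=
  {σ | ∃ ε > (0 : ℝ), ∃ s : ℝ → Gam B F E, IsCoisotropicFamily U Ω (Ico 0 ε) s ∧
    HamiltonianTrivial U Ω (Ico 0 ε) s ∧ IsInitialVelocity (Ico 0 ε) s σ}

/-- The velocities at `t = 0` of families `s_t`, `t ∈ [0, ε)`, of coisotropic sections that are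
trivial under symplectic equivalence. -/
def symplecticVelocities (U : Set (TotalSpace F E)) (Ω : BilinField B F E) :
    Set (Gam B F E) :=
  {σ | ∃ ε > (0 : ℝ), ∃ s : ℝ → Gam B F E, IsCoisotropicFamily U Ω (Ico 0 ε) s ∧
    SymplecticallyTrivial U Ω (Ico 0 ε) s ∧ IsInitialVelocity (Ico 0 ε) s σ}

/-- The formal tangent space at zero to `Def_U(C)`. -/
def formalTangentDef (Ω : BilinField B F E) : Submodule ℝ (Gam B F E) :=
  Submodule.span ℝ (linearizedSolutions Ω)

/-- The formal tangent space at zero to `Def_U(C)` modulo Hamiltonian equivalence. -/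
abbrev FormalTangentHam (U : Set (TotalSpace F E)) (Ω : BilinField B F E) : Type _ :=
  formalTangentDef Ω ⧸
    (Submodule.span ℝ (hamiltonianDirections U Ω)).submoduleOf (formalTangentDef Ω)

/-- The formal tangent space at zero to `Def_U(C)` modulo symplectic equivalence. -/
abbrev FormalTangentSym (U : Set (TotalSpace F E)) (Ω : BilinField B F E) : Type _ :=
  formalTangentDef Ω ⧸
    (Submodule.span ℝ (symplecticDirections U Ω)).submoduleOf (formalTangentDef Ω)

end Sections

end Coiso

end

open Coiso

/-! The work is local along the zero section. A chart of $C$ and a trivialization of $E$ give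
coordinates $(y,w)\in B\times F$ in which $C$ is $\{w=0\}$ and $\Omega$ is a field $\Theta$ of
nondegenerate skew forms (`coordBilin`) whose closedness is a cyclic identity for its derivative.

Coisotropy says that a vector at $(y,0)$ that is $\Theta$-orthogonal to $B\times 0$ lies in $B\times
0$. Hence the $\Theta$-dual of a conormal covector $\beta\in F^*$ is tangent to $C$
(`inverse_eq_kernelVec`). These duals `kernelVec β` are exactly the vectors of $K$ (`eq_kernelVec`),
and $\Theta((0,f),(\mathtt{kernelVec}\,\beta,0))=-\beta(f)$. So $E$ and $K$ are in perfect duality,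
which gives $\Gamma(E)\cong\Gamma(K^*)$ (`range_flat`). The dual vectors also form smooth local
sections of $K$, on which smoothness and closedness of foliated forms can be tested. Since $K$
annihilates $TC$ under $\Omega$, the component of a vector normal to $C$ is read off from its
pairing with $K$ (`normal_iff`). Involutivity of $K$ is the usual fact about kernels of closed
two-forms.

The analysis rests on one identity for closed $\Theta$ and a family of maps $f_t$
(`hasDerivWithinAt_pullback`): $\frac{d}{dt}f_t^*\Theta=d\bigl(f_t^*\iota_{\dot f_t}\Theta\bigr)$,
also at boundary times. It is used in three ways. For a symplectic isotopy the left side vanishes,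
so contracting $\Omega$ with the initial velocity gives a closed form; its restriction $\gamma$ to
$C$ satisfies $\gamma|_K=\Omega(\dot s_0,\cdot)|_K$, because moving along $C$ changes the pairing
with $K$ by zero. In the Hamiltonian case $\gamma=d(H_0|_C)$. For the flow of a symplectic field the
right side vanishes, so the flow preserves $\Omega$. For $f_t(y)=(y,t\sigma(y))$ it differentiates
the pullback of $\Omega$ under the graphs of $t\sigma$.

For the equation $\mu(s)=0$: in coordinates $(\psi_{-s})_*\Omega$ along $C$ is the pullback of
$\Theta$ at $(y,s(y))$ by the shear $(v,w)\mapsto(v,w+Ds\,v)$, and $\mu(s)$ is minus its inverse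
evaluated on conormal covectors (`mu_chart`). It vanishes iff duals of conormal covectors are
tangent, i.e. iff the graph is coisotropic. Differentiating the inverse along $t\sigma$ gives
$-d\alpha$ on $K\times K$ with $\alpha=\Omega(\sigma,\cdot)|_{TC}$, which is $d_{\mathfrak
F}$-closedness of the foliated form of $\sigma$ (`linearizedSolutions_eq`).

Vector fields with prescribed normal part come from pulling a function or closed form on $C$ back to
$E$ by the projection and taking its $\Omega$-dual. On compact $C$ such a field has a flow near $C$
for a uniform time. The flow depends smoothly on time and initial value, by the inverse function
theorem applied to the integral equation in $C([0,1],V)$. For small $t$ the map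
$x\mapsto\pi(\varphi_t(x))$ is a diffeomorphism of $C$, so $\varphi_t(C)$ is a graph
(`exists_family_of_flow`). The moduli statements are then quotient algebra, with the one remark that
$d_{\mathfrak F}f$ is the restriction of the closed form $df$. -/

noncomputable section

namespace Coiso

/-! ### Vector fields, brackets and one-forms in a chart -/

section Charts

variable {B H : Type*} [NormedAddCommGroup B] [NormedSpace ℝ B] [FiniteDimensional ℝ B]
  [TopologicalSpace H] (I : ModelWithCorners ℝ B H) [I.Boundaryless]
  {N : Type*} [TopologicalSpace N] [ChartedSpace H N] [IsManifold I ∞ N]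

/-- The derivative of the inverse chart centred at `x₀`. -/
def chartD (x₀ : N) (q : B) : B →L[ℝ] TangentSpace I ((extChartAt I x₀).symm q) :=
  mfderiv 𝓘(ℝ, B) I (extChartAt I x₀).symm q

variable {I} {x₀ : N} {q : B}

theorem contMDiffAt_chart_symm (hq : q ∈ (extChartAt I x₀).target) :
    ContMDiffAt 𝓘(ℝ, B) I ∞ (extChartAt I x₀).symm q :=
  (contMDiffOn_extChartAt_symm x₀).contMDiffAt ((isOpen_extChartAt_target x₀).mem_nhds hq)

theorem mdifferentiableAt_chart_symm (hq : q ∈ (extChartAt I x₀).target) :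
    MDifferentiableAt 𝓘(ℝ, B) I (extChartAt I x₀).symm q :=
  (contMDiffAt_chart_symm hq).mdifferentiableAt (by simp)

theorem contMDiffAt_chart {x : N} (hx : x ∈ (extChartAt I x₀).source) :
    ContMDiffAt I 𝓘(ℝ, B) ∞ (extChartAt I x₀) x :=
  contMDiffAt_extChartAt' (by rwa [extChartAt_source] at hx)

theorem chartD_isInvertible (hq : q ∈ (extChartAt I x₀).target) :
    (mfderiv 𝓘(ℝ, B) I (extChartAt I x₀).symm q).IsInvertible := by
  have := isInvertible_mfderivWithin_extChartAt_symm hq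
  rwa [I.range_eq_univ, mfderivWithin_univ] at this

theorem mfderiv_chart_chartD (hq : q ∈ (extChartAt I x₀).target) (v : B) :
    (mfderiv I 𝓘(ℝ, B) (extChartAt I x₀) ((extChartAt I x₀).symm q) (chartD I x₀ q v) : B) = v := by
  have := mfderiv_extChartAt_comp_mfderivWithin_extChartAt_symm hq
  rw [I.range_eq_univ, mfderivWithin_univ] at this
  exact DFunLike.congr_fun this v

theorem chartD_mfderiv_chart (hq : q ∈ (extChartAt I x₀).target)
    (v : TangentSpace I ((extChartAt I x₀).symm q)) :
    chartD I x₀ q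
      (mfderiv I 𝓘(ℝ, B) (extChartAt I x₀) ((extChartAt I x₀).symm q) v : B) = v := by
  have := mfderivWithin_extChartAt_symm_comp_mfderiv_extChartAt hq
  rw [I.range_eq_univ, mfderivWithin_univ] at this
  exact DFunLike.congr_fun this v

theorem chartD_injective (hq : q ∈ (extChartAt I x₀).target) :
    Function.Injective (chartD I x₀ q) :=
  Function.LeftInverse.injective (mfderiv_chart_chartD hq)

theorem chartD_surjective (hq : q ∈ (extChartAt I x₀).target) :
    Function.Surjective (chartD I x₀ q) :=
  Function.RightInverse.surjective (chartD_mfderiv_chart hq)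

theorem dirDeriv_chartD (hq : q ∈ (extChartAt I x₀).target) {f : N → ℝ}
    (hf : MDifferentiableAt I 𝓘(ℝ, ℝ) f ((extChartAt I x₀).symm q)) (v : B) :
    dirDeriv I f ((extChartAt I x₀).symm q) (chartD I x₀ q v)
      = fderiv ℝ (fun y => f ((extChartAt I x₀).symm y)) q v := by
  have h := mfderiv_comp q hf (mdifferentiableAt_chart_symm hq)
  rw [mfderiv_eq_fderiv] at h
  exact (DFunLike.congr_fun h v).symm

variable (I x₀) in
/-- The coordinate expression of a vector field. -/
def coordField (X : ∀ p : N, TangentSpace I p) (q : B) : B :=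
  mfderiv I 𝓘(ℝ, B) (extChartAt I x₀) ((extChartAt I x₀).symm q) (X ((extChartAt I x₀).symm q))

theorem chartD_coordField (hq : q ∈ (extChartAt I x₀).target) (X : ∀ p : N, TangentSpace I p) :
    chartD I x₀ q (coordField I x₀ X q) = X ((extChartAt I x₀).symm q) :=
  chartD_mfderiv_chart hq _

theorem inverse_chartD (hq : q ∈ (extChartAt I x₀).target) :
    (mfderiv 𝓘(ℝ, B) I (extChartAt I x₀).symm q).inverse
      = mfderiv I 𝓘(ℝ, B) (extChartAt I x₀) ((extChartAt I x₀).symm q) := by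
  have h1 := mfderiv_extChartAt_comp_mfderivWithin_extChartAt_symm hq
  have h2 := mfderivWithin_extChartAt_symm_comp_mfderiv_extChartAt hq
  rw [I.range_eq_univ, mfderivWithin_univ] at h1 h2
  exact ContinuousLinearMap.inverse_eq h2 h1

theorem coordField_eq_mpullback (hq : q ∈ (extChartAt I x₀).target)
    (X : ∀ p : N, TangentSpace I p) :
    coordField I x₀ X q = mpullback 𝓘(ℝ, B) I (extChartAt I x₀).symm X q := by
  rw [mpullback_apply, inverse_chartD hq]
  rfl

theorem contDiffAt_coordField (hq : q ∈ (extChartAt I x₀).target) {X : ∀ p : N, TangentSpace I p}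
    (hX : ContMDiffAt I I.tangent ∞ (fun p => (⟨p, X p⟩ : TangentBundle I N))
      ((extChartAt I x₀).symm q)) :
    ContDiffAt ℝ ∞ (coordField I x₀ X) q := by
  have h := ContMDiffAt.mpullback_vectorField_preimage (n := ∞) hX (contMDiffAt_chart_symm hq)
    (chartD_isInvertible hq) (by simp)
  have h2 := contMDiffAt_vectorSpace_iff_contDiffAt.1 h
  refine h2.congr_of_eventuallyEq ?_
  filter_upwards [(isOpen_extChartAt_target x₀).mem_nhds hq] with y hy
  exact coordField_eq_mpullback hy X

variable (I x₀) in
/-- The vector field with constant coordinates `v`. -/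
def frame (v : B) (p : N) : TangentSpace I p :=
  mpullback I 𝓘(ℝ, B) (extChartAt I x₀) (fun _ => v) p

theorem inverse_mfderiv_chart (hq : q ∈ (extChartAt I x₀).target) :
    (mfderiv I 𝓘(ℝ, B) (extChartAt I x₀) ((extChartAt I x₀).symm q)).inverse = chartD I x₀ q := by
  have h1 := mfderiv_extChartAt_comp_mfderivWithin_extChartAt_symm hq
  have h2 := mfderivWithin_extChartAt_symm_comp_mfderiv_extChartAt hq
  rw [I.range_eq_univ, mfderivWithin_univ] at h1 h2
  exact ContinuousLinearMap.inverse_eq h1 h2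

/-- A vector field is smooth if its coordinates are. -/
theorem contMDiffAt_field_of_coord (hq : q ∈ (extChartAt I x₀).target)
    {X : ∀ p : N, TangentSpace I p} {Y : B → B} (hY : ContDiffAt ℝ ∞ Y q)
    (h : ∀ᶠ y in 𝓝 q, X ((extChartAt I x₀).symm y) = chartD I x₀ y (Y y)) :
    ContMDiffAt I I.tangent ∞ (fun p => (⟨p, X p⟩ : TangentBundle I N))
      ((extChartAt I x₀).symm q) := by
  have hs := (extChartAt I x₀).map_target hq
  have hr := (extChartAt I x₀).right_inv hq
  have hY' : ContMDiffAt 𝓘(ℝ, B) 𝓘(ℝ, B).tangent ∞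
      (fun y => (⟨y, Y y⟩ : TangentBundle 𝓘(ℝ, B) B))
      (extChartAt I x₀ ((extChartAt I x₀).symm q)) := by
    rw [hr]
    exact contMDiffAt_vectorSpace_iff_contDiffAt.2 hY
  have h1 := ContMDiffAt.mpullback_vectorField_preimage (n := ∞) hY' (contMDiffAt_chart hs)
    (isInvertible_mfderiv_extChartAt hs) (by simp)
  refine h1.congr_of_eventuallyEq ?_
  have hc : ContinuousAt (extChartAt I x₀) ((extChartAt I x₀).symm q) :=
    continuousAt_extChartAt' (by rwa [extChartAt_source] at hs ⊢)
  have h2 := hc.eventually (by rw [hr]; exact h)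
  filter_upwards [h2, (isOpen_extChartAt_source (I := I) x₀).mem_nhds hs] with p hp hps
  have h3 := (extChartAt I x₀).left_inv hps
  have h4 := (extChartAt I x₀).map_source hps
  have h5 : ∀ p', p' = p → (X p' = mpullback I 𝓘(ℝ, B) (extChartAt I x₀) Y p') →
    (⟨p, X p⟩ : TangentBundle I N) = ⟨p, mpullback I 𝓘(ℝ, B) (extChartAt I x₀) Y p⟩ := by
    rintro p' rfl h; rw [h]
  refine h5 _ h3 ?_
  rw [hp]
  show _ = (mfderiv I 𝓘(ℝ, B) (extChartAt I x₀) _).inverse (Y (extChartAt I x₀ _))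
  rw [inverse_mfderiv_chart h4, (extChartAt I x₀).right_inv h4]
  rfl

theorem frame_chart_symm (hq : q ∈ (extChartAt I x₀).target) (v : B) :
    frame I x₀ v ((extChartAt I x₀).symm q) = chartD I x₀ q v := by
  rw [← inverse_mfderiv_chart hq]
  rfl

theorem contMDiffAt_frame (v : B) {p : N} (hp : p ∈ (extChartAt I x₀).source) :
    ContMDiffAt I I.tangent ∞ (fun p => (⟨p, frame I x₀ v p⟩ : TangentBundle I N)) p := by
  have h := contMDiffAt_field_of_coord (I := I) (x₀ := x₀) (X := frame I x₀ v) (Y := fun _ => v)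
    ((extChartAt I x₀).map_source hp) contDiffAt_const (by
      filter_upwards [(isOpen_extChartAt_target x₀).mem_nhds ((extChartAt I x₀).map_source hp)]
        with y hy
      exact frame_chart_symm hy v)
  rwa [(extChartAt I x₀).left_inv hp] at h

theorem smoothFieldOn_frame (v : B) :
    SmoothFieldOn I (extChartAt I x₀).source (frame I x₀ v) :=
  fun _ hp => (contMDiffAt_frame v hp).contMDiffWithinAt

theorem mlieBracket_eq_lieBracket {V W : ∀ x : B, TangentSpace 𝓘(ℝ, B) x} :
    mlieBracket 𝓘(ℝ, B) V W = lieBracket ℝ V W := by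
  rw [← mlieBracketWithin_univ, mlieBracketWithin_eq_lieBracketWithin]
  exact lieBracketWithin_univ

/-- Naturality of the bracket under pullback by the inverse chart, together with the fact that the
bracket only depends on germs. -/
theorem mlieBracket_chart (hq : q ∈ (extChartAt I x₀).target) {X Y : ∀ p : N, TangentSpace I p}
    (hX : ContMDiffAt I I.tangent ∞ (fun p => (⟨p, X p⟩ : TangentBundle I N))
      ((extChartAt I x₀).symm q))
    (hY : ContMDiffAt I I.tangent ∞ (fun p => (⟨p, Y p⟩ : TangentBundle I N))
      ((extChartAt I x₀).symm q)) :
    mlieBracket I X Y ((extChartAt I x₀).symm q)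
      = chartD I x₀ q (lieBracket ℝ (coordField I x₀ X) (coordField I x₀ Y) q) := by
  have h2 : minSmoothness ℝ 2 ≤ ∞ := by
    rw [minSmoothness_of_isRCLikeNormedField]
    exact ENat.LEInfty.out
  have : IsManifold I (minSmoothness ℝ 2) N := IsManifold.of_le h2
  have h := mpullback_mlieBracket (n := ∞) (hX.mdifferentiableAt (by simp))
    (hY.mdifferentiableAt (by simp)) (contMDiffAt_chart_symm hq) h2
  rw [← chartD_coordField hq (mlieBracket I X Y), coordField_eq_mpullback hq, h]
  congr 1
  have h3 : mlieBracket 𝓘(ℝ, B) (mpullback 𝓘(ℝ, B) I (extChartAt I x₀).symm X)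
      (mpullback 𝓘(ℝ, B) I (extChartAt I x₀).symm Y) q
      = mlieBracket 𝓘(ℝ, B) (coordField I x₀ X) (coordField I x₀ Y) q := by
    refine Filter.EventuallyEq.mlieBracket_vectorField_eq ?_ ?_ <;>
    filter_upwards [(isOpen_extChartAt_target x₀).mem_nhds hq] with y hy <;>
    exact (coordField_eq_mpullback hy _).symm
  rw [h3]
  exact congrFun mlieBracket_eq_lieBracket q

variable (I x₀) in
/-- The coordinate expression of a one-form. -/
def coordForm (α : ∀ p : N, TangentSpace I p →L[ℝ] ℝ) (q : B) : B →L[ℝ] ℝ :=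
  (α ((extChartAt I x₀).symm q)).comp (chartD I x₀ q)

theorem coordForm_apply (α : ∀ p : N, TangentSpace I p →L[ℝ] ℝ) (q v : B) :
    coordForm I x₀ α q v = α ((extChartAt I x₀).symm q) (chartD I x₀ q v) := rfl

theorem coordForm_coordField (hq : q ∈ (extChartAt I x₀).target)
    (α : ∀ p : N, TangentSpace I p →L[ℝ] ℝ) (X : ∀ p : N, TangentSpace I p) :
    coordForm I x₀ α q (coordField I x₀ X q)
      = α ((extChartAt I x₀).symm q) (X ((extChartAt I x₀).symm q)) := by
  rw [coordForm_apply, chartD_coordField hq]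

theorem mdifferentiableAt_of_comp_chart_symm (hq : q ∈ (extChartAt I x₀).target) {f : N → ℝ}
    (hf : DifferentiableAt ℝ (fun y => f ((extChartAt I x₀).symm y)) q) :
    MDifferentiableAt I 𝓘(ℝ, ℝ) f ((extChartAt I x₀).symm q) := by
  have hs := (extChartAt I x₀).map_target hq
  have hr := (extChartAt I x₀).right_inv hq
  have h1 := (contMDiffAt_chart hs).mdifferentiableAt (n := ∞) (by simp)
  have h2 : MDifferentiableAt 𝓘(ℝ, B) 𝓘(ℝ, ℝ) (fun y => f ((extChartAt I x₀).symm y))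
      (extChartAt I x₀ ((extChartAt I x₀).symm q)) := by
    rw [hr]; exact hf.mdifferentiableAt
  refine (h2.comp _ h1).congr_of_eventuallyEq ?_
  filter_upwards [(isOpen_extChartAt_source (I := I) x₀).mem_nhds hs] with p hp
  exact congrArg f ((extChartAt I x₀).left_inv hp).symm

/-- The exterior derivative of a one-form in coordinates. -/
theorem dOneForm_chart (hq : q ∈ (extChartAt I x₀).target) {X Y : ∀ p : N, TangentSpace I p}
    (hX : ContMDiffAt I I.tangent ∞ (fun p => (⟨p, X p⟩ : TangentBundle I N))
      ((extChartAt I x₀).symm q))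
    (hY : ContMDiffAt I I.tangent ∞ (fun p => (⟨p, Y p⟩ : TangentBundle I N))
      ((extChartAt I x₀).symm q))
    (α : ∀ p : N, TangentSpace I p →L[ℝ] ℝ) (hα : DifferentiableAt ℝ (coordForm I x₀ α) q) :
    dirDeriv I (fun p => α p (Y p)) ((extChartAt I x₀).symm q) (X ((extChartAt I x₀).symm q))
      - dirDeriv I (fun p => α p (X p)) ((extChartAt I x₀).symm q) (Y ((extChartAt I x₀).symm q))
      - α ((extChartAt I x₀).symm q) (mlieBracket I X Y ((extChartAt I x₀).symm q))
    = fderiv ℝ (coordForm I x₀ α) q (coordField I x₀ X q) (coordField I x₀ Y q)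
      - fderiv ℝ (coordForm I x₀ α) q (coordField I x₀ Y q) (coordField I x₀ X q) := by
  -- Leibniz rule $W(\alpha(Z))=(D\alpha\cdot W)(Z)+\alpha(DZ\cdot W)$ in coordinates. The second
  -- terms of the two instances cancel against $\alpha([X,Y])$.
  have key : ∀ Z W : ∀ p : N, TangentSpace I p,
      ContMDiffAt I I.tangent ∞ (fun p => (⟨p, Z p⟩ : TangentBundle I N))
        ((extChartAt I x₀).symm q) →
      dirDeriv I (fun p => α p (Z p)) ((extChartAt I x₀).symm q) (W ((extChartAt I x₀).symm q))
      = fderiv ℝ (coordForm I x₀ α) q (coordField I x₀ W q) (coordField I x₀ Z q)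
        + coordForm I x₀ α q (fderiv ℝ (coordField I x₀ Z) q (coordField I x₀ W q)) := by
    intro Z W hZ
    have hZ' := (contDiffAt_coordField hq hZ).differentiableAt (by simp)
    have he : (fun y => α ((extChartAt I x₀).symm y) (Z ((extChartAt I x₀).symm y)))
        =ᶠ[𝓝 q] fun y => coordForm I x₀ α y (coordField I x₀ Z y) := by
      filter_upwards [(isOpen_extChartAt_target x₀).mem_nhds hq] with y hy
      exact (coordForm_coordField hy α Z).symm
    have hd : DifferentiableAt ℝ (fun y => coordForm I x₀ α y (coordField I x₀ Z y)) q :=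
      hα.clm_apply hZ'
    conv_lhs => rw [← chartD_coordField hq W]
    rw [dirDeriv_chartD hq (mdifferentiableAt_of_comp_chart_symm hq (hd.congr_of_eventuallyEq he)),
      he.fderiv_eq, fderiv_clm_apply hα hZ']
    simp [add_comm]
  rw [key Y X hY, key X Y hX, mlieBracket_chart hq hX hY, ← coordForm_apply, lieBracket_eq]
  simp only [map_sub]
  ring

end Charts

/-- On a finite-dimensional space an operator is a fixed linear expression in its values on a basis,
so smoothness can be tested one vector at a time. -/
theorem contDiffAt_clm_of_apply {V G M : Type*} [NormedAddCommGroup V] [NormedSpace ℝ V]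
    [NormedAddCommGroup G] [NormedSpace ℝ G] [FiniteDimensional ℝ G] [NormedAddCommGroup M]
    [NormedSpace ℝ M] {f : V → G →L[ℝ] M} {x : V}
    (h : ∀ v, ContDiffAt ℝ ∞ (fun y => f y v) x) : ContDiffAt ℝ ∞ f x := by
  let b := Module.finBasis ℝ G
  have he : f = fun y => ∑ i, ContinuousLinearMap.smulRightL ℝ G M
      (LinearMap.toContinuousLinearMap (b.coord i)) (f y (b i)) := by
    ext y v
    conv_lhs => rw [← b.sum_repr v, map_sum]
    simp
  rw [he]
  exact ContDiffAt.sum fun i _ => (ContinuousLinearMap.contDiff _).contDiffAt.comp x (h (b i))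

/-! ### Coordinate frames, and closedness of one- and two-forms in a chart -/

section Charts

variable {B H : Type*} [NormedAddCommGroup B] [NormedSpace ℝ B] [FiniteDimensional ℝ B]
  [TopologicalSpace H] {I : ModelWithCorners ℝ B H} [I.Boundaryless]
  {N : Type*} [TopologicalSpace N] [ChartedSpace H N] [IsManifold I ∞ N] {x₀ : N} {q : B}

theorem coordField_frame (hq : q ∈ (extChartAt I x₀).target) (v : B) :
    coordField I x₀ (frame I x₀ v) q = v := by
  rw [coordField, frame_chart_symm hq]
  exact mfderiv_chart_chartD hq v

theorem mlieBracket_frame (hq : q ∈ (extChartAt I x₀).target) (v w : B) :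
    mlieBracket I (frame I x₀ v) (frame I x₀ w) ((extChartAt I x₀).symm q) = 0 := by
  have hs := (extChartAt I x₀).map_target hq
  have h : ∀ v, coordField I x₀ (frame I x₀ v) =ᶠ[𝓝 q] fun _ => v := fun v => by
    filter_upwards [(isOpen_extChartAt_target x₀).mem_nhds hq] with y hy
    exact coordField_frame hy v
  rw [mlieBracket_chart hq (contMDiffAt_frame v hs) (contMDiffAt_frame w hs),
    (h v).lieBracket_vectorField_eq (h w), lieBracket_eq]
  simp only [fderiv_fun_const, Pi.zero_apply, zero_apply, sub_self, map_zero]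

theorem isOpen_target_inter_preimage {W : Set N} (hW : IsOpen W) (x₀ : N) :
    IsOpen ((extChartAt I x₀).target ∩ (extChartAt I x₀).symm ⁻¹' W) :=
  (continuousOn_extChartAt_symm x₀).isOpen_inter_preimage (isOpen_extChartAt_target x₀) hW

/-- Testing closedness on two fields with constant coordinates leaves only the derivative of the
coefficients. -/
theorem OneFormClosedOn.symm_fderiv {W : Set N} (hW : IsOpen W)
    {α : ∀ p : N, TangentSpace I p →L[ℝ] ℝ} (h : OneFormClosedOn I W α)
    (hq : q ∈ (extChartAt I x₀).target) (hqW : (extChartAt I x₀).symm q ∈ W)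
    (hα : DifferentiableAt ℝ (coordForm I x₀ α) q) (v w : B) :
    fderiv ℝ (coordForm I x₀ α) q v w = fderiv ℝ (coordForm I x₀ α) q w v := by
  have hs := (extChartAt I x₀).map_target hq
  have h1 := h (W ∩ (extChartAt I x₀).source) (hW.inter (isOpen_extChartAt_source x₀))
    inter_subset_left (frame I x₀ v) (frame I x₀ w)
    ((smoothFieldOn_frame v).mono inter_subset_right)
    ((smoothFieldOn_frame w).mono inter_subset_right) _ ⟨hqW, hs⟩
  rw [dOneForm_chart hq (contMDiffAt_frame v hs) (contMDiffAt_frame w hs) α hα,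
    coordField_frame hq, coordField_frame hq] at h1
  exact sub_eq_zero.1 h1

/-- The coordinate formula for $d\alpha$ is tensorial and every point is the centre of its own
chart, so symmetry is only needed at chart centres. -/
theorem oneFormClosedOn_of_chart {W : Set N} {α : ∀ p : N, TangentSpace I p →L[ℝ] ℝ}
    (h : ∀ x₀ ∈ W, DifferentiableAt ℝ (coordForm I x₀ α) (extChartAt I x₀ x₀) ∧
      ∀ v w, fderiv ℝ (coordForm I x₀ α) (extChartAt I x₀ x₀) v w
        = fderiv ℝ (coordForm I x₀ α) (extChartAt I x₀ x₀) w v) :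
    OneFormClosedOn I W α := by
  intro W' hW' hsub X Y hX hY p hp
  obtain ⟨h1, h2⟩ := h p (hsub hp)
  have hq := mem_extChartAt_target (I := I) p
  have hr := extChartAt_to_inv (I := I) p
  have key := fun hX hY => dOneForm_chart hq (X := X) (Y := Y) hX hY α h1
  rw [h2, sub_self, hr] at key
  exact key (hX.contMDiffAt (hW'.mem_nhds hp)) (hY.contMDiffAt (hW'.mem_nhds hp))

variable (I x₀) in
/-- The coordinate expression of a field of bilinear forms. -/
def coordBilin (Ω : ∀ p : N, TangentSpace I p →L[ℝ] TangentSpace I p →L[ℝ] ℝ) (q : B) :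
    B →L[ℝ] B →L[ℝ] ℝ :=
  ((ContinuousLinearMap.compL ℝ B B ℝ).flip
    (chartD I x₀ q : B →L[ℝ] B)).comp ((Ω ((extChartAt I x₀).symm q) : B →L[ℝ] B →L[ℝ] ℝ).comp
      (chartD I x₀ q : B →L[ℝ] B))

theorem coordBilin_apply (Ω : ∀ p : N, TangentSpace I p →L[ℝ] TangentSpace I p →L[ℝ] ℝ)
    (q v w : B) : coordBilin I x₀ Ω q v w
      = Ω ((extChartAt I x₀).symm q) (chartD I x₀ q v) (chartD I x₀ q w) := rfl

variable {Ω : ∀ p : N, TangentSpace I p →L[ℝ] TangentSpace I p →L[ℝ] ℝ}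

theorem SmoothBilinOn.apply_apply {W : Set N} (hΩ : SmoothBilinOn I W Ω)
    {X Y : ∀ p : N, TangentSpace I p} (hX : SmoothFieldOn I W X) (hY : SmoothFieldOn I W Y) :
    ContMDiffOn I 𝓘(ℝ, ℝ) ∞ (fun p => Ω p (X p) (Y p)) W := by
  have h2 : ContMDiffOn I (I.prod 𝓘(ℝ, B →L[ℝ] ℝ)) ∞
    (fun m => TotalSpace.mk' (B →L[ℝ] ℝ) m (Ω m (X m))) W :=
    ContMDiffOn.clm_bundle_apply (E₁ := fun x : N => TangentSpace I x)
      (E₂ := fun x : N => TangentSpace I x →L[ℝ] ℝ) (b := fun x => x) hΩ hX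
  have h3 : ContMDiffOn I (I.prod 𝓘(ℝ, ℝ)) ∞
    (fun m => TotalSpace.mk' ℝ (E := Bundle.Trivial N ℝ) m (Ω m (X m) (Y m))) W :=
    ContMDiffOn.clm_bundle_apply (E₁ := fun x : N => TangentSpace I x)
      (E₂ := Bundle.Trivial N ℝ) (b := fun x => x) h2 hY
  exact fun x hx => (Bundle.contMDiffWithinAt_totalSpace.1 (h3 x hx)).2

theorem SmoothBilinOn.contDiffAt_coordBilin {W : Set N} (hW : IsOpen W) (hΩ : SmoothBilinOn I W Ω)
    (hq : q ∈ (extChartAt I x₀).target) (hqW : (extChartAt I x₀).symm q ∈ W) :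
    ContDiffAt ℝ ∞ (coordBilin I x₀ Ω) q := by
  refine contDiffAt_clm_of_apply fun v => contDiffAt_clm_of_apply fun w => ?_
  have hs := (extChartAt I x₀).map_target hq
  have h1 : ContMDiffOn I 𝓘(ℝ, ℝ) ∞ (fun p => Ω p (frame I x₀ v p) (frame I x₀ w p))
      (W ∩ (extChartAt I x₀).source) :=
    SmoothBilinOn.apply_apply (hΩ.mono inter_subset_left)
      ((smoothFieldOn_frame v).mono inter_subset_right)
      ((smoothFieldOn_frame w).mono inter_subset_right)
  have h2 := (h1.contMDiffAt ((hW.inter (isOpen_extChartAt_source x₀)).mem_nhds ⟨hqW, hs⟩)).comp q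
    (contMDiffAt_chart_symm hq)
  refine h2.contDiffAt.congr_of_eventuallyEq ?_
  filter_upwards [(isOpen_extChartAt_target x₀).mem_nhds hq] with y hy
  simp only [Function.comp_apply, coordBilin_apply, frame_chart_symm hy]

/-- Coordinate frames commute, so the three bracket terms of $d\Omega$ drop out. -/
theorem TwoFormClosedOn.cyclic {W : Set N} (hW : IsOpen W) (h : TwoFormClosedOn I W Ω)
    (hq : q ∈ (extChartAt I x₀).target) (hqW : (extChartAt I x₀).symm q ∈ W)
    (hΩ : DifferentiableAt ℝ (coordBilin I x₀ Ω) q) (u v w : B) :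
    fderiv ℝ (coordBilin I x₀ Ω) q u v w - fderiv ℝ (coordBilin I x₀ Ω) q v u w
      + fderiv ℝ (coordBilin I x₀ Ω) q w u v = 0 := by
  have hs := (extChartAt I x₀).map_target hq
  have hf := fun v : B => (smoothFieldOn_frame (I := I) (x₀ := x₀) v).mono
    (inter_subset_right : W ∩ (extChartAt I x₀).source ⊆ _)
  have h1 := h (W ∩ (extChartAt I x₀).source) (hW.inter (isOpen_extChartAt_source x₀))
    inter_subset_left _ _ _ (hf u) (hf v) (hf w) _ ⟨hqW, hs⟩
  have key : ∀ u v w : B, dirDeriv I (fun p => Ω p (frame I x₀ v p) (frame I x₀ w p))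
      ((extChartAt I x₀).symm q) (frame I x₀ u ((extChartAt I x₀).symm q))
      = fderiv ℝ (coordBilin I x₀ Ω) q u v w := by
    intro u v w
    have he : (fun y => Ω ((extChartAt I x₀).symm y) (frame I x₀ v ((extChartAt I x₀).symm y))
        (frame I x₀ w ((extChartAt I x₀).symm y))) =ᶠ[𝓝 q] fun y => coordBilin I x₀ Ω y v w := by
      filter_upwards [(isOpen_extChartAt_target x₀).mem_nhds hq] with y hy
      rw [coordBilin_apply, frame_chart_symm hy, frame_chart_symm hy]
    have hd1 : HasFDerivAt (fun y => coordBilin I x₀ Ω y v)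
        ((fderiv ℝ (coordBilin I x₀ Ω) q).flip v) q := by
      simpa using hΩ.hasFDerivAt.clm_apply (hasFDerivAt_const v q)
    have hd : HasFDerivAt (fun y => coordBilin I x₀ Ω y v w)
        (((fderiv ℝ (coordBilin I x₀ Ω) q).flip v).flip w) q := by
      simpa using hd1.clm_apply (hasFDerivAt_const w q)
    rw [frame_chart_symm hq, dirDeriv_chartD hq (mdifferentiableAt_of_comp_chart_symm hq
      (hd.differentiableAt.congr_of_eventuallyEq he)), he.fderiv_eq, hd.fderiv]
    rfl
  rw [key, key, key, mlieBracket_frame hq, mlieBracket_frame hq, mlieBracket_frame hq] at h1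
  simpa only [map_zero, zero_apply, sub_zero, add_zero] using h1

end Charts

/-! ### The inverse function theorem on a neighbourhood -/

/-- Invertibility of the derivative is an open condition. Restricting the local inverse at `a` to
points where it persists makes the inverse smooth on its whole domain, not only at `f a`. -/
theorem exists_openPartialHomeomorph_of_isInvertible {V W : Type*} [NormedAddCommGroup V]
    [NormedSpace ℝ V] [CompleteSpace V] [NormedAddCommGroup W] [NormedSpace ℝ W] {f : V → W}
    {s : Set V} (hs : IsOpen s) (hf : ContDiffOn ℝ ∞ f s) {a : V} (ha : a ∈ s)
    (h : (fderiv ℝ f a).IsInvertible) :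
    ∃ e : OpenPartialHomeomorph V W, a ∈ e.source ∧ e.source ⊆ s ∧ (∀ x, e x = f x) ∧
      (∀ x ∈ e.source, (fderiv ℝ f x).IsInvertible) ∧ ContDiffOn ℝ ∞ e.symm e.target := by
  obtain ⟨A, hA⟩ := h
  have hfa := hf.contDiffAt (hs.mem_nhds ha)
  have hd : HasFDerivAt f (A : V →L[ℝ] W) a := by
    rw [hA]; exact (hfa.differentiableAt (by simp)).hasFDerivAt
  let e₀ := hfa.toOpenPartialHomeomorph f hd (by simp)
  have he₀ : ∀ x, e₀ x = f x := fun x => rfl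
  have ha₀ : a ∈ e₀.source := hfa.mem_toOpenPartialHomeomorph_source hd (by simp)
  let T : Set V := s ∩ fderiv ℝ f ⁻¹' range ((↑) : (V ≃L[ℝ] W) → V →L[ℝ] W)
  have hT : IsOpen T :=
    (hf.continuousOn_fderiv_of_isOpen hs (by simp)).isOpen_inter_preimage hs
      ContinuousLinearEquiv.isOpen
  have haT : a ∈ T := ⟨ha, A, hA⟩
  refine ⟨e₀.restrOpen T hT, ⟨ha₀, haT⟩, fun x hx => hx.2.1, he₀, fun x hx => hx.2.2, ?_⟩
  intro y hy
  have hy' := (e₀.restrOpen T hT).map_target hy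
  obtain ⟨A', hA'⟩ := hy'.2.2
  refine (OpenPartialHomeomorph.contDiffAt_symm (f₀' := A') _ hy ?_ ?_).contDiffWithinAt
  · rw [hA']
    exact ((hf.contDiffAt (hs.mem_nhds hy'.2.1)).differentiableAt (by simp)).hasFDerivAt
  · exact hf.contDiffAt (hs.mem_nhds hy'.2.1)

/-! ### Composition operators on spaces of continuous functions -/

section Nemytskii

set_option synthInstance.maxHeartbeats 200000

universe u
variable {K : Type*} [TopologicalSpace K] [CompactSpace K]

/-- Pointwise application of a function with values in linear maps, as a bilinear map. -/
def pointwiseApply (K : Type*) [TopologicalSpace K] [CompactSpace K] (V M : Type*)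
    [NormedAddCommGroup V] [NormedSpace ℝ V] [NormedAddCommGroup M] [NormedSpace ℝ M] :
    C(K, V →L[ℝ] M) →L[ℝ] C(K, V) →L[ℝ] C(K, M) :=
  LinearMap.mkContinuous₂ (LinearMap.mk₂ ℝ
    (fun (A : C(K, V →L[ℝ] M)) (h : C(K, V)) => (⟨fun t => A t (h t), A.continuous.clm_apply h.continuous⟩ : C(K, M)))
    (fun _ _ _ => by ext; simp) (fun _ _ _ => by ext; simp) (fun _ _ _ => by ext; simp)
    (fun _ _ _ => by ext; simp)) 1 (by
      intro A h
      rw [one_mul, ContinuousMap.norm_le _ (by positivity)]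
      intro t
      exact ((A t).le_opNorm _).trans (mul_le_mul (A.norm_coe_le_norm t) (h.norm_coe_le_norm t)
        (norm_nonneg _) (norm_nonneg A)))

variable {V M : Type u} [NormedAddCommGroup V] [NormedSpace ℝ V] [NormedAddCommGroup M]
  [NormedSpace ℝ M]

/-- The operator of composition with a differentiable map. -/
theorem hasFDerivAt_postcomp {X : V → M} {X' : V → V →L[ℝ] M} (hX : ∀ v, HasFDerivAt X (X' v) v)
    (hc : Continuous X') (u : C(K, V)) :
    HasFDerivAt (fun w : C(K, V) => (⟨X, continuous_iff_continuousAt.2 fun v =>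
      (hX v).continuousAt⟩ : C(V, M)).comp w)
      (pointwiseApply K V M ((⟨X', hc⟩ : C(V, V →L[ℝ] M)).comp u)) u := by
  rw [hasFDerivAt_iff_isLittleO_nhds_zero, Asymptotics.isLittleO_iff]
  intro ε hε
  -- Composition with `X'` is continuous for the sup norm, so for small `h` the derivative varies by
  -- at most `ε` on all segments from `u t` to `u t + h t`, uniformly in `t`. The mean value
  -- inequality then bounds the remainder.
  have h1 : ContinuousAt (fun w : C(K, V) => (⟨X', hc⟩ : C(V, V →L[ℝ] M)).comp w) u :=
    (ContinuousMap.continuous_postcomp _).continuousAt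
  obtain ⟨δ, hδ, hball⟩ := (Metric.continuousAt_iff
    (f := fun w : C(K, V) => (⟨X', hc⟩ : C(V, V →L[ℝ] M)).comp w)).1 h1 ε hε
  filter_upwards [Metric.ball_mem_nhds (0 : C(K, V)) hδ] with h hh
  rw [mem_ball_zero_iff] at hh
  rw [ContinuousMap.norm_le _ (by positivity)]
  intro t
  have h2 : ∀ x ∈ segment ℝ (u t) (u t + h t), ‖X' x - X' (u t)‖ ≤ ε := by
    intro x hx
    rw [segment_eq_image'] at hx
    obtain ⟨r, hr, rfl⟩ := hx
    have h3 : dist (u + r • h) u < δ := by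
      rw [dist_eq_norm, add_sub_cancel_left, norm_smul, Real.norm_of_nonneg hr.1]
      exact (mul_le_of_le_one_left (norm_nonneg _) hr.2).trans_lt hh
    have h4 := (ContinuousMap.dist_apply_le_dist (f := (⟨X', hc⟩ : C(V, V →L[ℝ] M)).comp
      (u + r • h)) (g := (⟨X', hc⟩ : C(V, V →L[ℝ] M)).comp u) t).trans (hball h3).le
    rw [dist_eq_norm] at h4
    simpa using h4
  have h5 := (convex_segment (𝕜 := ℝ) (u t) (u t + h t)).norm_image_sub_le_of_norm_hasFDerivWithin_le'
    (fun x _ => (hX x).hasFDerivWithinAt) h2 (left_mem_segment ℝ _ _) (right_mem_segment ℝ _ _)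
  simp only [add_sub_cancel_left] at h5
  exact h5.trans (mul_le_mul_of_nonneg_left (h.norm_coe_le_norm t) hε.le)

/-- The derivative is pointwise application of the composition operator of `fderiv ℝ X`, so one
inducts on the order with the target space generalized. Taking `V` and `M` in one universe lets `V
→L[ℝ] M` replace `M`. -/
theorem contDiff_postcomp {X : V → M} (hX : ContDiff ℝ ∞ X) :
    ContDiff ℝ ∞ (fun w : C(K, V) => (⟨X, hX.continuous⟩ : C(V, M)).comp w) := by
  have hp : ∀ (M : Type u) [NormedAddCommGroup M] [NormedSpace ℝ M] (n : ℕ),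
      ContDiff ℝ n (pointwiseApply K V M) := fun M _ _ n =>
    ContinuousLinearMap.contDiff (𝕜 := ℝ) (E := C(K, V →L[ℝ] M)) (F := C(K, V) →L[ℝ] C(K, M))
      (pointwiseApply K V M)
  rw [contDiff_infty]
  intro n
  induction n generalizing M with
  | zero => exact contDiff_zero.2 (ContinuousMap.continuous_postcomp _)
  | succ n ih =>
    have h1 : ContDiff ℝ ∞ (fderiv ℝ X) := hX.fderiv_right (by simp)
    push_cast
    rw [contDiff_succ_iff_hasFDerivAt]
    exact ⟨fun u => pointwiseApply K V M ((⟨fderiv ℝ X, h1.continuous⟩ : C(V, V →L[ℝ] M)).comp u),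
      (hp M n).comp (ih h1),
      fun u => hasFDerivAt_postcomp
        (fun v => (hX.differentiable (by simp) v).hasFDerivAt) h1.continuous u⟩

end Nemytskii

/-! ### The integral equation of a flow and smooth dependence on time and initial value -/

section Integral

variable {V : Type*} [NormedAddCommGroup V] [NormedSpace ℝ V]

theorem continuous_primitive_IccExtend (u : C(unitInterval, V)) :
    Continuous fun r : ℝ => ∫ s in (0 : ℝ)..r, IccExtend zero_le_one u s :=
  intervalIntegral.continuous_primitive
    (fun a b => (u.continuous.Icc_extend').intervalIntegrable a b) 0

/-- The primitive vanishing at `0` of a continuous function on the unit interval. -/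
def primitiveCLM (V : Type*) [NormedAddCommGroup V] [NormedSpace ℝ V] :
    C(unitInterval, V) →L[ℝ] C(unitInterval, V) :=
  LinearMap.mkContinuous
    { toFun := fun u => ⟨fun r => ∫ s in (0 : ℝ)..r, IccExtend zero_le_one u s,
        (continuous_primitive_IccExtend u).comp continuous_subtype_val⟩
      map_add' := by
        intro u v
        ext r
        exact intervalIntegral.integral_add ((u.continuous.Icc_extend').intervalIntegrable _ _)
          ((v.continuous.Icc_extend').intervalIntegrable _ _)
      map_smul' := by
        intro c u
        ext r
        exact intervalIntegral.integral_smul c _ } 1 (by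
    intro u
    rw [one_mul, ContinuousMap.norm_le _ (norm_nonneg _)]
    intro r
    refine (intervalIntegral.norm_integral_le_of_norm_le_const (C := ‖u‖)
      fun s _ => u.norm_coe_le_norm _).trans ?_
    rw [sub_zero, abs_of_nonneg r.2.1]
    exact mul_le_of_le_one_right (norm_nonneg _) r.2.2)

end Integral

section Flow

universe u
variable {V : Type u} [NormedAddCommGroup V] [NormedSpace ℝ V]

/-- The constant functions on the unit interval. -/
def constCLM (V : Type u) [NormedAddCommGroup V] [NormedSpace ℝ V] : V →L[ℝ] C(unitInterval, V) :=
  LinearMap.mkContinuous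
    { toFun := fun v => ContinuousMap.const _ v
      map_add' := fun _ _ => rfl
      map_smul' := fun _ _ => rfl } 1 (fun v => by
    rw [one_mul, ContinuousMap.norm_le _ (norm_nonneg _)]
    exact fun _ => le_rfl)

variable [CompleteSpace V]

/-- The integral equation of the rescaled flow has a solution that depends smoothly on the time and
the initial value. -/
theorem exists_contDiffOn_integral_solution {X : V → V} (hX : ContDiff ℝ ∞ X) (x₀ : V) :
    ∃ A : Set (ℝ × V), IsOpen A ∧ ((0 : ℝ), x₀) ∈ A ∧ ∃ u : ℝ × V → C(unitInterval, V),
      ContDiffOn ℝ ∞ u A ∧ ∀ p ∈ A, u p = constCLM V p.2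
        + p.1 • primitiveCLM V ((⟨X, hX.continuous⟩ : C(V, V)).comp (u p)) := by
  let Z := C(unitInterval, V)
  let N : Z → Z := fun u => (⟨X, hX.continuous⟩ : C(V, V)).comp u
  have hN : ContDiff ℝ ∞ N := contDiff_postcomp hX
  have hS : ContDiff ℝ ∞ (fun u : Z => primitiveCLM V (N u)) :=
    (ContinuousLinearMap.contDiff (𝕜 := ℝ) (E := Z) (F := Z) (primitiveCLM V)).comp hN
  have hc : ContDiff ℝ ∞ (fun v : V => constCLM V v) :=
    ContinuousLinearMap.contDiff (𝕜 := ℝ) (E := V) (F := Z) (constCLM V)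
  -- In the rescaled time $r\in[0,1]$ the flow line over $[0,t]$ solves $u=x+t\int_0^r X(u)$. The
  -- second component of `f` is the defect of this equation, so a solution for `p` is a preimage of
  -- `(p, 0)`.
  let f : (ℝ × V) × Z → (ℝ × V) × Z :=
    fun q => (q.1, q.2 - (constCLM V q.1.2 + q.1.1 • primitiveCLM V (N q.2)))
  have hf : ContDiff ℝ ∞ f := contDiff_fst.prodMk (contDiff_snd.sub
    ((hc.comp (contDiff_snd.comp contDiff_fst)).add
      ((contDiff_fst.comp contDiff_fst).smul (hS.comp contDiff_snd))))
  let a : (ℝ × V) × Z := ((0, x₀), constCLM V x₀)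
  let c : Z := primitiveCLM V (N a.2)
  let L : (ℝ × V) →L[ℝ] Z := (constCLM V).comp (ContinuousLinearMap.snd ℝ ℝ V)
    + (ContinuousLinearMap.fst ℝ ℝ V).smulRight c
  -- At $t=0$ the nonlinear term has zero derivative in `u`. So the derivative of `f` is unipotent,
  -- and `D'` is its inverse.
  let D : ((ℝ × V) × Z) →L[ℝ] (ℝ × V) × Z := (ContinuousLinearMap.fst ℝ (ℝ × V) Z).prod
    (ContinuousLinearMap.snd ℝ (ℝ × V) Z - L.comp (ContinuousLinearMap.fst ℝ (ℝ × V) Z))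
  let D' : ((ℝ × V) × Z) →L[ℝ] (ℝ × V) × Z := (ContinuousLinearMap.fst ℝ (ℝ × V) Z).prod
    (ContinuousLinearMap.snd ℝ (ℝ × V) Z + L.comp (ContinuousLinearMap.fst ℝ (ℝ × V) Z))
  have hD : HasFDerivAt f D a := by
    have h1 : HasFDerivAt (fun q : (ℝ × V) × Z => q.1.1 • primitiveCLM V (N q.2)) _ a :=
      (((ContinuousLinearMap.fst ℝ ℝ V).comp (ContinuousLinearMap.fst ℝ (ℝ × V) Z)).hasFDerivAt
        (x := a)).smul (((hS.differentiable (by simp)) a.2).hasFDerivAt.comp a hasFDerivAt_snd)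
    have h2 : HasFDerivAt (fun q : (ℝ × V) × Z => constCLM V q.1.2) _ a :=
      ((constCLM V).comp ((ContinuousLinearMap.snd ℝ ℝ V).comp
        (ContinuousLinearMap.fst ℝ (ℝ × V) Z))).hasFDerivAt
    have h3 := hasFDerivAt_fst.prodMk ((hasFDerivAt_snd (p := a) (𝕜 := ℝ)).sub (h2.add h1))
    refine h3.congr_fderiv ?_
    refine ContinuousLinearMap.ext fun q => Prod.ext rfl ?_
    simp [D, L, a, c]
  have hinv : (fderiv ℝ f a).IsInvertible := by
    rw [hD.fderiv]
    refine ContinuousLinearMap.IsInvertible.of_inverse (g := D') ?_ ?_ <;>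
    · refine ContinuousLinearMap.ext fun q => Prod.ext rfl ?_
      simp [D, D']
  obtain ⟨e, hae, -, hef, -, hsm⟩ :=
    exists_openPartialHomeomorph_of_isInvertible isOpen_univ hf.contDiffOn (mem_univ a) hinv
  have hι : ContDiff ℝ ∞ (fun p : ℝ × V => (p, (0 : Z))) := contDiff_id.prodMk contDiff_const
  refine ⟨(fun p : ℝ × V => (p, (0 : Z))) ⁻¹' e.target, e.open_target.preimage hι.continuous, ?_,
    fun p => (e.symm (p, 0)).2, contDiff_snd.comp_contDiffOn (hsm.comp hι.contDiffOn
      (mapsTo_preimage _ _)), ?_⟩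
  · have h1 := e.map_source hae
    rw [hef] at h1
    have h2 : f a = ((0, x₀), 0) := by simp [f, a]
    rwa [h2] at h1
  · intro p hp
    have h1 := e.right_inv hp
    rw [hef] at h1
    have h2 : (e.symm (p, 0)).1 = p := congrArg Prod.fst h1
    have h3 := sub_eq_zero.1 (congrArg Prod.snd h1)
    rw [h2] at h3
    exact h3

/-- Picard–Lindelöf provides the flow lines, the integral equation provides a smooth candidate.
Uniqueness, available thanks to the global Lipschitz bound, identifies `α x t` with `u (t, x) 1`. -/
theorem exists_flow_of_lipschitz {X : V → V} (hX : ContDiff ℝ ∞ X) {K : NNReal}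
    (hK : LipschitzWith K X) (x₀ : V) :
    ∃ ε > (0 : ℝ), ∃ r > (0 : ℝ), ∃ φ : ℝ → V → V,
      ContDiffOn ℝ ∞ (fun p : ℝ × V => φ p.1 p.2) (Ioo (-ε) ε ×ˢ Metric.ball x₀ r) ∧
      ∀ x ∈ Metric.ball x₀ r, φ 0 x = x ∧
        ∀ t ∈ Ioo (-ε) ε, HasDerivAt (fun t => φ t x) (X (φ t x)) t := by
  obtain ⟨A, hA, h0A, u, hu, huA⟩ := exists_contDiffOn_integral_solution hX x₀
  obtain ⟨r₁, hr₁, ε₁, hε₁, h⟩ :=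
    (hX.contDiffAt (x := x₀)).of_le (n := ∞) (m := 1)
      (by exact ENat.LEInfty.out) |>.exists_forall_mem_closedBall_exists_eq_forall_mem_Ioo_hasDerivAt 0
  choose! α hα using h
  obtain ⟨δ, hδ, hball⟩ := Metric.isOpen_iff.1 hA _ h0A
  set ε := min ε₁ δ
  set r := min r₁ δ
  have hsub : Ioo (-ε) ε ×ˢ Metric.ball x₀ r ⊆ A := by
    rintro ⟨t, x⟩ ⟨ht, hx⟩
    apply hball
    rw [← ball_prod_same]
    refine ⟨?_, Metric.ball_subset_ball (min_le_right _ _) hx⟩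
    rw [Real.ball_eq_Ioo, zero_sub, zero_add]
    exact Ioo_subset_Ioo (neg_le_neg (min_le_right _ _)) (min_le_right _ _) ht
  have hαx : ∀ x ∈ Metric.ball x₀ r, α x 0 = x ∧ ∀ t ∈ Ioo (-ε) ε,
      HasDerivAt (α x) (X (α x t)) t := by
    intro x hx
    have hx' : x ∈ Metric.closedBall x₀ r₁ :=
      Metric.ball_subset_closedBall (Metric.ball_subset_ball (min_le_left _ _) hx)
    refine ⟨(hα x hx').1, fun t ht => (hα x hx').2 t ?_⟩
    rw [zero_sub, zero_add]
    exact Ioo_subset_Ioo (neg_le_neg (min_le_left _ _)) (min_le_left _ _) ht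
  have key : ∀ p ∈ Ioo (-ε) ε ×ˢ Metric.ball x₀ r, α p.2 p.1 = u p 1 := by
    rintro ⟨t, x⟩ ⟨ht, hx⟩
    obtain ⟨hx0, hxd⟩ := hαx x hx
    have hut := huA _ (hsub ⟨ht, hx⟩)
    set U := IccExtend (zero_le_one (α := ℝ)) (u (t, x))
    have hUc : Continuous U := (u (t, x)).continuous.Icc_extend'
    -- On $[0,1]$ this is `U`, but it is differentiable from both sides at the end points, where the
    -- constantly extended `U` need not be.
    let w : ℝ → V := fun r => x + t • ∫ s in (0 : ℝ)..r, X (U s)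
    have hwU : ∀ r ∈ Icc (0 : ℝ) 1, w r = U r := by
      intro r hr
      have h1 := DFunLike.congr_fun hut ⟨r, hr⟩
      have h2 : U r = u (t, x) ⟨r, hr⟩ := IccExtend_of_mem _ _ hr
      rw [h2, h1]
      rfl
    have hw : ∀ r ∈ Icc (0 : ℝ) 1, HasDerivAt w (t • X (w r)) r := by
      intro r hr
      rw [hwU r hr]
      exact ((intervalIntegral.integral_hasDerivAt_right
        ((hX.continuous.comp hUc).intervalIntegrable _ _)
        ((hX.continuous.comp hUc).stronglyMeasurableAtFilter _ _)
        (hX.continuous.comp hUc).continuousAt).const_smul t).const_add x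
    have hv : ∀ r ∈ Icc (0 : ℝ) 1, HasDerivAt (fun r => α x (t * r)) (t • X (α x (t * r))) r := by
      intro r hr
      have htr : t * r ∈ Ioo (-ε) ε := by
        refine abs_lt.1 (lt_of_le_of_lt ?_ (abs_lt.2 ht))
        rw [abs_mul, abs_of_nonneg hr.1]
        exact mul_le_of_le_one_right (abs_nonneg _) hr.2
      have h1 := (hxd _ htr).scomp r ((hasDerivAt_id r).const_mul t)
      simpa [Function.comp_def] using h1
    have h := ODE_solution_unique (v := fun _ y => t • X y) (K := ‖t‖₊ * K)
      (fun _ => (lipschitzWith_smul t).comp hK)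
      (HasDerivAt.continuousOn hv) (fun r hr => (hv r (Ico_subset_Icc_self hr)).hasDerivWithinAt)
      (HasDerivAt.continuousOn hw) (fun r hr => (hw r (Ico_subset_Icc_self hr)).hasDerivWithinAt)
      (by simp [w, hx0]) (right_mem_Icc.2 zero_le_one)
    simp only [mul_one] at h
    rw [h, hwU 1 (right_mem_Icc.2 zero_le_one)]
    exact IccExtend_of_mem _ _ (right_mem_Icc.2 zero_le_one)
  refine ⟨ε, lt_min hε₁ hδ, r, lt_min hr₁ hδ, fun t x => α x t, ?_, hαx⟩
  refine ContDiffOn.congr ?_ key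
  have h1 : ContDiff ℝ ∞ (fun u : C(unitInterval, V) => u 1) :=
    ContinuousLinearMap.contDiff (𝕜 := ℝ) (E := C(unitInterval, V)) (F := V)
      (ContinuousMap.evalCLM ℝ 1)
  exact h1.comp_contDiffOn (hu.mono hsub)

end Flow

/-- A bump function supported in `O` makes the field globally smooth with compact support, hence
Lipschitz. For short times, orbits starting near `x₀` stay where the bump equals one and so follow
the original field. -/
theorem exists_flow_of_contDiffOn {V : Type*} [NormedAddCommGroup V] [NormedSpace ℝ V]
    [FiniteDimensional ℝ V] {X : V → V} {O : Set V} (hO : IsOpen O) (hX : ContDiffOn ℝ ∞ X O)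
    {x₀ : V} (hx₀ : x₀ ∈ O) :
    ∃ ε > (0 : ℝ), ∃ A : Set V, IsOpen A ∧ x₀ ∈ A ∧ ∃ φ : ℝ → V → V,
      ContDiffOn ℝ ∞ (fun p : ℝ × V => φ p.1 p.2) (Ioo (-ε) ε ×ˢ A) ∧
      ∀ x ∈ A, φ 0 x = x ∧
        ∀ t ∈ Ioo (-ε) ε, φ t x ∈ O ∧ HasDerivAt (fun t => φ t x) (X (φ t x)) t := by
  obtain ⟨ρ, hρ, hball⟩ := Metric.isOpen_iff.1 hO x₀ hx₀
  let χ : ContDiffBump x₀ := ⟨ρ / 4, ρ / 2, by positivity, by linarith⟩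
  have hts : tsupport χ ⊆ O := by
    rw [χ.tsupport_eq]
    exact (Metric.closedBall_subset_ball (by simp only [χ]; linarith)).trans hball
  have hX' : ContDiff ℝ ∞ fun x => χ x • X x := by
    rw [contDiff_iff_contDiffAt]
    intro x
    by_cases hx : x ∈ tsupport χ
    · exact χ.contDiffAt.smul (hX.contDiffAt (hO.mem_nhds (hts hx)))
    · refine (contDiffAt_const (c := (0 : V))).congr_of_eventuallyEq ?_
      filter_upwards [notMem_tsupport_iff_eventuallyEq.1 hx] with y hy
      simp [hy]
  obtain ⟨K, hK⟩ := hX'.lipschitzWith_of_hasCompactSupport χ.hasCompactSupport.smul_right (by simp)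
  obtain ⟨ε, hε, r, hr, φ, hφ, h⟩ := exists_flow_of_lipschitz hX' hK x₀
  have h0 : ((0 : ℝ), x₀) ∈ Ioo (-ε) ε ×ˢ Metric.ball x₀ r :=
    ⟨⟨neg_lt_zero.2 hε, hε⟩, Metric.mem_ball_self hr⟩
  have hc := hφ.continuousOn.continuousAt ((isOpen_Ioo.prod Metric.isOpen_ball).mem_nhds h0)
  have hn : Metric.ball x₀ (ρ / 4) ∈ 𝓝 (φ 0 x₀) := by
    rw [(h x₀ h0.2).1]
    exact Metric.ball_mem_nhds _ (by positivity)
  obtain ⟨δ, hδ, hsub⟩ := Metric.mem_nhds_iff.1 (hc hn)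
  rw [← ball_prod_same, Real.ball_eq_Ioo, zero_sub, zero_add] at hsub
  refine ⟨min ε δ, lt_min hε hδ, Metric.ball x₀ (min r δ), Metric.isOpen_ball,
    Metric.mem_ball_self (lt_min hr hδ), φ, hφ.mono (prod_mono
      (Ioo_subset_Ioo (neg_le_neg (min_le_left _ _)) (min_le_left _ _))
      (Metric.ball_subset_ball (min_le_left _ _))), fun x hx => ?_⟩
  obtain ⟨h1, h2⟩ := h x (Metric.ball_subset_ball (min_le_left _ _) hx)
  refine ⟨h1, fun t ht => ?_⟩
  have h3 : φ t x ∈ Metric.ball x₀ (ρ / 4) := hsub (a := (t, x))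
    ⟨Ioo_subset_Ioo (neg_le_neg (min_le_right _ _)) (min_le_right _ _) ht,
      Metric.ball_subset_ball (min_le_right _ _) hx⟩
  have h4 : χ (φ t x) = 1 := χ.one_of_mem_closedBall (Metric.ball_subset_closedBall h3)
  refine ⟨hball (Metric.ball_subset_ball (by linarith) h3), ?_⟩
  have h5 := h2 t (Ioo_subset_Ioo (neg_le_neg (min_le_left _ _)) (min_le_left _ _) ht)
  rwa [h4, one_smul] at h5

/-! ### Local flows on manifolds -/

section Manifold

variable {B H : Type*} [NormedAddCommGroup B] [NormedSpace ℝ B] [FiniteDimensional ℝ B]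
  [TopologicalSpace H] (I : ModelWithCorners ℝ B H) [I.Boundaryless]
  {N : Type*} [TopologicalSpace N] [ChartedSpace H N] [IsManifold I ∞ N]

/-- `φ` is the flow of the vector field `X` for times in `(-ε, ε)`, with initial values in the open
set `V`; it takes values in `U`. -/
structure IsLocalFlow (U : Set N) (X : ∀ p : N, TangentSpace I p) (V : Set N) (ε : ℝ)
    (φ : ℝ → N → N) : Prop where
  isOpen : IsOpen V
  smooth : ContMDiffOn (𝓘(ℝ, ℝ).prod I) I ∞ (fun q : ℝ × N => φ q.1 q.2) (Ioo (-ε) ε ×ˢ V)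
  start : ∀ p ∈ V, φ 0 p = p
  mem : ∀ p ∈ V, ∀ t ∈ Ioo (-ε) ε, φ t p ∈ U
  deriv : ∀ p ∈ V, ∀ t ∈ Ioo (-ε) ε, HasMFDerivAt 𝓘(ℝ, ℝ) I (fun τ => φ τ p) t
    ((1 : ℝ →L[ℝ] ℝ).smulRight (X (φ t p)))

variable {I}

theorem IsLocalFlow.mono {U : Set N} {X : ∀ p : N, TangentSpace I p} {V V' : Set N} {ε ε' : ℝ}
    {φ : ℝ → N → N} (h : IsLocalFlow I U X V ε φ) (hV' : IsOpen V') (hV : V' ⊆ V) (hε : ε' ≤ ε) :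
    IsLocalFlow I U X V' ε' φ where
  isOpen := hV'
  smooth := h.smooth.mono (prod_mono (Ioo_subset_Ioo (neg_le_neg hε) hε) hV)
  start p hp := h.start p (hV hp)
  mem p hp t ht := h.mem p (hV hp) t (Ioo_subset_Ioo (neg_le_neg hε) hε ht)
  deriv p hp t ht := h.deriv p (hV hp) t (Ioo_subset_Ioo (neg_le_neg hε) hε ht)

theorem exists_isLocalFlow {U : Set N} (hU : IsOpen U) {X : ∀ p : N, TangentSpace I p}
    (hX : SmoothFieldOn I U X) {p₀ : N} (hp₀ : p₀ ∈ U) :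
    ∃ (V : Set N) (ε : ℝ) (φ : ℝ → N → N), p₀ ∈ V ∧ 0 < ε ∧ IsLocalFlow I U X V ε φ := by
  have hO := isOpen_target_inter_preimage (I := I) hU p₀
  have hq₀ := mem_extChartAt_target (I := I) p₀
  obtain ⟨ε, hε, A, hA, hxA, φ, hφ, h⟩ := exists_flow_of_contDiffOn hO
    (X := coordField I p₀ X) (fun q hq => (contDiffAt_coordField hq.1
      (hX.contMDiffAt (hU.mem_nhds hq.2))).contDiffWithinAt)
    (x₀ := extChartAt I p₀ p₀) ⟨hq₀, by rwa [mem_preimage, extChartAt_to_inv]⟩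
  have hsrc : ∀ p ∈ (extChartAt I p₀).source ∩ extChartAt I p₀ ⁻¹' A,
    extChartAt I p₀ p ∈ A := fun p hp => hp.2
  refine ⟨(extChartAt I p₀).source ∩ extChartAt I p₀ ⁻¹' A, ε,
    fun t p => (extChartAt I p₀).symm (φ t (extChartAt I p₀ p)),
    ⟨mem_extChartAt_source p₀, hxA⟩, hε, ?_, ?_, ?_, ?_, ?_⟩
  · exact (continuousOn_extChartAt p₀).isOpen_inter_preimage (isOpen_extChartAt_source p₀) hA
  · rintro ⟨t, p⟩ ⟨ht, hp⟩
    have h1 : ContMDiffAt (𝓘(ℝ, ℝ).prod I) 𝓘(ℝ, ℝ × B) ∞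
        (fun q : ℝ × N => (q.1, extChartAt I p₀ q.2)) (t, p) :=
      contMDiffAt_fst.prodMk_space ((contMDiffAt_chart hp.1).comp (t, p) contMDiffAt_snd)
    have h2 : ContMDiffAt 𝓘(ℝ, ℝ × B) 𝓘(ℝ, B) ∞ (fun q : ℝ × B => φ q.1 q.2)
        (t, extChartAt I p₀ p) :=
      (hφ.contDiffAt ((isOpen_Ioo.prod hA).mem_nhds
        (show (t, extChartAt I p₀ p) ∈ Ioo (-ε) ε ×ˢ A from ⟨ht, hp.2⟩))).contMDiffAt
    have h3 := contMDiffAt_chart_symm ((h _ hp.2).2 t ht).1.1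
    exact (ContMDiffAt.comp (t, p) (f := fun q : ℝ × N => φ q.1 (extChartAt I p₀ q.2)) h3
      (ContMDiffAt.comp (t, p) (g := fun q : ℝ × B => φ q.1 q.2) h2 h1)).contMDiffWithinAt
  · intro p hp
    simp only [(h _ hp.2).1, (extChartAt I p₀).left_inv hp.1]
  · intro p hp t ht
    exact ((h _ hp.2).2 t ht).1.2
  · intro p hp t ht
    obtain ⟨h1, h2⟩ := (h _ hp.2).2 t ht
    have h3 := (mdifferentiableAt_chart_symm h1.1).hasMFDerivAt.comp t
      h2.hasFDerivAt.hasMFDerivAt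
    refine h3.congr_mfderiv ?_
    refine ContinuousLinearMap.ext fun c => ?_
    have h4 := chartD_coordField h1.1 X
    rw [← h4]
    exact map_smul (chartD I p₀ (φ t (extChartAt I p₀ p))) (show ℝ from c) _

/-- The set of times near which the curves agree is open. It is relatively closed because distinct
limits in a Hausdorff space would separate the curves, and local uniqueness turns equality at a time
into equality near it. The interval is connected. -/
theorem eqOn_Ioo_of_integralCurves [T2Space N] {U : Set N} (hU : IsOpen U)
    {X : ∀ p : N, TangentSpace I p} (hX : SmoothFieldOn I U X) {ε t₀ : ℝ} (ht₀ : t₀ ∈ Ioo (-ε) ε)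
    {γ γ' : ℝ → N}
    (hγU : ∀ t ∈ Ioo (-ε) ε, γ t ∈ U)
    (hγ : ∀ t ∈ Ioo (-ε) ε, HasMFDerivAt 𝓘(ℝ, ℝ) I γ t ((1 : ℝ →L[ℝ] ℝ).smulRight (X (γ t))))
    (hγ' : ∀ t ∈ Ioo (-ε) ε, HasMFDerivAt 𝓘(ℝ, ℝ) I γ' t ((1 : ℝ →L[ℝ] ℝ).smulRight (X (γ' t))))
    (h : γ t₀ = γ' t₀) : EqOn γ γ' (Ioo (-ε) ε) := by
  have hloc : ∀ t ∈ Ioo (-ε) ε, γ t = γ' t → γ =ᶠ[𝓝 t] γ' := fun t ht heq => by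
    have hn := isOpen_Ioo.mem_nhds ht
    exact isMIntegralCurveAt_eventuallyEq_of_contMDiffAt_boundaryless
      ((hX.contMDiffAt (hU.mem_nhds (hγU t ht))).of_le ENat.LEInfty.out)
      (Filter.mem_of_superset hn hγ) (Filter.mem_of_superset hn hγ') heq
  have hsub : Ioo (-ε) ε ⊆ {t | γ =ᶠ[𝓝 t] γ'} := by
    refine isPreconnected_Ioo.subset_of_closure_inter_subset isOpen_setOfPred_eventually_nhds
      ⟨t₀, ht₀, hloc t₀ ht₀ h⟩ ?_
    rintro t ⟨htc, ht⟩
    refine hloc t ht ?_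
    by_contra hne
    have hc : ContinuousAt (fun s => (γ s, γ' s)) t :=
      (hγ t ht).continuousAt.prodMk (hγ' t ht).continuousAt
    have hn := hc.preimage_mem_nhds (isClosed_diagonal.isOpen_compl.mem_nhds
      (show (γ t, γ' t) ∈ (diagonal N)ᶜ from hne))
    obtain ⟨s, hs1, hs2⟩ := mem_closure_iff_nhds.1 htc _ hn
    exact hs1 hs2.self_of_nhds
  exact fun t ht => (hsub ht).self_of_nhds

/-- Two orbits that meet at time `t` coincide on the whole interval, in particular at time zero. -/
theorem IsLocalFlow.injOn [T2Space N] {U : Set N} (hU : IsOpen U)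
    {X : ∀ p : N, TangentSpace I p} (hX : SmoothFieldOn I U X) {V : Set N} {ε : ℝ} {φ : ℝ → N → N}
    (h : IsLocalFlow I U X V ε φ) {t : ℝ} (ht : t ∈ Ioo (-ε) ε) : InjOn (φ t) V := by
  intro p hp q hq heq
  have h0 : (0 : ℝ) ∈ Ioo (-ε) ε := by
    have := ht.1.trans ht.2
    constructor <;> linarith
  have := eqOn_Ioo_of_integralCurves hU hX ht (h.mem p hp) (h.deriv p hp) (h.deriv q hq) heq h0
  simpa only [h.start p hp, h.start q hq] using this

/-- Flows on two open sets agree on the overlap by uniqueness of integral curves, so they glue over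
the smaller time interval. Compactness reduces to finitely many gluings, which keeps the time
positive. -/
theorem exists_isLocalFlow_of_isCompact [T2Space N] {U : Set N} (hU : IsOpen U)
    {X : ∀ p : N, TangentSpace I p} (hX : SmoothFieldOn I U X) {Q : Set N} (hQ : IsCompact Q)
    (hQU : Q ⊆ U) :
    ∃ (V : Set N) (ε : ℝ) (φ : ℝ → N → N), Q ⊆ V ∧ 0 < ε ∧ IsLocalFlow I U X V ε φ := by
  classical
  refine hQ.induction_on (p := fun Q => ∃ (V : Set N) (ε : ℝ) (φ : ℝ → N → N), Q ⊆ V ∧ 0 < ε ∧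
    IsLocalFlow I U X V ε φ) ?_ ?_ ?_ ?_
  · refine ⟨∅, 1, fun _ p => p, Subset.rfl, one_pos, isOpen_empty, ?_, ?_, ?_, ?_⟩
    · rw [prod_empty]
      exact contMDiffOn_empty
    all_goals exact fun p hp => hp.elim
  · rintro s t hst ⟨V, ε, φ, h1, h2⟩
    exact ⟨V, ε, φ, hst.trans h1, h2⟩
  · rintro s t ⟨V₁, ε₁, φ₁, hs₁, hε₁, h₁⟩ ⟨V₂, ε₂, φ₂, hs₂, hε₂, h₂⟩
    have hε := lt_min hε₁ hε₂
    have h₁' := h₁.mono h₁.isOpen Subset.rfl (min_le_left ε₁ ε₂)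
    have h₂' := h₂.mono h₂.isOpen Subset.rfl (min_le_right ε₁ ε₂)
    set ε := min ε₁ ε₂
    let φ : ℝ → N → N := fun t p => if p ∈ V₁ then φ₁ t p else φ₂ t p
    have e₁ : ∀ p ∈ V₁, ∀ t, φ t p = φ₁ t p := fun p hp t => if_pos hp
    have e₂ : ∀ p ∈ V₂, ∀ t ∈ Ioo (-ε) ε, φ t p = φ₂ t p := by
      intro p hp t ht
      by_cases hp₁ : p ∈ V₁
      · rw [e₁ p hp₁]
        refine eqOn_Ioo_of_integralCurves hU hX (t₀ := 0) ⟨neg_lt_zero.2 hε, hε⟩ (h₁'.mem p hp₁)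
          (h₁'.deriv p hp₁) (h₂'.deriv p hp) ?_ ht
        simp only [h₁.start p hp₁, h₂.start p hp]
      · exact if_neg hp₁
    refine ⟨V₁ ∪ V₂, ε, φ, union_subset_union hs₁ hs₂, hε, h₁.isOpen.union h₂.isOpen,
      ?_, ?_, ?_, ?_⟩
    · rintro ⟨t, p⟩ ⟨ht, hp | hp⟩
      · refine ((h₁'.smooth.contMDiffAt ((isOpen_Ioo.prod h₁.isOpen).mem_nhds
          ⟨ht, hp⟩)).congr_of_eventuallyEq ?_).contMDiffWithinAt
        filter_upwards [(isOpen_Ioo.prod h₁.isOpen).mem_nhds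
          (show (t, p) ∈ Ioo (-ε) ε ×ˢ V₁ from ⟨ht, hp⟩)] with q hq
        exact e₁ _ hq.2 _
      · refine ((h₂'.smooth.contMDiffAt ((isOpen_Ioo.prod h₂.isOpen).mem_nhds
          ⟨ht, hp⟩)).congr_of_eventuallyEq ?_).contMDiffWithinAt
        filter_upwards [(isOpen_Ioo.prod h₂.isOpen).mem_nhds
          (show (t, p) ∈ Ioo (-ε) ε ×ˢ V₂ from ⟨ht, hp⟩)] with q hq
        exact e₂ _ hq.2 _ hq.1
    · rintro p (hp | hp)
      · rw [e₁ p hp, h₁.start p hp]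
      · rw [e₂ p hp 0 ⟨neg_lt_zero.2 hε, hε⟩, h₂.start p hp]
    · rintro p (hp | hp) t ht
      · rw [e₁ p hp]
        exact h₁'.mem p hp t ht
      · rw [e₂ p hp t ht]
        exact h₂'.mem p hp t ht
    · rintro p (hp | hp) t ht
      · rw [e₁ p hp t]
        exact (h₁'.deriv p hp t ht).congr_of_eventuallyEq (Filter.Eventually.of_forall (e₁ p hp))
      · rw [e₂ p hp t ht]
        refine (h₂'.deriv p hp t ht).congr_of_eventuallyEq ?_
        filter_upwards [isOpen_Ioo.mem_nhds ht] with τ hτ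
        exact e₂ p hp τ hτ
  · intro p hp
    obtain ⟨V, ε, φ, h1, h2, h3⟩ := exists_isLocalFlow hU hX (hQU hp)
    exact ⟨V, mem_nhdsWithin_of_mem_nhds (h3.isOpen.mem_nhds h1), V, ε, φ, Subset.rfl, h2, h3⟩

end Manifold

/-! ### Closed forms on vector spaces: Cartan's formula, kernels, pullbacks -/

section VectorSpace

variable {V M : Type*} [NormedAddCommGroup V] [NormedSpace ℝ V]
  [NormedAddCommGroup M] [NormedSpace ℝ M]

/-- The pullback of a one-form under a family of maps, contracted with the velocity. -/
def velocityForm (Θ : M → M →L[ℝ] M →L[ℝ] ℝ) (f : ℝ × V → M) (S : Set (ℝ × V)) (t₀ : ℝ) (z : V) :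
    V →L[ℝ] ℝ :=
  (Θ (f (t₀, z)) (fderivWithin ℝ f S (t₀, z) (1, 0))).comp
    ((fderivWithin ℝ f S (t₀, z)).comp (ContinuousLinearMap.inr ℝ ℝ V))

variable {Θ : M → M →L[ℝ] M →L[ℝ] ℝ} {f : ℝ × V → M} {J : Set ℝ} {O : Set V} {t₀ : ℝ} {y : V}

theorem contDiffAt_velocityForm (hJ : UniqueDiffOn ℝ J) (ht₀ : t₀ ∈ J) (hO : IsOpen O)
    (hy : y ∈ O) (hf : ContDiffOn ℝ ∞ f (J ×ˢ O)) (hΘ : ContDiffAt ℝ ∞ Θ (f (t₀, y))) :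
    ContDiffAt ℝ ∞ (velocityForm Θ f (J ×ˢ O) t₀) y := by
  have hι : ContDiff ℝ ∞ (fun z : V => (t₀, z)) := contDiff_const.prodMk contDiff_id
  have hm : MapsTo (fun z : V => (t₀, z)) O (J ×ˢ O) := fun z hz => ⟨ht₀, hz⟩
  have hG : ContDiffOn ℝ ∞ (fderivWithin ℝ f (J ×ˢ O)) (J ×ˢ O) :=
    hf.fderivWithin (hJ.prod hO.uniqueDiffOn) (by simp)
  have h1 : ContDiffAt ℝ ∞ (fun z => f (t₀, z)) y :=
    (hf.comp hι.contDiffOn hm).contDiffAt (hO.mem_nhds hy)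
  have h2 : ContDiffAt ℝ ∞ (fun z => fderivWithin ℝ f (J ×ˢ O) (t₀, z)) y :=
    (hG.comp hι.contDiffOn hm).contDiffAt (hO.mem_nhds hy)
  exact ((hΘ.comp y h1).clm_apply (h2.clm_apply contDiffAt_const)).clm_comp
    (h2.clm_comp contDiffAt_const)

/-- The derivative of the pullbacks of a closed two-form under a family of maps is the exterior
derivative of the pullback of its contraction with the velocity. -/
theorem hasDerivWithinAt_pullback (hJ : UniqueDiffOn ℝ J) (ht₀ : t₀ ∈ J)
    (hcl : t₀ ∈ closure (interior J)) (hO : IsOpen O) (hy : y ∈ O)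
    (hf : ContDiffOn ℝ ∞ f (J ×ˢ O)) (hΘ : ContDiffAt ℝ ∞ Θ (f (t₀, y)))
    (hskew : ∀ a b, Θ (f (t₀, y)) a b = -Θ (f (t₀, y)) b a)
    (hcyc : ∀ a b c, fderiv ℝ Θ (f (t₀, y)) a b c - fderiv ℝ Θ (f (t₀, y)) b a c
      + fderiv ℝ Θ (f (t₀, y)) c a b = 0) (v w : V) :
    HasDerivWithinAt (fun t => Θ (f (t, y)) (fderivWithin ℝ f (J ×ˢ O) (t, y) (0, v))
        (fderivWithin ℝ f (J ×ˢ O) (t, y) (0, w)))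
      (fderiv ℝ (velocityForm Θ f (J ×ˢ O) t₀) y v w
        - fderiv ℝ (velocityForm Θ f (J ×ˢ O) t₀) y w v) J t₀ := by
  set S := J ×ˢ O with hS
  set G := fderivWithin ℝ f S with hGdef
  have hU : UniqueDiffOn ℝ S := hJ.prod hO.uniqueDiffOn
  have hmem : (t₀, y) ∈ S := ⟨ht₀, hy⟩
  have hG : ContDiffOn ℝ ∞ G S := hf.fderivWithin hU (by simp)
  set D2 := fderivWithin ℝ G S (t₀, y) with hD2
  have hGd : HasFDerivWithinAt G D2 S (t₀, y) :=
    ((hG _ hmem).differentiableWithinAt (by simp)).hasFDerivWithinAt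
  have hfd : HasFDerivWithinAt f (G (t₀, y)) S (t₀, y) :=
    ((hf _ hmem).differentiableWithinAt (by simp)).hasFDerivWithinAt
  -- Second derivatives within a set are symmetric at points in the closure of its interior, which
  -- is what `hcl` provides when `t₀` is an end point of `J`.
  have hsymm : ∀ a b, D2 a b = D2 b a := by
    have h2 : minSmoothness ℝ 2 ≤ ∞ := by
      rw [minSmoothness_of_isRCLikeNormedField]
      exact ENat.LEInfty.out
    refine ContDiffWithinAt.isSymmSndFDerivWithinAt (hf _ hmem) h2 hU ?_ hmem
    rw [hS, interior_prod_eq, closure_prod_eq]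
    exact ⟨hcl, subset_closure (by rwa [hO.interior_eq])⟩
  have hΘd := (hΘ.differentiableAt (by simp)).hasFDerivAt
  -- derivatives in time
  have ht : HasDerivWithinAt (fun t : ℝ => (t, y)) (1, 0) J t₀ :=
    (hasDerivWithinAt_id t₀ J).prodMk (hasDerivWithinAt_const t₀ J y)
  have htm : MapsTo (fun t : ℝ => (t, y)) J S := fun t ht => ⟨ht, hy⟩
  have hf1 := hfd.comp_hasDerivWithinAt t₀ ht htm
  have hG1 := hGd.comp_hasDerivWithinAt t₀ ht htm
  have hΘ1 : HasDerivWithinAt (fun t => Θ (f (t, y)))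
      (fderiv ℝ Θ (f (t₀, y)) (G (t₀, y) (1, 0))) J t₀ :=
    HasFDerivAt.comp_hasDerivWithinAt (F := M) (E := M →L[ℝ] M →L[ℝ] ℝ) t₀ hΘd hf1
  have hGv : ∀ v : V, HasDerivWithinAt (fun t => G (t, y) (0, v)) (D2 (1, 0) (0, v)) J t₀ :=
    fun v => by simpa using hG1.clm_apply (hasDerivWithinAt_const t₀ J ((0 : ℝ), v))
  have hmain := (hΘ1.clm_apply (hGv v)).clm_apply (hGv w)
  -- derivatives in space
  have hs : HasFDerivAt (fun z : V => (t₀, z)) (ContinuousLinearMap.inr ℝ ℝ V) y :=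
    hasFDerivAt_prodMk_right t₀ y
  have hsm : ∀ᶠ z in 𝓝 y, (t₀, z) ∈ S := by
    filter_upwards [hO.mem_nhds hy] with z hz using ⟨ht₀, hz⟩
  have hf2 : HasFDerivAt (fun z => f (t₀, z))
      ((G (t₀, y)).comp (ContinuousLinearMap.inr ℝ ℝ V)) y :=
    HasFDerivWithinAt.comp_hasFDerivAt y hfd hs hsm
  have hG2 : HasFDerivAt (fun z => G (t₀, z)) (D2.comp (ContinuousLinearMap.inr ℝ ℝ V)) y :=
    HasFDerivWithinAt.comp_hasFDerivAt y hGd hs hsm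
  have hΘ2 : HasFDerivAt (fun z => Θ (f (t₀, z))) _ y :=
    HasFDerivAt.comp (F := M) (G := M →L[ℝ] M →L[ℝ] ℝ) y hΘd hf2
  have hG2c : ∀ c : ℝ × V, HasFDerivAt (fun z => G (t₀, z) c)
      ((D2.comp (ContinuousLinearMap.inr ℝ ℝ V)).flip c) y := fun c => by
    simpa using hG2.clm_apply (hasFDerivAt_const c y)
  have hα := (contDiffAt_velocityForm hJ ht₀ hO hy hf hΘ).differentiableAt (by simp)
  have key : ∀ v w, fderiv ℝ (velocityForm Θ f S t₀) y v w
      = fderiv ℝ Θ (f (t₀, y)) (G (t₀, y) (0, v)) (G (t₀, y) (1, 0)) (G (t₀, y) (0, w))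
        + Θ (f (t₀, y)) (D2 (0, v) (1, 0)) (G (t₀, y) (0, w))
        + Θ (f (t₀, y)) (G (t₀, y) (1, 0)) (D2 (0, v) (0, w)) := by
    intro v w
    have h1 : HasFDerivAt (fun z => velocityForm Θ f S t₀ z w)
        ((fderiv ℝ (velocityForm Θ f S t₀) y).flip w) y := by
      simpa using hα.hasFDerivAt.clm_apply (hasFDerivAt_const w y)
    have h2 := (hΘ2.clm_apply (hG2c (1, 0))).clm_apply (hG2c (0, w))
    have h3 := DFunLike.congr_fun (h1.unique h2) v
    simp only [ContinuousLinearMap.flip_apply] at h3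
    rw [h3]
    simp
    ring
  refine hmain.congr_deriv ?_
  rw [key, key, hsymm (0, v) (0, w), hsymm (0, v) (1, 0), hsymm (0, w) (1, 0)]
  -- The derivatives of `Θ` match by closedness applied to the velocity and the images of `v` and
  -- `w`. The mixed second derivatives match by skewness, and the purely spatial one cancels by
  -- symmetry.
  have h1 := hcyc (G (t₀, y) (1, 0)) (G (t₀, y) (0, v)) (G (t₀, y) (0, w))
  have h2 := hskew (G (t₀, y) (0, v)) (D2 (1, 0) (0, w))
  simp only [add_apply]
  rw [h2]
  linarith

/-- The kernel of a closed two-form is involutive. -/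
theorem lieBracket_mem_kernel {Θ : V → V →L[ℝ] V →L[ℝ] ℝ} {y : V} (hΘ : DifferentiableAt ℝ Θ y)
    (hskew : ∀ᶠ z in 𝓝 y, ∀ a b, Θ z a b = -Θ z b a)
    (hcyc : ∀ a b c, fderiv ℝ Θ y a b c - fderiv ℝ Θ y b a c + fderiv ℝ Θ y c a b = 0)
    {X Y : V → V} (hX : DifferentiableAt ℝ X y) (hY : DifferentiableAt ℝ Y y)
    (hXk : ∀ᶠ z in 𝓝 y, ∀ w, Θ z (X z) w = 0) (hYk : ∀ᶠ z in 𝓝 y, ∀ w, Θ z (Y z) w = 0) (w : V) :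
    Θ y (lieBracket ℝ X Y y) w = 0 := by
  have hd : ∀ Z W : V → V, DifferentiableAt ℝ Z y → DifferentiableAt ℝ W y →
      (∀ᶠ z in 𝓝 y, Θ z (Z z) (W z) = 0) → ∀ v, fderiv ℝ Θ y v (Z y) (W y)
        + Θ y (fderiv ℝ Z y v) (W y) + Θ y (Z y) (fderiv ℝ W y v) = 0 := by
    intro Z W hZ hW h v
    have h1 := (hΘ.hasFDerivAt.clm_apply hZ.hasFDerivAt).clm_apply hW.hasFDerivAt
    have h2 : HasFDerivAt (fun z => Θ z (Z z) (W z)) (0 : V →L[ℝ] ℝ) y :=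
      (hasFDerivAt_const (0 : ℝ) y).congr_of_eventuallyEq h
    have h3 := DFunLike.congr_fun (h1.unique h2) v
    simp at h3
    linarith
  have hw : DifferentiableAt ℝ (fun _ : V => w) y := differentiableAt_const w
  -- Differentiate $\Theta(Y,w)=0$ along $X$, $\Theta(X,w)=0$ along $Y$ and $\Theta(X,Y)=0$ along
  -- $w$, and insert the results into the closedness identity.
  have e1 := hd Y (fun _ => w) hY hw (hYk.mono fun z hz => hz w) (X y)
  have e2 := hd X (fun _ => w) hX hw (hXk.mono fun z hz => hz w) (Y y)
  have e3 := hd X Y hX hY (hXk.mono fun z hz => hz (Y z)) w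
  have e4 := hcyc (X y) (Y y) w
  have e5 := hXk.self_of_nhds
  have e6 := hYk.self_of_nhds
  have e7 := hskew.self_of_nhds
  have e8 : Θ y (fderiv ℝ X y w) (Y y) = 0 := by rw [e7, e6, neg_zero]
  have e9 : Θ y (X y) (fderiv ℝ Y y w) = 0 := e5 _
  simp only [fderiv_fun_const, Pi.zero_apply, zero_apply, map_zero, add_zero] at e1 e2
  rw [lieBracket_eq]
  simp only [map_sub, sub_apply]
  linarith

theorem contDiffAt_pullback_form {β : M → M →L[ℝ] ℝ} {g : V → M} {y : V}
    (hβ : ContDiffAt ℝ ∞ β (g y)) (hg : ContDiffAt ℝ ∞ g y) :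
    ContDiffAt ℝ ∞ (fun z => (β (g z)).comp (fderiv ℝ g z)) y :=
  (hβ.comp y hg).clm_comp (hg.fderiv_right (by simp))

/-- The derivative of $g^*\beta$ is $D\beta(Dg\,v)(Dg\,w)+\beta(D^2g(v,w))$, and both terms are
symmetric in $v,w$. -/
theorem fderiv_pullback_form_symm {β : M → M →L[ℝ] ℝ} {g : V → M} {y : V}
    (hβ : ContDiffAt ℝ ∞ β (g y)) (hg : ContDiffAt ℝ ∞ g y)
    (hsymm : ∀ a b, fderiv ℝ β (g y) a b = fderiv ℝ β (g y) b a) (v w : V) :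
    fderiv ℝ (fun z => (β (g z)).comp (fderiv ℝ g z)) y v w
      = fderiv ℝ (fun z => (β (g z)).comp (fderiv ℝ g z)) y w v := by
  have hα := (contDiffAt_pullback_form hβ hg).differentiableAt (by simp)
  have h2 : IsSymmSndFDerivAt ℝ g y := hg.isSymmSndFDerivAt (by
    rw [minSmoothness_of_isRCLikeNormedField]
    exact ENat.LEInfty.out)
  have hβd : HasFDerivAt (fun z => β (g z)) _ y :=
    (hβ.differentiableAt (by simp)).hasFDerivAt.comp y (hg.differentiableAt (by simp)).hasFDerivAt
  have hgd := ((hg.fderiv_right (m := ∞) (by simp)).differentiableAt (by simp)).hasFDerivAt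
  have key : ∀ v w, fderiv ℝ (fun z => (β (g z)).comp (fderiv ℝ g z)) y v w
      = fderiv ℝ β (g y) (fderiv ℝ g y v) (fderiv ℝ g y w)
        + β (g y) (fderiv ℝ (fderiv ℝ g) y v w) := by
    intro v w
    have h1 := hα.hasFDerivAt.clm_apply (hasFDerivAt_const w y)
    have h2 := hβd.clm_apply (hgd.clm_apply (hasFDerivAt_const w y))
    have h3 := DFunLike.congr_fun (h1.unique h2) v
    simp at h3
    rw [h3]
    ring
  rw [key, key, hsymm, h2 v w]

end VectorSpace

/-! ### Maps between manifolds in charts -/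

section Manifold

variable {B H : Type*} [NormedAddCommGroup B] [NormedSpace ℝ B] [FiniteDimensional ℝ B]
  [TopologicalSpace H] {I : ModelWithCorners ℝ B H} [I.Boundaryless]
  {N : Type*} [TopologicalSpace N] [ChartedSpace H N] [IsManifold I ∞ N]
  {B' H' : Type*} [NormedAddCommGroup B'] [NormedSpace ℝ B'] [FiniteDimensional ℝ B']
  [TopologicalSpace H'] {I' : ModelWithCorners ℝ B' H'} [I'.Boundaryless]
  {N' : Type*} [TopologicalSpace N'] [ChartedSpace H' N'] [IsManifold I' ∞ N']
  {x₀ : N} {y₀ : N'} {q : B}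

variable (I I' x₀ y₀) in
/-- The coordinate expression of a map. -/
def coordMap (g : N → N') (q : B) : B' := extChartAt I' y₀ (g ((extChartAt I x₀).symm q))

theorem contDiffAt_coordMap {g : N → N'} (hq : q ∈ (extChartAt I x₀).target)
    (hg : ContMDiffAt I I' ∞ g ((extChartAt I x₀).symm q))
    (hgq : g ((extChartAt I x₀).symm q) ∈ (extChartAt I' y₀).source) :
    ContDiffAt ℝ ∞ (coordMap I I' x₀ y₀ g) q :=
  ((contMDiffAt_chart hgq).comp q (hg.comp q (contMDiffAt_chart_symm hq))).contDiffAt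

theorem mfderiv_chartD {g : N → N'} (hq : q ∈ (extChartAt I x₀).target)
    (hg : MDifferentiableAt I I' g ((extChartAt I x₀).symm q))
    (hgq : g ((extChartAt I x₀).symm q) ∈ (extChartAt I' y₀).source) (v : B) :
    (mfderiv I I' g ((extChartAt I x₀).symm q) (chartD I x₀ q v) : B')
      = chartD I' y₀ (coordMap I I' x₀ y₀ g q) (fderiv ℝ (coordMap I I' x₀ y₀ g) q v) := by
  have h0 := hg.comp q (mdifferentiableAt_chart_symm hq)
  have h1 := mfderiv_comp q hg (mdifferentiableAt_chart_symm hq)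
  have hd : MDifferentiableAt 𝓘(ℝ, B) 𝓘(ℝ, B') (coordMap I I' x₀ y₀ g) q :=
    ((contMDiffAt_chart hgq).mdifferentiableAt (by simp)).comp q h0
  have ht := (extChartAt I' y₀).map_source hgq
  have h2 := mfderiv_comp q (mdifferentiableAt_chart_symm ht) hd
  have h3 : (extChartAt I' y₀).symm ∘ coordMap I I' x₀ y₀ g =ᶠ[𝓝 q]
      g ∘ (extChartAt I x₀).symm := by
    filter_upwards [h0.continuousAt.preimage_mem_nhds
      ((isOpen_extChartAt_source (I := I') y₀).mem_nhds hgq)] with z hz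
    exact (extChartAt I' y₀).left_inv hz
  have h4 := h3.mfderiv_eq (I := 𝓘(ℝ, B)) (I' := I')
  rw [mfderiv_eq_fderiv] at h2
  have h5 := DFunLike.congr_fun h1 v
  have h6 := DFunLike.congr_fun h2 v
  have h7 := DFunLike.congr_fun h4 v
  exact h5.symm.trans (h7.symm.trans h6)

end Manifold

/-! ### Charts of the total space adapted to the zero section -/

section TotalSpaceCharts

variable {B : Type*} [NormedAddCommGroup B] [NormedSpace ℝ B] [FiniteDimensional ℝ B]
  {C : Type*} [TopologicalSpace C] [ChartedSpace B C] [IsManifold 𝓘(ℝ, B) ∞ C]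
  {F : Type*} [NormedAddCommGroup F] [NormedSpace ℝ F] [FiniteDimensional ℝ F]
  {E : C → Type*} [TopologicalSpace (TotalSpace F E)] [∀ x, AddCommGroup (E x)]
  [∀ x, Module ℝ (E x)] [∀ x, TopologicalSpace (E x)]
  [FiberBundle F E] [VectorBundle ℝ F E] [ContMDiffVectorBundle ∞ F E 𝓘(ℝ, B)]

local notation "𝓘B" => modelWithCornersSelf ℝ B
local notation "𝓙" => ModelWithCorners.prod (modelWithCornersSelf ℝ B) (modelWithCornersSelf ℝ F)
local notation "𝟎" => graphMap (0 : Gam B F E)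

/-- Points over different base points are separated by the projection. Points of one fibre lie in
the domain of a single trivialization, which injects into a Hausdorff product. -/
theorem t2Space_totalSpace [T2Space C] : T2Space (TotalSpace F E) := by
  refine ⟨fun p q hne => ?_⟩
  have hc := FiberBundle.continuous_proj F E
  by_cases h : p.proj = q.proj
  · set T := trivializationAt F E p.proj
    have hp : p ∈ T.source := T.mem_source.2 (mem_baseSet_trivializationAt F E _)
    have hq : q ∈ T.source := T.mem_source.2 (h ▸ mem_baseSet_trivializationAt F E _)
    have : T2Space T.source := T2Space.of_injective_continuous
      (f := fun z : T.source => T z) T.injOn.injective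
      (continuousOn_iff_continuous_domRestrict.1 T.continuousOn)
    exact separated_by_isOpenEmbedding (x := (⟨p, hp⟩ : T.source)) (y := ⟨q, hq⟩)
      T.open_source.isOpenEmbedding_subtypeVal fun h => hne (congrArg Subtype.val h)
  · exact separated_by_continuous hc h

variable (B F E) in
/-- The coordinates of the points near `x₀` at which both the chart of `C` and the trivialization of
`E` centred at `x₀` are defined. -/
def baseDom (x₀ : C) : Set B :=
  (extChartAt 𝓘B x₀).target ∩ (extChartAt 𝓘B x₀).symm ⁻¹' (trivializationAt F E x₀).baseSet

variable {x₀ : C} {y : B} {w : F}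

theorem isOpen_baseDom : IsOpen (baseDom B F E x₀) :=
  isOpen_target_inter_preimage (trivializationAt F E x₀).open_baseSet x₀

theorem mem_baseDom_self : extChartAt 𝓘B x₀ x₀ ∈ baseDom B F E x₀ :=
  ⟨mem_extChartAt_target x₀, by
    rw [mem_preimage, extChartAt_to_inv]; exact mem_baseSet_trivializationAt F E x₀⟩

theorem extChartAt_total_target :
    (extChartAt 𝓙 (𝟎 x₀)).target = baseDom B F E x₀ ×ˢ (univ : Set F) :=
  FiberBundle.extChartAt_target _

theorem mem_total_target (hy : y ∈ baseDom B F E x₀) : (y, w) ∈ (extChartAt 𝓙 (𝟎 x₀)).target := by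
  rw [extChartAt_total_target]; exact ⟨hy, mem_univ _⟩

theorem extChartAt_total_apply (p : TotalSpace F E) :
    extChartAt 𝓙 (𝟎 x₀) p = (extChartAt 𝓘B x₀ (trivializationAt F E x₀ p).1,
      (trivializationAt F E x₀ p).2) := by
  rw [FiberBundle.extChartAt]
  rfl

theorem extChartAt_total_symm (hy : y ∈ baseDom B F E x₀) :
    (extChartAt 𝓙 (𝟎 x₀)).symm (y, w)
      = ⟨(extChartAt 𝓘B x₀).symm y, (trivializationAt F E x₀).symm ((extChartAt 𝓘B x₀).symm y) w⟩ := by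
  rw [FiberBundle.extChartAt]
  exact ((trivializationAt F E x₀).mk_symm hy.2 w).symm

variable (F x₀) in
/-- The coordinate expression of a section. -/
def sectCoord (s : ∀ x, E x) (y : B) : F :=
  (trivializationAt F E x₀ ⟨(extChartAt 𝓘B x₀).symm y, s ((extChartAt 𝓘B x₀).symm y)⟩).2

theorem contMDiffAt_graphMap (s : Gam B F E) (x : C) : ContMDiffAt 𝓘B 𝓙 ∞ (graphMap s) x :=
  s.contMDiff x

theorem graphMap_chart_mem (s : ∀ x, E x) (hy : y ∈ baseDom B F E x₀) :
    (⟨(extChartAt 𝓘B x₀).symm y, s ((extChartAt 𝓘B x₀).symm y)⟩ : TotalSpace F E)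
      ∈ (extChartAt 𝓙 (𝟎 x₀)).source := by
  rw [FiberBundle.extChartAt, PartialEquiv.trans_source]
  refine ⟨((trivializationAt F E x₀).mem_source).2 hy.2, ?_⟩
  rw [mem_preimage, PartialEquiv.prod_source]
  refine ⟨?_, mem_univ _⟩
  have h := (trivializationAt F E x₀).coe_fst' (x := ⟨(extChartAt 𝓘B x₀).symm y,
    s ((extChartAt 𝓘B x₀).symm y)⟩) hy.2
  have h1 := (extChartAt 𝓘B x₀).map_target hy.1
  exact h.symm ▸ h1

theorem extChartAt_total_graph (s : ∀ x, E x) (hy : y ∈ baseDom B F E x₀) :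
    extChartAt 𝓙 (𝟎 x₀) ⟨(extChartAt 𝓘B x₀).symm y, s ((extChartAt 𝓘B x₀).symm y)⟩
      = (y, sectCoord F x₀ s y) := by
  rw [extChartAt_total_apply]
  refine Prod.ext ?_ rfl
  have h := (trivializationAt F E x₀).coe_fst' (x := ⟨(extChartAt 𝓘B x₀).symm y,
    s ((extChartAt 𝓘B x₀).symm y)⟩) hy.2
  show extChartAt 𝓘B x₀ _ = y
  rw [h]
  exact (extChartAt 𝓘B x₀).right_inv hy.1

theorem chart_symm_sectCoord (s : ∀ x, E x) (hy : y ∈ baseDom B F E x₀) :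
    (extChartAt 𝓙 (𝟎 x₀)).symm (y, sectCoord F x₀ s y)
      = ⟨(extChartAt 𝓘B x₀).symm y, s ((extChartAt 𝓘B x₀).symm y)⟩ := by
  rw [← extChartAt_total_graph s hy]
  exact (extChartAt 𝓙 (𝟎 x₀)).left_inv (graphMap_chart_mem s hy)

theorem coordMap_graphMap (s : Gam B F E) (hy : y ∈ baseDom B F E x₀) :
    coordMap 𝓘B 𝓙 x₀ (𝟎 x₀) (graphMap s) y = (y, sectCoord F x₀ s y) :=
  extChartAt_total_graph s hy

theorem contDiffAt_sectCoord (s : Gam B F E) (hy : y ∈ baseDom B F E x₀) :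
    ContDiffAt ℝ ∞ (sectCoord F x₀ s) y := by
  have h := (contDiffAt_coordMap (I' := 𝓙) (y₀ := 𝟎 x₀) hy.1 (contMDiffAt_graphMap s _)
    (graphMap_chart_mem s hy)).snd
  refine h.congr_of_eventuallyEq ?_
  filter_upwards [isOpen_baseDom.mem_nhds hy] with z hz
  rw [coordMap_graphMap s hz]

theorem fderiv_coordMap_graphMap (s : Gam B F E) (hy : y ∈ baseDom B F E x₀) (v : B) :
    fderiv ℝ (coordMap 𝓘B 𝓙 x₀ (𝟎 x₀) (graphMap s)) y v = (v, fderiv ℝ (sectCoord F x₀ s) y v) := by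
  have h : coordMap 𝓘B 𝓙 x₀ (𝟎 x₀) (graphMap s) =ᶠ[𝓝 y] fun z => (z, sectCoord F x₀ s z) := by
    filter_upwards [isOpen_baseDom.mem_nhds hy] with z hz using coordMap_graphMap s hz
  have h2 : HasFDerivAt (fun z => (z, sectCoord F x₀ s z)) _ y := (hasFDerivAt_id y).prodMk
    ((contDiffAt_sectCoord s hy).differentiableAt (by simp)).hasFDerivAt
  rw [h.fderiv_eq, h2.fderiv]
  rfl

theorem mfderiv_graphMap (s : Gam B F E) (hy : y ∈ baseDom B F E x₀) (v : B) :
    (mfderiv 𝓘B 𝓙 (graphMap s) ((extChartAt 𝓘B x₀).symm y) (chartD 𝓘B x₀ y v) : B × F)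
      = chartD 𝓙 (𝟎 x₀) (y, sectCoord F x₀ s y) (v, fderiv ℝ (sectCoord F x₀ s) y v) := by
  have h := mfderiv_chartD (I' := 𝓙) (y₀ := 𝟎 x₀) hy.1
    ((contMDiffAt_graphMap s _).mdifferentiableAt (by simp)) (graphMap_chart_mem s hy) v
  rw [coordMap_graphMap s hy, fderiv_coordMap_graphMap s hy] at h
  exact h

theorem sectCoord_eq (s : ∀ x, E x) (hy : y ∈ baseDom B F E x₀) : sectCoord F x₀ s y =
    (trivializationAt F E x₀).continuousLinearMapAt ℝ ((extChartAt 𝓘B x₀).symm y)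
      (s ((extChartAt 𝓘B x₀).symm y)) := by
  rw [Trivialization.continuousLinearMapAt_apply, Trivialization.linearMapAt_apply,
    if_pos (mem_preimage.1 hy.2), sectCoord]

theorem sectCoord_zero (hy : y ∈ baseDom B F E x₀) :
    sectCoord F x₀ ((0 : Gam B F E) : ∀ x, E x) y = 0 := by
  rw [sectCoord_eq _ hy]
  exact map_zero _

theorem fderiv_sectCoord_zero (hy : y ∈ baseDom B F E x₀) :
    fderiv ℝ (sectCoord F x₀ ((0 : Gam B F E) : ∀ x, E x)) y = 0 := by
  have h : sectCoord F x₀ ((0 : Gam B F E) : ∀ x, E x) =ᶠ[𝓝 y] fun _ => 0 := by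
    filter_upwards [isOpen_baseDom.mem_nhds hy] with z hz using sectCoord_zero hz
  rw [h.fderiv_eq]
  simp

theorem zeroDeriv_chartD (hy : y ∈ baseDom B F E x₀) (v : B) :
    (zeroDeriv B F E ((extChartAt 𝓘B x₀).symm y) (chartD 𝓘B x₀ y v) : B × F)
      = chartD 𝓙 (𝟎 x₀) (y, (0 : F)) (v, 0) := by
  have h := mfderiv_graphMap (0 : Gam B F E) hy v
  rw [sectCoord_zero hy, fderiv_sectCoord_zero hy] at h
  exact h

theorem graphMap_zero_chart (hy : y ∈ baseDom B F E x₀) :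
    (extChartAt 𝓙 (𝟎 x₀)).symm (y, 0) = 𝟎 ((extChartAt 𝓘B x₀).symm y) := by
  have h := chart_symm_sectCoord ((0 : Gam B F E) : ∀ x, E x) hy
  rw [sectCoord_zero hy] at h
  exact h

/-- `vert` is defined by the trivialization centred at the point itself, while the chart uses the
one centred at `x₀`. In the chart the fibre inclusion is $w\mapsto(y,Lw)$, where $L$ is the linear
transition map between the two, and $L$ cancels against the first trivialization. -/
theorem vert_chart (hy : y ∈ baseDom B F E x₀) (e : E ((extChartAt 𝓘B x₀).symm y)) :
    (vert B F E ((extChartAt 𝓘B x₀).symm y) e : B × F) = chartD 𝓙 (𝟎 x₀) (y, (0 : F))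
      (0, (trivializationAt F E x₀).continuousLinearMapAt ℝ ((extChartAt 𝓘B x₀).symm y) e) := by
  let x := (extChartAt 𝓘B x₀).symm y
  let T := trivializationAt F E x₀
  let T' := trivializationAt F E x
  let L : F →L[ℝ] F := (T.continuousLinearMapAt ℝ x).comp (T'.symmL ℝ x)
  have hfun : (fun w : F => (⟨x, T'.symmL ℝ x w⟩ : TotalSpace F E))
      = (extChartAt 𝓙 (𝟎 x₀)).symm ∘ fun w : F => (y, L w) := by
    funext w
    rw [Function.comp_apply, extChartAt_total_symm hy]
    refine congrArg (TotalSpace.mk x) ?_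
    exact (T.symmL_continuousLinearMapAt (R := ℝ) hy.2 _).symm.trans
      (T.symmL_apply (R := ℝ) hy.2 _)
  have hg : HasFDerivAt (fun w : F => (y, L w)) ((ContinuousLinearMap.inr ℝ B F).comp L) 0 :=
    (hasFDerivAt_const y _).prodMk L.hasFDerivAt
  have h0 : ((y, L 0) : B × F) ∈ (extChartAt 𝓙 (𝟎 x₀)).target := mem_total_target hy
  have hc := mfderiv_comp (I := 𝓘(ℝ, F)) (I' := 𝓘(ℝ, B × F)) (I'' := 𝓙) (0 : F)
    (mdifferentiableAt_chart_symm h0) hg.differentiableAt.mdifferentiableAt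
  rw [mfderiv_eq_fderiv, hg.fderiv] at hc
  have h2 := DFunLike.congr_fun hc (T'.continuousLinearMapAt ℝ x e)
  rw [← hfun] at h2
  refine Eq.trans (show (vert B F E x e : B × F) = _ from h2) ?_
  have h3 : T'.symmL ℝ x (T'.continuousLinearMapAt ℝ x e) = e :=
    T'.symmL_continuousLinearMapAt (mem_baseSet_trivializationAt F E x) e
  have h4 : L 0 = 0 := map_zero L
  show (chartD 𝓙 (𝟎 x₀) (y, L 0) ((0 : B), T.continuousLinearMapAt ℝ x
    (T'.symmL ℝ x (T'.continuousLinearMapAt ℝ x e))) : B × F) = _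
  rw [h3, h4]

end TotalSpaceCharts

/-! ### Nondegenerate forms on finite-dimensional spaces -/

section LinearAlgebra

variable {M : Type*} [NormedAddCommGroup M] [NormedSpace ℝ M] [FiniteDimensional ℝ M]

theorem isInvertible_of_nondegenerate {Θ : M →L[ℝ] M →L[ℝ] ℝ}
    (h : ∀ v, (∀ w, Θ v w = 0) → v = 0) : Θ.IsInvertible := by
  let e : M →ₗ[ℝ] Module.Dual ℝ M :=
    (LinearMap.toContinuousLinearMap (𝕜 := ℝ) (E := M) (F' := ℝ)).symm.toLinearMap ∘ₗ Θ.toLinearMap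
  have he : Function.Injective e := by
    rw [← LinearMap.ker_eq_bot, LinearMap.ker_eq_bot']
    exact fun v hv => h v fun w => DFunLike.congr_fun hv w
  let e' := (LinearEquiv.ofInjectiveOfFinrankEq e he Subspace.dual_finrank_eq.symm).trans
    (LinearMap.toContinuousLinearMap (𝕜 := ℝ) (E := M) (F' := ℝ))
  refine ⟨e'.toContinuousLinearEquiv, ?_⟩
  ext v w
  rfl

/-- The pullback of a bilinear form under a linear map. -/
def pullbackForm {V : Type*} [NormedAddCommGroup V] [NormedSpace ℝ V]
    (Θ : M →L[ℝ] M →L[ℝ] ℝ) (S : V →L[ℝ] M) : V →L[ℝ] V →L[ℝ] ℝ :=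
  ((ContinuousLinearMap.compL ℝ V M ℝ).flip S).comp (Θ.comp S)

theorem pullbackForm_apply {V : Type*} [NormedAddCommGroup V] [NormedSpace ℝ V]
    (Θ : M →L[ℝ] M →L[ℝ] ℝ) (S : V →L[ℝ] M) (v w : V) :
    pullbackForm Θ S v w = Θ (S v) (S w) := rfl

theorem contDiffAt_pullbackForm {V W : Type*} [NormedAddCommGroup V] [NormedSpace ℝ V]
    [FiniteDimensional ℝ V] [NormedAddCommGroup W] [NormedSpace ℝ W]
    {Θ : W → M →L[ℝ] M →L[ℝ] ℝ} {S : W → V →L[ℝ] M} {x : W} (hΘ : ContDiffAt ℝ ∞ Θ x)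
    (hS : ContDiffAt ℝ ∞ S x) : ContDiffAt ℝ ∞ (fun y => pullbackForm (Θ y) (S y)) x :=
  contDiffAt_clm_of_apply fun _ => contDiffAt_clm_of_apply fun _ =>
    (hΘ.clm_apply (hS.clm_apply contDiffAt_const)).clm_apply (hS.clm_apply contDiffAt_const)

/-- Dual vectors transform naturally: both sides pair equally under `Θ` with every `S u`, and `S` is
surjective. It serves for changes of chart and for shears. -/
theorem apply_inverse_pullbackForm {Θ : M →L[ℝ] M →L[ℝ] ℝ} {V : Type*} [NormedAddCommGroup V]
    [NormedSpace ℝ V] {S : V →L[ℝ] M} (hS : Function.Surjective S) (hΘ : Θ.IsInvertible)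
    (hΘ' : (pullbackForm Θ S).IsInvertible) (a : M →L[ℝ] ℝ) :
    S ((pullbackForm Θ S).inverse (a.comp S)) = Θ.inverse a := by
  apply hΘ.injective
  rw [hΘ.self_apply_inverse]
  ext w
  obtain ⟨u, rfl⟩ := hS w
  exact DFunLike.congr_fun (hΘ'.self_apply_inverse (a.comp S)) u

end LinearAlgebra

/-! ### Symplectic forms and their inverses in charts -/

section Manifold

variable {B H : Type*} [NormedAddCommGroup B] [NormedSpace ℝ B] [FiniteDimensional ℝ B]
  [TopologicalSpace H] {I : ModelWithCorners ℝ B H} [I.Boundaryless]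
  {N : Type*} [TopologicalSpace N] [ChartedSpace H N] [IsManifold I ∞ N] {x₀ : N} {q : B}

theorem contMDiffAt_of_comp_chart_symm {M : Type*} [NormedAddCommGroup M] [NormedSpace ℝ M]
    (hq : q ∈ (extChartAt I x₀).target) {f : N → M}
    (hf : ContDiffAt ℝ ∞ (fun y => f ((extChartAt I x₀).symm y)) q) :
    ContMDiffAt I 𝓘(ℝ, M) ∞ f ((extChartAt I x₀).symm q) := by
  have hs := (extChartAt I x₀).map_target hq
  have hr := (extChartAt I x₀).right_inv hq
  have h2 : ContMDiffAt 𝓘(ℝ, B) 𝓘(ℝ, M) ∞ (fun y => f ((extChartAt I x₀).symm y))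
      (extChartAt I x₀ ((extChartAt I x₀).symm q)) := by
    rw [hr]; exact hf.contMDiffAt
  refine (h2.comp _ (contMDiffAt_chart hs)).congr_of_eventuallyEq ?_
  filter_upwards [(isOpen_extChartAt_source (I := I) x₀).mem_nhds hs] with p hp
  rw [Function.comp_apply, (extChartAt I x₀).left_inv hp]

variable (I x₀) in
/-- The vector field with given coordinates. -/
def fieldOfCoord (Y : B → B) (p : N) : TangentSpace I p :=
  mpullback I 𝓘(ℝ, B) (extChartAt I x₀) Y p

theorem fieldOfCoord_chart_symm (hq : q ∈ (extChartAt I x₀).target) (Y : B → B) :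
    fieldOfCoord I x₀ Y ((extChartAt I x₀).symm q) = chartD I x₀ q (Y q) := by
  show (mfderiv I 𝓘(ℝ, B) (extChartAt I x₀) _).inverse (Y (extChartAt I x₀ _)) = _
  rw [inverse_mfderiv_chart hq, (extChartAt I x₀).right_inv hq]
  rfl

variable {Ω : ∀ p : N, TangentSpace I p →L[ℝ] TangentSpace I p →L[ℝ] ℝ} {U : Set N}

theorem IsSymplecticOn.skew (hΩ : IsSymplecticOn I U Ω) {p : N} (hp : p ∈ U)
    (v w : TangentSpace I p) : Ω p v w = -Ω p w v := by
  have h := hΩ.alternating p hp (v + w)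
  simp only [map_add, add_apply, hΩ.alternating p hp] at h
  linarith

theorem IsSymplecticOn.isInvertible (hΩ : IsSymplecticOn I U Ω) {p : N} (hp : p ∈ U) :
    (Ω p).IsInvertible :=
  isInvertible_of_nondegenerate (M := B) (hΩ.nondegenerate p hp)

theorem IsSymplecticOn.coordBilin_skew (hΩ : IsSymplecticOn I U Ω)
    (hqU : (extChartAt I x₀).symm q ∈ U) (v w : B) :
    coordBilin I x₀ Ω q v w = -coordBilin I x₀ Ω q w v :=
  hΩ.skew hqU _ _

theorem coordBilin_isInvertible_aux (hΩ : IsSymplecticOn I U Ω) (hq : q ∈ (extChartAt I x₀).target)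
    (hqU : (extChartAt I x₀).symm q ∈ U) (v : B) (h : ∀ w, coordBilin I x₀ Ω q v w = 0) : v = 0 := by
  apply chartD_injective hq
  rw [map_zero]
  refine hΩ.nondegenerate _ hqU _ fun w => ?_
  obtain ⟨u, rfl⟩ := chartD_surjective hq w
  exact h u

theorem IsSymplecticOn.coordBilin_isInvertible (hΩ : IsSymplecticOn I U Ω)
    (hq : q ∈ (extChartAt I x₀).target)
    (hqU : (extChartAt I x₀).symm q ∈ U) : (coordBilin I x₀ Ω q).IsInvertible :=
  isInvertible_of_nondegenerate (coordBilin_isInvertible_aux hΩ hq hqU)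

theorem IsSymplecticOn.contDiffAt_coordBilin (hΩ : IsSymplecticOn I U Ω)
    (hq : q ∈ (extChartAt I x₀).target) (hqU : (extChartAt I x₀).symm q ∈ U) :
    ContDiffAt ℝ ∞ (coordBilin I x₀ Ω) q :=
  hΩ.smooth.contDiffAt_coordBilin hΩ.isOpen hq hqU

theorem IsSymplecticOn.contDiffAt_inverse (hΩ : IsSymplecticOn I U Ω)
    (hq : q ∈ (extChartAt I x₀).target) (hqU : (extChartAt I x₀).symm q ∈ U) :
    ContDiffAt ℝ ∞ (fun y => (coordBilin I x₀ Ω y).inverse) q :=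
  ContDiffAt.comp q (hΩ.coordBilin_isInvertible hq hqU).contDiffAt_map_inverse
    (hΩ.contDiffAt_coordBilin hq hqU)

theorem IsSymplecticOn.cyclic (hΩ : IsSymplecticOn I U Ω)
    (hq : q ∈ (extChartAt I x₀).target) (hqU : (extChartAt I x₀).symm q ∈ U) (u v w : B) :
    fderiv ℝ (coordBilin I x₀ Ω) q u v w - fderiv ℝ (coordBilin I x₀ Ω) q v u w
      + fderiv ℝ (coordBilin I x₀ Ω) q w u v = 0 :=
  hΩ.closed.cyclic hΩ.isOpen hq hqU ((hΩ.contDiffAt_coordBilin hq hqU).differentiableAt (by simp))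
    u v w

theorem IsSymplecticOn.inverse_chart (hΩ : IsSymplecticOn I U Ω)
    (hq : q ∈ (extChartAt I x₀).target) (hqU : (extChartAt I x₀).symm q ∈ U)
    (α : TangentSpace I ((extChartAt I x₀).symm q) →L[ℝ] ℝ) :
    (Ω ((extChartAt I x₀).symm q)).inverse α
      = chartD I x₀ q ((coordBilin I x₀ Ω q).inverse (α.comp (chartD I x₀ q))) :=
  (apply_inverse_pullbackForm (M := B) (V := B) (chartD_surjective hq) (hΩ.isInvertible hqU)
    (hΩ.coordBilin_isInvertible hq hqU) α).symm

/-- The vector field dual to a smooth one-form is smooth. -/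
theorem IsSymplecticOn.contMDiffAt_inverse (hΩ : IsSymplecticOn I U Ω)
    (hq : q ∈ (extChartAt I x₀).target) (hqU : (extChartAt I x₀).symm q ∈ U)
    {α : ∀ p : N, TangentSpace I p →L[ℝ] ℝ} (hα : ContDiffAt ℝ ∞ (coordForm I x₀ α) q) :
    ContMDiffAt I I.tangent ∞ (fun p => (⟨p, (Ω p).inverse (α p)⟩ : TangentBundle I N))
      ((extChartAt I x₀).symm q) := by
  refine contMDiffAt_field_of_coord hq ((hΩ.contDiffAt_inverse hq hqU).clm_apply hα) ?_
  filter_upwards [(isOpen_target_inter_preimage hΩ.isOpen x₀).mem_nhds ⟨hq, hqU⟩] with y hy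
  exact hΩ.inverse_chart hy.1 hy.2 _

end Manifold

/-- The derivative of the restriction of a field of bilinear forms to a subspace. -/
theorem fderiv_pullbackForm_inl {B F : Type*} [NormedAddCommGroup B] [NormedSpace ℝ B]
    [FiniteDimensional ℝ B] [NormedAddCommGroup F] [NormedSpace ℝ F] [FiniteDimensional ℝ F]
    {Φ : B × F → (B × F) →L[ℝ] (B × F) →L[ℝ] ℝ} {y : B} (hΦ : ContDiffAt ℝ ∞ Φ (y, 0)) (a b c : B) :
    fderiv ℝ (fun z => pullbackForm (Φ (z, (0 : F))) (ContinuousLinearMap.inl ℝ B F)) y a b c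
      = fderiv ℝ Φ (y, 0) (a, 0) (b, 0) (c, 0) := by
  have hι : ContDiffAt ℝ ∞ (fun z : B => (z, (0 : F))) y := contDiffAt_id.prodMk contDiffAt_const
  have h := (contDiffAt_pullbackForm (S := fun _ => ContinuousLinearMap.inl ℝ B F)
    (hΦ.comp y hι) contDiffAt_const).differentiableAt (by simp)
  have hfd : HasFDerivAt (fun z : B => Φ (z, (0 : F))) _ y :=
    HasFDerivAt.comp (E := B) (F := B × F) (G := B × F →L[ℝ] B × F →L[ℝ] ℝ)
      (f := fun z : B => (z, (0 : F))) (g := Φ) y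
      (hΦ.differentiableAt (by simp)).hasFDerivAt (hasFDerivAt_prodMk_left y (0 : F))
  have h1 := (h.hasFDerivAt.clm_apply (hasFDerivAt_const b y)).clm_apply (hasFDerivAt_const c y)
  have h2 := (hfd.clm_apply (hasFDerivAt_const ((b, 0) : B × F) y)).clm_apply
    (hasFDerivAt_const ((c, 0) : B × F) y)
  have h3 := DFunLike.congr_fun (h1.unique h2) a
  simpa using h3

/-! ### The kernel distribution of the coisotropic zero section -/

section KernelDistribution

variable {B : Type*} [NormedAddCommGroup B] [NormedSpace ℝ B] [FiniteDimensional ℝ B]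
  {C : Type*} [TopologicalSpace C] [ChartedSpace B C] [IsManifold 𝓘(ℝ, B) ∞ C]
  {F : Type*} [NormedAddCommGroup F] [NormedSpace ℝ F] [FiniteDimensional ℝ F]
  {E : C → Type*} [TopologicalSpace (TotalSpace F E)] [∀ x, AddCommGroup (E x)]
  [∀ x, Module ℝ (E x)] [∀ x, TopologicalSpace (E x)]
  [FiberBundle F E] [VectorBundle ℝ F E] [ContMDiffVectorBundle ∞ F E 𝓘(ℝ, B)]

local notation "𝓘B" => modelWithCornersSelf ℝ B
local notation "𝓙" => ModelWithCorners.prod (modelWithCornersSelf ℝ B) (modelWithCornersSelf ℝ F)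
local notation "𝟎" => graphMap (0 : Gam B F E)

variable {x₀ : C} {y : B} {w : F} {U : Set (TotalSpace F E)} {Ω : BilinField B F E}

/-- Each point is the centre of its own chart. Phrasing pointwise claims at `(extChartAt x₀).symm y`
avoids transporting vectors and fibres along equalities of base points. -/
theorem forall_of_chart {P : C → Prop}
    (h : ∀ (x₀ : C), ∀ y ∈ baseDom B F E x₀, P ((extChartAt 𝓘B x₀).symm y)) (x : C) : P x := by
  have := h x _ mem_baseDom_self
  rwa [extChartAt_to_inv] at this

/-- All tangent spaces of the total space are definitionally `B × F`, so the base point can be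
changed without a cast on the vectors. -/
theorem omega_congr (Ω : BilinField B F E) {p p' : TotalSpace F E} (h : p = p') (a b : B × F) :
    (Ω p : (B × F) →L[ℝ] (B × F) →L[ℝ] ℝ) a b = (Ω p' : (B × F) →L[ℝ] (B × F) →L[ℝ] ℝ) a b := by
  subst h; rfl

/-- In coordinates the tangent space of the graph consists of the pairs $(v,Ds\,v)$. -/
theorem coiso_at_iff (s : Gam B F E) (hy : y ∈ baseDom B F E x₀) :
    (∀ v : TT B (graphMap s ((extChartAt 𝓘B x₀).symm y)),
      (∀ w : TangentSpace 𝓘B ((extChartAt 𝓘B x₀).symm y),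
        Ω (graphMap s ((extChartAt 𝓘B x₀).symm y)) v
          (mfderiv 𝓘B 𝓙 (graphMap s) ((extChartAt 𝓘B x₀).symm y) w) = 0) →
      ∃ u : TangentSpace 𝓘B ((extChartAt 𝓘B x₀).symm y),
        mfderiv 𝓘B 𝓙 (graphMap s) ((extChartAt 𝓘B x₀).symm y) u = v) ↔
    ∀ z : B × F, (∀ v, coordBilin 𝓙 (𝟎 x₀) Ω (y, sectCoord F x₀ s y) z
      (v, fderiv ℝ (sectCoord F x₀ s) y v) = 0) → z.2 = fderiv ℝ (sectCoord F x₀ s) y z.1 := by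
  have ht := mem_total_target (w := sectCoord F x₀ s y) hy
  have hp : (extChartAt 𝓙 (𝟎 x₀)).symm (y, sectCoord F x₀ s y)
    = graphMap s ((extChartAt 𝓘B x₀).symm y) := chart_symm_sectCoord s hy
  constructor
  · intro h z hz
    obtain ⟨u, hu⟩ := h (chartD 𝓙 (𝟎 x₀) (y, sectCoord F x₀ s y) z : B × F) (fun w => by
      obtain ⟨w, rfl⟩ := chartD_surjective hy.1 w
      have h1 := mfderiv_graphMap s hy w
      have h2 := omega_congr Ω hp (chartD 𝓙 (𝟎 x₀) (y, sectCoord F x₀ s y) z)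
        (chartD 𝓙 (𝟎 x₀) (y, sectCoord F x₀ s y) (w, fderiv ℝ (sectCoord F x₀ s) y w))
      refine Eq.trans ?_ (h2.symm.trans (hz w))
      exact congrArg (fun t => (Ω (graphMap s ((extChartAt 𝓘B x₀).symm y)) :
        (B × F) →L[ℝ] (B × F) →L[ℝ] ℝ) (chartD 𝓙 (𝟎 x₀) (y, sectCoord F x₀ s y) z) t) h1)
    obtain ⟨u, rfl⟩ := chartD_surjective hy.1 u
    have h1 := chartD_injective ht ((mfderiv_graphMap s hy u).symm.trans hu)
    rw [← h1]
  · intro h v hv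
    obtain ⟨z, hz⟩ := chartD_surjective ht (v : B × F)
    refine ⟨chartD 𝓘B x₀ y z.1, ?_⟩
    refine (mfderiv_graphMap s hy z.1).trans (Eq.trans ?_ hz)
    rw [← h z]
    intro w
    have h1 := mfderiv_graphMap s hy w
    have h2 := omega_congr Ω hp v
        (chartD 𝓙 (𝟎 x₀) (y, sectCoord F x₀ s y) (w, fderiv ℝ (sectCoord F x₀ s) y w))
    have h3 := hv (chartD 𝓘B x₀ y w)
    rw [coordBilin_apply, hz]
    refine h2.trans (Eq.trans ?_ h3)
    exact congrArg (fun t => (Ω (graphMap s ((extChartAt 𝓘B x₀).symm y)) :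
      (B × F) →L[ℝ] (B × F) →L[ℝ] ℝ) v t) h1.symm

theorem graphMap_zero_mem (hC : (0 : Gam B F E) ∈ DefU U Ω) (x : C) : 𝟎 x ∈ U := hC.1 ⟨x, rfl⟩

theorem chart_zero_mem (hC : (0 : Gam B F E) ∈ DefU U Ω) (hy : y ∈ baseDom B F E x₀) :
    (extChartAt 𝓙 (𝟎 x₀)).symm (y, 0) ∈ U := by
  rw [graphMap_zero_chart hy]
  exact graphMap_zero_mem hC _

theorem coiso_zero_chart (hC : (0 : Gam B F E) ∈ DefU U Ω) (hy : y ∈ baseDom B F E x₀) (z : B × F)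
    (hz : ∀ v, coordBilin 𝓙 (𝟎 x₀) Ω (y, 0) z (v, 0) = 0) : z.2 = 0 := by
  have h := (coiso_at_iff (Ω := Ω) (0 : Gam B F E) hy).1 (hC.2 _) z
  rw [sectCoord_zero hy, fderiv_sectCoord_zero hy] at h
  exact h hz

theorem omega_zero_chart (hy : y ∈ baseDom B F E x₀) {a b : B × F} {v w : B × F}
    (hv : v = chartD 𝓙 (𝟎 x₀) (y, (0 : F)) a) (hw : w = chartD 𝓙 (𝟎 x₀) (y, (0 : F)) b) :
    (Ω (𝟎 ((extChartAt 𝓘B x₀).symm y)) : (B × F) →L[ℝ] (B × F) →L[ℝ] ℝ) v w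
      = coordBilin 𝓙 (𝟎 x₀) Ω (y, 0) a b := by
  rw [coordBilin_apply, hv, hw]
  exact omega_congr Ω (graphMap_zero_chart hy).symm _ _

theorem mem_kernelDist_chart (hy : y ∈ baseDom B F E x₀) (v : B) :
    chartD 𝓘B x₀ y v ∈ kernelDist Ω ((extChartAt 𝓘B x₀).symm y) ↔
      ∀ w, coordBilin 𝓙 (𝟎 x₀) Ω (y, 0) (v, 0) (w, 0) = 0 := by
  have h := fun w => omega_zero_chart (Ω := Ω) hy (zeroDeriv_chartD hy v) (zeroDeriv_chartD hy w)
  constructor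
  · intro hv w
    exact (h w).symm.trans (hv _)
  · intro hv w
    obtain ⟨w, rfl⟩ := chartD_surjective hy.1 w
    exact (h w).trans (hv w)

/-- The one-form `Ω(σ, ·)` on `C`. -/
def flatForm (Ω : BilinField B F E) (σ : ∀ x, E x) (x : C) : TangentSpace 𝓘B x →L[ℝ] ℝ :=
  (Ω (𝟎 x) (vert B F E x (σ x))).comp (zeroDeriv B F E x)

theorem coordForm_flatForm (σ : ∀ x, E x) (hy : y ∈ baseDom B F E x₀) (v : B) :
    coordForm 𝓘B x₀ (flatForm Ω σ) y v
      = coordBilin 𝓙 (𝟎 x₀) Ω (y, 0) (0, sectCoord F x₀ σ y) (v, 0) := by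
  refine omega_zero_chart hy ((vert_chart hy _).trans ?_) (zeroDeriv_chartD hy v)
  rw [sectCoord_eq _ hy]

theorem contDiffAt_coordBilin_zero (hΩ : IsSymplecticOn 𝓙 U Ω) (hC : (0 : Gam B F E) ∈ DefU U Ω)
    (hy : y ∈ baseDom B F E x₀) :
    ContDiffAt ℝ ∞ (fun y => coordBilin 𝓙 (𝟎 x₀) Ω (y, (0 : F))) y :=
  (hΩ.contDiffAt_coordBilin (mem_total_target hy) (chart_zero_mem hC hy)).comp y
    (contDiffAt_id.prodMk contDiffAt_const)

theorem contDiffAt_coordForm_flatForm (hΩ : IsSymplecticOn 𝓙 U Ω)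
    (hC : (0 : Gam B F E) ∈ DefU U Ω) (σ : Gam B F E) (hy : y ∈ baseDom B F E x₀) :
    ContDiffAt ℝ ∞ (coordForm 𝓘B x₀ (flatForm Ω σ)) y := by
  refine contDiffAt_clm_of_apply fun v => ?_
  have h : ContDiffAt ℝ ∞ (fun y => coordBilin 𝓙 (𝟎 x₀) Ω (y, (0 : F))
      (0, sectCoord F x₀ σ y) (v, 0)) y :=
    ((contDiffAt_coordBilin_zero hΩ hC hy).clm_apply
      (contDiffAt_const.prodMk (contDiffAt_sectCoord σ hy))).clm_apply contDiffAt_const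
  refine h.congr_of_eventuallyEq ?_
  filter_upwards [isOpen_baseDom.mem_nhds hy] with z hz using coordForm_flatForm σ hz v

variable (x₀ Ω) in
/-- The coordinates of the vector in the kernel of the presymplectic form that is dual to a conormal
covector. -/
def kernelVec (β : F →L[ℝ] ℝ) (y : B) : B :=
  ((coordBilin 𝓙 (𝟎 x₀) Ω (y, 0)).inverse (β.comp (ContinuousLinearMap.snd ℝ B F))).1

/-- A conormal covector vanishes on $TC$, so its dual lies in $TC^\perp$, which is contained in $TC$
by coisotropy: the second component is zero. -/
theorem inverse_eq_kernelVec (hΩ : IsSymplecticOn 𝓙 U Ω) (hC : (0 : Gam B F E) ∈ DefU U Ω)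
    (hy : y ∈ baseDom B F E x₀) (β : F →L[ℝ] ℝ) :
    (coordBilin 𝓙 (𝟎 x₀) Ω (y, 0)).inverse (β.comp (ContinuousLinearMap.snd ℝ B F))
      = (kernelVec x₀ Ω β y, 0) := by
  refine Prod.ext rfl (coiso_zero_chart hC hy _ fun v => ?_)
  rw [(hΩ.coordBilin_isInvertible (mem_total_target hy) (chart_zero_mem hC hy)).self_apply_inverse]
  simp

theorem kernelVec_spec (hΩ : IsSymplecticOn 𝓙 U Ω) (hC : (0 : Gam B F E) ∈ DefU U Ω)
    (hy : y ∈ baseDom B F E x₀) (β : F →L[ℝ] ℝ) (z : B × F) :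
    coordBilin 𝓙 (𝟎 x₀) Ω (y, 0) (kernelVec x₀ Ω β y, 0) z = β z.2 := by
  rw [← inverse_eq_kernelVec hΩ hC hy,
    (hΩ.coordBilin_isInvertible (mem_total_target hy) (chart_zero_mem hC hy)).self_apply_inverse]
  rfl

/-- For $v\in K$ the covector $\Omega(v,\cdot)$ is conormal, and $v$ is its dual. So duals of
conormal covectors exhaust $K$. -/
theorem eq_kernelVec (hΩ : IsSymplecticOn 𝓙 U Ω) (hC : (0 : Gam B F E) ∈ DefU U Ω)
    (hy : y ∈ baseDom B F E x₀) {v : B}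
    (hv : ∀ w, coordBilin 𝓙 (𝟎 x₀) Ω (y, 0) (v, 0) (w, 0) = 0) :
    v = kernelVec x₀ Ω ((coordBilin 𝓙 (𝟎 x₀) Ω (y, 0) (v, 0)).comp
      (ContinuousLinearMap.inr ℝ B F)) y := by
  have hi := hΩ.coordBilin_isInvertible (mem_total_target hy) (chart_zero_mem hC hy)
  have h : ((v, 0) : B × F) = (kernelVec x₀ Ω ((coordBilin 𝓙 (𝟎 x₀) Ω (y, 0) (v, 0)).comp
      (ContinuousLinearMap.inr ℝ B F)) y, 0) := by
    apply hi.injective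
    ext z
    · simp only [ContinuousLinearMap.comp_apply, ContinuousLinearMap.inl_apply,
        kernelVec_spec hΩ hC hy, hv z, map_zero]
    · simp [kernelVec_spec hΩ hC hy]
  exact congrArg Prod.fst h

theorem contDiffAt_kernelVec (hΩ : IsSymplecticOn 𝓙 U Ω) (hC : (0 : Gam B F E) ∈ DefU U Ω)
    (hy : y ∈ baseDom B F E x₀) (β : F →L[ℝ] ℝ) : ContDiffAt ℝ ∞ (kernelVec x₀ Ω β) y := by
  have h := (hΩ.contDiffAt_inverse (mem_total_target hy) (chart_zero_mem hC hy)).comp y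
    (contDiffAt_id.prodMk contDiffAt_const : ContDiffAt ℝ ∞ (fun y : B => (y, (0 : F))) y)
  exact (h.clm_apply contDiffAt_const).fst

open Classical in
variable (x₀ Ω) in
/-- The local section of the characteristic distribution with coordinates `kernelVec`. -/
def kernelField (β : F →L[ℝ] ℝ) (x : C) : kernelDist Ω x :=
  -- The value `0` is a default for points outside the coordinate domain; inside, `kernelVec_mem`
  -- selects the first branch.
  if h : fieldOfCoord 𝓘B x₀ (kernelVec x₀ Ω β) x ∈ kernelDist Ω x then ⟨_, h⟩ else 0

theorem kernelVec_mem (hΩ : IsSymplecticOn 𝓙 U Ω) (hC : (0 : Gam B F E) ∈ DefU U Ω)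
    (hy : y ∈ baseDom B F E x₀) (β : F →L[ℝ] ℝ) :
    chartD 𝓘B x₀ y (kernelVec x₀ Ω β y) ∈ kernelDist Ω ((extChartAt 𝓘B x₀).symm y) := by
  rw [mem_kernelDist_chart hy]
  intro w
  rw [kernelVec_spec hΩ hC hy]
  exact map_zero β

theorem kernelField_chart (hΩ : IsSymplecticOn 𝓙 U Ω) (hC : (0 : Gam B F E) ∈ DefU U Ω)
    (hy : y ∈ baseDom B F E x₀) (β : F →L[ℝ] ℝ) :
    kernelField x₀ Ω β ((extChartAt 𝓘B x₀).symm y)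
      = ⟨chartD 𝓘B x₀ y (kernelVec x₀ Ω β y), kernelVec_mem hΩ hC hy β⟩ := by
  have h := kernelVec_mem hΩ hC hy β
  have h1 := fieldOfCoord_chart_symm hy.1 (kernelVec x₀ Ω β)
  rw [← h1] at h
  rw [kernelField, dif_pos h]
  exact Subtype.ext h1

variable (B F E) in
/-- The domain in `C` of the coordinates centred at `x₀`. -/
def baseNhd (x₀ : C) : Set C := (extChartAt 𝓘B x₀).source ∩ (trivializationAt F E x₀).baseSet

theorem isOpen_baseNhd : IsOpen (baseNhd B F E x₀) :=
  (isOpen_extChartAt_source x₀).inter (trivializationAt F E x₀).open_baseSet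

theorem exists_of_mem_baseNhd {x : C} (hx : x ∈ baseNhd B F E x₀) :
    ∃ y ∈ baseDom B F E x₀, (extChartAt 𝓘B x₀).symm y = x := by
  have h := (extChartAt 𝓘B x₀).left_inv hx.1
  exact ⟨_, ⟨(extChartAt 𝓘B x₀).map_source hx.1, by rw [mem_preimage, h]; exact hx.2⟩, h⟩

theorem chart_symm_mem_baseNhd (hy : y ∈ baseDom B F E x₀) :
    (extChartAt 𝓘B x₀).symm y ∈ baseNhd B F E x₀ := ⟨(extChartAt 𝓘B x₀).map_target hy.1, hy.2⟩

theorem smoothKFieldOn_kernelField (hΩ : IsSymplecticOn 𝓙 U Ω) (hC : (0 : Gam B F E) ∈ DefU U Ω)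
    (β : F →L[ℝ] ℝ) :
    SmoothKFieldOn (kernelDist Ω) (baseNhd B F E x₀) (kernelField x₀ Ω β) := by
  intro x hx
  obtain ⟨y, hy, rfl⟩ := exists_of_mem_baseNhd hx
  refine (contMDiffAt_field_of_coord hy.1 (contDiffAt_kernelVec hΩ hC hy β) ?_).contMDiffWithinAt
  filter_upwards [isOpen_baseDom.mem_nhds hy] with z hz
  rw [kernelField_chart hΩ hC hz]

variable (x₀ Ω) in
/-- The coordinate expression of the presymplectic form on `C`. -/
def presymplecticCoord (y : B) : B →L[ℝ] B →L[ℝ] ℝ :=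
  pullbackForm (coordBilin 𝓙 (𝟎 x₀) Ω (y, (0 : F))) (ContinuousLinearMap.inl ℝ B F)

theorem presymplecticCoord_apply (y v w : B) : presymplecticCoord x₀ Ω y v w
    = coordBilin 𝓙 (𝟎 x₀) Ω (y, 0) (v, 0) (w, 0) := rfl

theorem presymplecticCoord_coordField (X : ∀ x, kernelDist Ω x) (hy : y ∈ baseDom B F E x₀)
    (w : B) :
    presymplecticCoord x₀ Ω y (coordField 𝓘B x₀ (fun x => (X x : TangentSpace 𝓘B x)) y) w = 0 := by
  rw [presymplecticCoord_apply]
  revert w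
  rw [← mem_kernelDist_chart hy, chartD_coordField hy.1]
  exact (X _).2

theorem contDiffAt_presymplecticCoord (hΩ : IsSymplecticOn 𝓙 U Ω)
    (hC : (0 : Gam B F E) ∈ DefU U Ω) (hy : y ∈ baseDom B F E x₀) :
    ContDiffAt ℝ ∞ (presymplecticCoord x₀ Ω) y :=
  contDiffAt_pullbackForm (contDiffAt_coordBilin_zero hΩ hC hy) contDiffAt_const

theorem presymplecticCoord_skew (hΩ : IsSymplecticOn 𝓙 U Ω) (hC : (0 : Gam B F E) ∈ DefU U Ω)
    (hy : y ∈ baseDom B F E x₀) (v w : B) :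
    presymplecticCoord x₀ Ω y v w = -presymplecticCoord x₀ Ω y w v := by
  rw [presymplecticCoord_apply, presymplecticCoord_apply]
  exact hΩ.coordBilin_skew (chart_zero_mem hC hy) (v, 0) (w, 0)

theorem presymplecticCoord_cyclic (hΩ : IsSymplecticOn 𝓙 U Ω) (hC : (0 : Gam B F E) ∈ DefU U Ω)
    (hy : y ∈ baseDom B F E x₀) (a b c : B) :
    fderiv ℝ (presymplecticCoord x₀ Ω) y a b c - fderiv ℝ (presymplecticCoord x₀ Ω) y b a c
      + fderiv ℝ (presymplecticCoord x₀ Ω) y c a b = 0 := by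
  have h1 := hΩ.contDiffAt_coordBilin (mem_total_target hy) (chart_zero_mem hC hy)
  have h2 := fderiv_pullbackForm_inl h1
  rw [show presymplecticCoord x₀ Ω = fun z => pullbackForm (coordBilin 𝓙 (𝟎 x₀) Ω (z, (0 : F)))
    (ContinuousLinearMap.inl ℝ B F) from rfl, h2, h2, h2]
  exact hΩ.cyclic (mem_total_target hy) (chart_zero_mem hC hy) _ _ _

theorem presymplecticCoord_lieBracket (hΩ : IsSymplecticOn 𝓙 U Ω)
    (hC : (0 : Gam B F E) ∈ DefU U Ω) (hy : y ∈ baseDom B F E x₀) {X Y : B → B}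
    (hX : DifferentiableAt ℝ X y) (hY : DifferentiableAt ℝ Y y)
    (hXk : ∀ᶠ z in 𝓝 y, ∀ w, presymplecticCoord x₀ Ω z (X z) w = 0)
    (hYk : ∀ᶠ z in 𝓝 y, ∀ w, presymplecticCoord x₀ Ω z (Y z) w = 0) (w : B) :
    presymplecticCoord x₀ Ω y (lieBracket ℝ X Y y) w = 0 := by
  have h1 : DifferentiableAt ℝ (presymplecticCoord x₀ Ω) y :=
    (contDiffAt_presymplecticCoord hΩ hC hy).differentiableAt (by simp)
  have h2 : ∀ᶠ z in 𝓝 y, ∀ a b, presymplecticCoord x₀ Ω z a b = -presymplecticCoord x₀ Ω z b a := by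
    filter_upwards [isOpen_baseDom.mem_nhds hy] with z hz using presymplecticCoord_skew hΩ hC hz
  have h3 := presymplecticCoord_cyclic hΩ hC hy
  exact lieBracket_mem_kernel h1 h2 h3 hX hY hXk hYk w

/-- In coordinates the pullback of $\Omega$ to $C$ is again skew and closed, so
`lieBracket_mem_kernel` applies to it. -/
theorem kernelDist_involutive (hΩ : IsSymplecticOn 𝓙 U Ω) (hC : (0 : Gam B F E) ∈ DefU U Ω) :
    Involutive (kernelDist Ω) := by
  intro W hW X Y hX hY x hx
  have key : ∀ y ∈ baseDom B F E x, (extChartAt 𝓘B x).symm y = x →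
      mlieBracket 𝓘B (fun y => (X y : TangentSpace 𝓘B y)) (fun y => Y y)
        ((extChartAt 𝓘B x).symm y) ∈ kernelDist Ω ((extChartAt 𝓘B x).symm y) := by
    intro y hy hyx
    have hX' : ContMDiffAt 𝓘B (𝓘B).tangent ∞ (fun x => (⟨x, X x⟩ : TangentBundle 𝓘B C))
      ((extChartAt 𝓘B x).symm y) := hX.contMDiffAt (hW.mem_nhds (by rwa [hyx]))
    have hY' : ContMDiffAt 𝓘B (𝓘B).tangent ∞ (fun x => (⟨x, Y x⟩ : TangentBundle 𝓘B C))
      ((extChartAt 𝓘B x).symm y) := hY.contMDiffAt (hW.mem_nhds (by rwa [hyx]))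
    rw [mlieBracket_chart hy.1 hX' hY', mem_kernelDist_chart hy]
    have hn := isOpen_baseDom.mem_nhds hy
    have hk : ∀ Z : ∀ x, kernelDist Ω x, ∀ᶠ z in 𝓝 y, ∀ w, presymplecticCoord x Ω z
        (coordField 𝓘B x (fun x => (Z x : TangentSpace 𝓘B x)) z) w = 0 := fun Z =>
      Filter.mem_of_superset hn fun z hz => presymplecticCoord_coordField Z hz
    exact fun w => presymplecticCoord_lieBracket hΩ hC hy
      ((contDiffAt_coordField hy.1 hX').differentiableAt (by simp))
      ((contDiffAt_coordField hy.1 hY').differentiableAt (by simp)) (hk X) (hk Y) w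
  have := key _ mem_baseDom_self (extChartAt_to_inv x)
  rwa [extChartAt_to_inv] at this

end KernelDistribution

/-! ### The isomorphism of sections of E with foliated one-forms -/

section FlatIsomorphism

variable {B : Type*} [NormedAddCommGroup B] [NormedSpace ℝ B] [FiniteDimensional ℝ B]
  {C : Type*} [TopologicalSpace C] [ChartedSpace B C] [IsManifold 𝓘(ℝ, B) ∞ C]
  {F : Type*} [NormedAddCommGroup F] [NormedSpace ℝ F] [FiniteDimensional ℝ F]
  {E : C → Type*} [TopologicalSpace (TotalSpace F E)] [∀ x, AddCommGroup (E x)]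
  [∀ x, Module ℝ (E x)] [∀ x, TopologicalSpace (E x)]
  [FiberBundle F E] [VectorBundle ℝ F E] [ContMDiffVectorBundle ∞ F E 𝓘(ℝ, B)]

local notation "𝓘B" => modelWithCornersSelf ℝ B
local notation "𝓙" => ModelWithCorners.prod (modelWithCornersSelf ℝ B) (modelWithCornersSelf ℝ F)
local notation "𝟎" => graphMap (0 : Gam B F E)

variable {x₀ : C} {y : B} {w : F} {U : Set (TotalSpace F E)} {Ω : BilinField B F E}

theorem coordForm_vert (hy : y ∈ baseDom B F E x₀) (e : E ((extChartAt 𝓘B x₀).symm y)) (v : B) :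
    Ω (𝟎 ((extChartAt 𝓘B x₀).symm y)) (vert B F E _ e) (zeroDeriv B F E _ (chartD 𝓘B x₀ y v))
      = coordBilin 𝓙 (𝟎 x₀) Ω (y, 0) (0, (trivializationAt F E x₀).continuousLinearMapAt ℝ
        ((extChartAt 𝓘B x₀).symm y) e) (v, 0) :=
  omega_zero_chart hy (vert_chart hy _) (zeroDeriv_chartD hy v)

/-- With $K$ parametrized by $F^*$, the pairing of $E$ and $K$ is minus evaluation, hence perfect.
Both injectivity and surjectivity of `flat` come from here. -/
theorem coordBilin_vert_kernelVec (hΩ : IsSymplecticOn 𝓙 U Ω) (hC : (0 : Gam B F E) ∈ DefU U Ω)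
    (hy : y ∈ baseDom B F E x₀) (f : F) (β : F →L[ℝ] ℝ) :
    coordBilin 𝓙 (𝟎 x₀) Ω (y, 0) (0, f) (kernelVec x₀ Ω β y, 0) = -β f := by
  rw [hΩ.coordBilin_skew (chart_zero_mem hC hy) (0, f) (kernelVec x₀ Ω β y, 0),
    kernelVec_spec hΩ hC hy]

theorem eq_zero_of_vert_kernelDist (hΩ : IsSymplecticOn 𝓙 U Ω) (hC : (0 : Gam B F E) ∈ DefU U Ω)
    (x : C) : ∀ e : E x, (∀ k ∈ kernelDist Ω x, Ω (𝟎 x) (vert B F E x e) (zeroDeriv B F E x k) = 0) →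
      e = 0 := by
  refine forall_of_chart (B := B) (F := F) (E := E) (P := fun x => ∀ e : E x, (∀ k ∈ kernelDist Ω x,
    Ω (𝟎 x) (vert B F E x e) (zeroDeriv B F E x k) = 0) → e = 0) (fun x₀ y hy e h => ?_) x
  have h1 : (trivializationAt F E x₀).continuousLinearMapAt ℝ ((extChartAt 𝓘B x₀).symm y) e = 0 := by
    refine SeparatingDual.eq_zero_of_forall_dual_eq_zero (R := ℝ) fun β => ?_
    have h2 := h _ (kernelVec_mem hΩ hC hy β)
    rw [coordForm_vert hy, coordBilin_vert_kernelVec hΩ hC hy, neg_eq_zero] at h2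
    exact h2
  rw [← (trivializationAt F E x₀).symmL_continuousLinearMapAt (R := ℝ) hy.2 e, h1, map_zero]

theorem flat_injective (hΩ : IsSymplecticOn 𝓙 U Ω) (hC : (0 : Gam B F E) ∈ DefU U Ω) :
    Function.Injective (flat Ω) := by
  refine (injective_iff_map_eq_zero _).2 fun σ h => ?_
  ext x
  exact eq_zero_of_vert_kernelDist hΩ hC x _ fun k hk =>
    LinearMap.congr_fun (congrFun h x) ⟨k, hk⟩

/-- The coordinate functionals of a basis. -/
def dualVec (j : Fin (Module.finrank ℝ F)) : F →L[ℝ] ℝ :=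
  LinearMap.toContinuousLinearMap ((Module.finBasis ℝ F).coord j)

theorem dualVec_sum (β : F →L[ℝ] ℝ) (f : F) :
    ∑ j, β (Module.finBasis ℝ F j) * dualVec j f = β f := by
  conv_rhs => rw [← (Module.finBasis ℝ F).sum_repr f, map_sum]
  refine Finset.sum_congr rfl fun j _ => ?_
  rw [map_smul, smul_eq_mul, mul_comm]
  rfl

theorem kernelVec_sum (hΩ : IsSymplecticOn 𝓙 U Ω) (hC : (0 : Gam B F E) ∈ DefU U Ω)
    (hy : y ∈ baseDom B F E x₀) (β : F →L[ℝ] ℝ) :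
    kernelVec x₀ Ω β y
      = ∑ j, β (Module.finBasis ℝ F j) • kernelVec x₀ Ω (dualVec (F := F) j) y := by
  have hi := hΩ.coordBilin_isInvertible (mem_total_target hy) (chart_zero_mem hC hy)
  have h : ((kernelVec x₀ Ω β y, 0) : B × F)
      = ∑ j, β (Module.finBasis ℝ F j) • ((kernelVec x₀ Ω (dualVec (F := F) j) y, 0) : B × F) := by
    apply hi.injective
    refine ContinuousLinearMap.ext fun z => ?_
    rw [kernelVec_spec hΩ hC hy, map_sum, sum_apply, ← dualVec_sum β z.2]
    refine Finset.sum_congr rfl fun j _ => ?_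
    rw [map_smul, smul_apply, kernelVec_spec hΩ hC hy, smul_eq_mul]
  have h1 := congrArg Prod.fst h
  rw [Prod.fst_sum] at h1
  exact h1

theorem exists_vert_eq (hΩ : IsSymplecticOn 𝓙 U Ω) (hC : (0 : Gam B F E) ∈ DefU U Ω)
    (x : C) : ∀ α : kernelDist Ω x →ₗ[ℝ] ℝ, ∃ e : E x, ∀ k : kernelDist Ω x,
      Ω (𝟎 x) (vert B F E x e) (zeroDeriv B F E x k) = α k := by
  refine forall_of_chart (B := B) (F := F) (E := E) (P := fun x => ∀ α : kernelDist Ω x →ₗ[ℝ] ℝ,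
    ∃ e : E x, ∀ k : kernelDist Ω x, Ω (𝟎 x) (vert B F E x e) (zeroDeriv B F E x k) = α k)
    (fun x₀ y hy α => ?_) x
  let k : (F →L[ℝ] ℝ) → kernelDist Ω ((extChartAt 𝓘B x₀).symm y) := fun β =>
    ⟨chartD 𝓘B x₀ y (kernelVec x₀ Ω β y), kernelVec_mem hΩ hC hy β⟩
  -- Forced by the pairing: the `j`-th coordinate must be minus the value of `α` on the vector dual
  -- to the `j`-th coordinate functional.
  let f : F := ∑ j, (-α (k (dualVec j))) • Module.finBasis ℝ F j
  refine ⟨(trivializationAt F E x₀).symmL ℝ _ f, ?_⟩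
  rintro ⟨v, hv⟩
  obtain ⟨v, rfl⟩ := chartD_surjective hy.1 v
  rw [mem_kernelDist_chart hy] at hv
  have hk := eq_kernelVec hΩ hC hy hv
  set β := (coordBilin 𝓙 (𝟎 x₀) Ω (y, 0) (v, 0)).comp (ContinuousLinearMap.inr ℝ B F)
  rw [coordForm_vert hy,
    (trivializationAt F E x₀).continuousLinearMapAt_symmL (R := ℝ) hy.2 f]
  have h1 : (⟨chartD 𝓘B x₀ y v, (mem_kernelDist_chart hy v).2 hv⟩ :
      kernelDist Ω ((extChartAt 𝓘B x₀).symm y))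
      = ∑ j, β (Module.finBasis ℝ F j) • k (dualVec j) := by
    apply Subtype.ext
    rw [AddSubmonoidClass.coe_finsetSum]
    show chartD 𝓘B x₀ y v = ∑ j, β (Module.finBasis ℝ F j) •
      chartD 𝓘B x₀ y (kernelVec x₀ Ω (dualVec (F := F) j) y)
    conv_lhs => rw [hk, kernelVec_sum hΩ hC hy, map_sum]
    simp only [map_smul]
  rw [h1, map_sum, hk, coordBilin_vert_kernelVec hΩ hC hy, map_sum, ← Finset.sum_neg_distrib]
  refine Finset.sum_congr rfl fun j _ => ?_
  rw [map_smul, map_smul, smul_eq_mul, smul_eq_mul]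
  ring

theorem range_flat (hΩ : IsSymplecticOn 𝓙 U Ω) (hC : (0 : Gam B F E) ∈ DefU U Ω) :
    LinearMap.range (flat Ω) = foliatedOneForms (kernelDist Ω) := by
  apply le_antisymm
  · rintro _ ⟨σ, rfl⟩ W hW X hX x hx
    have key : ∀ y ∈ baseDom B F E x, (extChartAt 𝓘B x).symm y = x →
        ContMDiffAt 𝓘B 𝓘(ℝ, ℝ) ∞ (fun x => flat Ω σ x (X x)) ((extChartAt 𝓘B x).symm y) := by
      intro y hy hyx
      have hX' : ContMDiffAt 𝓘B (𝓘B).tangent ∞ (fun x => (⟨x, X x⟩ : TangentBundle 𝓘B C))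
        ((extChartAt 𝓘B x).symm y) := hX.contMDiffAt (hW.mem_nhds (by rwa [hyx]))
      refine contMDiffAt_of_comp_chart_symm hy.1 (((contDiffAt_coordForm_flatForm hΩ hC σ hy).clm_apply
        (contDiffAt_coordField hy.1 hX')).congr_of_eventuallyEq ?_)
      filter_upwards [isOpen_baseDom.mem_nhds hy] with z hz
      exact (coordForm_coordField hz.1 (flatForm Ω σ) (fun p => (X p : TangentSpace 𝓘B p))).symm
    have h := key _ mem_baseDom_self (extChartAt_to_inv x)
    rw [extChartAt_to_inv] at h
    exact h.contMDiffWithinAt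
  · intro α hα
    choose σ hσ using fun x => exists_vert_eq hΩ hC x (α x)
    have hs : ContMDiff 𝓘B 𝓙 ∞ (fun x => TotalSpace.mk' F x (σ x)) := by
      intro x
      rw [Bundle.contMDiffAt_section]
      have hy := mem_baseDom_self (B := B) (F := F) (E := E) (x₀ := x)
      have h : ContMDiffAt 𝓘B 𝓘(ℝ, F) ∞ (fun z => (trivializationAt F E x ⟨z, σ z⟩).2)
          ((extChartAt 𝓘B x).symm (extChartAt 𝓘B x x)) := by
        refine contMDiffAt_of_comp_chart_symm hy.1 ?_
        -- The pointwise preimage `σ` is smooth because its `j`-th coordinate is minus the value of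
        -- `α` on the smooth local section `kernelField x Ω (dualVec j)` of the kernel.
        have h1 : ∀ j, ContDiffAt ℝ ∞ (fun y => dualVec (F := F) j (sectCoord F x σ y))
            (extChartAt 𝓘B x x) := by
          intro j
          have h2 := (hα _ isOpen_baseNhd _ (smoothKFieldOn_kernelField (x₀ := x) hΩ hC
            (dualVec j))).contMDiffAt (isOpen_baseNhd.mem_nhds (chart_symm_mem_baseNhd hy))
          refine (h2.comp _ (contMDiffAt_chart_symm hy.1)).neg.contDiffAt.congr_of_eventuallyEq ?_
          filter_upwards [isOpen_baseDom.mem_nhds hy] with z hz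
          have h3 := hσ ((extChartAt 𝓘B x).symm z) (kernelField x Ω (dualVec j) _)
          have h5 : Ω (𝟎 ((extChartAt 𝓘B x).symm z)) (vert B F E _ (σ _))
              (zeroDeriv B F E _ (kernelField x Ω (dualVec j) ((extChartAt 𝓘B x).symm z)))
              = -dualVec j (sectCoord F x σ z) := by
            rw [kernelField_chart hΩ hC hz]
            rw [coordForm_vert hz, coordBilin_vert_kernelVec hΩ hC hz, ← sectCoord_eq _ hz]
          rw [h3] at h5
          exact (neg_eq_iff_eq_neg.2 h5).symm
        have h4 : (fun y : B => sectCoord F x σ y) = fun y => ∑ j,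
            dualVec (F := F) j (sectCoord F x σ y) • Module.finBasis ℝ F j := by
          funext y
          exact ((Module.finBasis ℝ F).sum_repr _).symm
        show ContDiffAt ℝ ∞ (fun y : B => sectCoord F x σ y) _
        rw [h4]
        exact ContDiffAt.sum fun j _ => (h1 j).smul contDiffAt_const
      rwa [extChartAt_to_inv] at h
    exact ⟨⟨σ, hs⟩, funext fun x => LinearMap.ext fun k => hσ x k⟩

/-- The foliated form `flat Ω σ` is the restriction of the one-form `flatForm Ω σ` on $C$, so
$d_{\mathfrak F}$ of it is the restriction of the tensorial $d$. Conversely every kernel vector at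
`y` extends to some `kernelField`, so closedness on sections gives symmetry on all kernel vectors.
-/
theorem flat_mem_closedFoliated_iff (hΩ : IsSymplecticOn 𝓙 U Ω) (hC : (0 : Gam B F E) ∈ DefU U Ω)
    (σ : Gam B F E) : flat Ω σ ∈ closedFoliated (kernelDist Ω) ↔
      ∀ x₀, ∀ y ∈ baseDom B F E x₀, ∀ v w : B,
        (∀ u, coordBilin 𝓙 (𝟎 x₀) Ω (y, 0) (v, 0) (u, 0) = 0) →
        (∀ u, coordBilin 𝓙 (𝟎 x₀) Ω (y, 0) (w, 0) (u, 0) = 0) →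
        fderiv ℝ (coordForm 𝓘B x₀ (flatForm Ω σ)) y v w
          = fderiv ℝ (coordForm 𝓘B x₀ (flatForm Ω σ)) y w v := by
  constructor
  · rintro ⟨-, h⟩ x₀ y hy v w hv hw
    have hn := isOpen_baseNhd.mem_nhds (chart_symm_mem_baseNhd hy)
    have hX := fun β => smoothKFieldOn_kernelField (x₀ := x₀) hΩ hC β
    have h1 := fun β β' => h _ isOpen_baseNhd _ _ (hX β) (hX β') _ (chart_symm_mem_baseNhd hy)
      (kernelDist_involutive hΩ hC _ isOpen_baseNhd _ _ (hX β) (hX β') _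
        (chart_symm_mem_baseNhd hy))
    have h2 := fun β β' => dOneForm_chart hy.1 ((hX β).contMDiffAt hn) ((hX β').contMDiffAt hn)
      (flatForm Ω σ) ((contDiffAt_coordForm_flatForm hΩ hC σ hy).differentiableAt (by simp))
    have h3 : ∀ β, coordField 𝓘B x₀ (fun x => (kernelField x₀ Ω β x : TangentSpace 𝓘B x)) y
        = kernelVec x₀ Ω β y := fun β => by
      rw [coordField, kernelField_chart hΩ hC hy]
      exact mfderiv_chart_chartD hy.1 _
    have h4 := fun β β' => (h2 β β').symm.trans (h1 β β')
    simp only [h3] at h4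
    have h5 := h4
      ((coordBilin 𝓙 (𝟎 x₀) Ω (y, 0) (v, 0)).comp (ContinuousLinearMap.inr ℝ B F))
      ((coordBilin 𝓙 (𝟎 x₀) Ω (y, 0) (w, 0)).comp (ContinuousLinearMap.inr ℝ B F))
    rw [← eq_kernelVec hΩ hC hy hv, ← eq_kernelVec hΩ hC hy hw] at h5
    exact sub_eq_zero.1 h5
  · intro h
    refine ⟨range_flat hΩ hC ▸ ⟨σ, rfl⟩, ?_⟩
    intro W hW X Y hX hY x hx
    have key : ∀ y ∈ baseDom B F E x, (extChartAt 𝓘B x).symm y = x →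
      dirDeriv 𝓘B (fun y => flatForm Ω σ y (Y y)) ((extChartAt 𝓘B x).symm y)
          (X ((extChartAt 𝓘B x).symm y))
        - dirDeriv 𝓘B (fun y => flatForm Ω σ y (X y)) ((extChartAt 𝓘B x).symm y)
          (Y ((extChartAt 𝓘B x).symm y))
        - flatForm Ω σ ((extChartAt 𝓘B x).symm y) (mlieBracket 𝓘B
          (fun y => (X y : TangentSpace 𝓘B y)) (fun y => Y y) ((extChartAt 𝓘B x).symm y)) = 0 := by
      intro y hy hyx
      have hX' : ContMDiffAt 𝓘B (𝓘B).tangent ∞ (fun x => (⟨x, X x⟩ : TangentBundle 𝓘B C))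
        ((extChartAt 𝓘B x).symm y) := hX.contMDiffAt (hW.mem_nhds (by rwa [hyx]))
      have hY' : ContMDiffAt 𝓘B (𝓘B).tangent ∞ (fun x => (⟨x, Y x⟩ : TangentBundle 𝓘B C))
        ((extChartAt 𝓘B x).symm y) := hY.contMDiffAt (hW.mem_nhds (by rwa [hyx]))
      have hk : ∀ Z : ∀ x, kernelDist Ω x, ∀ u, coordBilin 𝓙 (𝟎 x) Ω (y, 0)
          (coordField 𝓘B x (fun x => (Z x : TangentSpace 𝓘B x)) y, 0) (u, 0) = 0 := fun Z u => by
        rw [← presymplecticCoord_apply, presymplecticCoord_coordField Z hy]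
      have h1 := h x y hy _ _ (hk X) (hk Y)
      rw [dOneForm_chart hy.1 hX' hY' (flatForm Ω σ)
        ((contDiffAt_coordForm_flatForm hΩ hC σ hy).differentiableAt (by simp)), h1, sub_self]
    have h1 := key _ mem_baseDom_self (extChartAt_to_inv x)
    rw [extChartAt_to_inv] at h1
    exact fun _ => h1

end FlatIsomorphism

/-! ### Shears and the pullback of a closed form under the sections tσ -/

section Shear

variable {B F : Type*} [NormedAddCommGroup B] [NormedSpace ℝ B]
  [NormedAddCommGroup F] [NormedSpace ℝ F]

/-- The shear `(v, w) ↦ (v, w + L v)`. -/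
def shear (L : B →L[ℝ] F) : (B × F) →L[ℝ] (B × F) :=
  (ContinuousLinearMap.fst ℝ B F).prod
    (ContinuousLinearMap.snd ℝ B F + L.comp (ContinuousLinearMap.fst ℝ B F))

theorem shear_apply (L : B →L[ℝ] F) (z : B × F) : shear L z = (z.1, z.2 + L z.1) := rfl

theorem shear_neg_shear (L : B →L[ℝ] F) (z : B × F) : shear (-L) (shear L z) = z := by
  simp [shear_apply]

theorem shear_shear_neg (L : B →L[ℝ] F) (z : B × F) : shear L (shear (-L) z) = z := by
  simp [shear_apply]

theorem shear_surjective (L : B →L[ℝ] F) : Function.Surjective (shear L) :=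
  Function.RightInverse.surjective (shear_shear_neg L)

theorem shear_injective (L : B →L[ℝ] F) : Function.Injective (shear L) :=
  Function.LeftInverse.injective (shear_neg_shear L)

theorem contDiff_shear : ContDiff ℝ ∞ (shear (B := B) (F := F)) := by
  have h : shear (B := B) (F := F) = fun L => ContinuousLinearMap.id ℝ (B × F) +
      (ContinuousLinearMap.inr ℝ B F).comp (L.comp (ContinuousLinearMap.fst ℝ B F)) := by
    funext L
    ext z <;> simp [shear_apply]
  rw [h]
  exact contDiff_const.add (contDiff_const.clm_comp (contDiff_id.clm_comp contDiff_const))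

theorem pullbackForm_shear_isInvertible [FiniteDimensional ℝ B] [FiniteDimensional ℝ F]
    {Θ : (B × F) →L[ℝ] (B × F) →L[ℝ] ℝ} (hΘ : Θ.IsInvertible) (L : B →L[ℝ] F) :
    (pullbackForm Θ (shear L)).IsInvertible := by
  refine isInvertible_of_nondegenerate fun v h => shear_injective L ?_
  rw [map_zero]
  apply hΘ.injective
  rw [map_zero]
  ext w
  · obtain ⟨u, hu⟩ := shear_surjective L ((ContinuousLinearMap.inl ℝ B F) w)
    have h1 := h u
    rw [pullbackForm_apply, hu] at h1
    simpa using h1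
  · obtain ⟨u, hu⟩ := shear_surjective L ((ContinuousLinearMap.inr ℝ B F) w)
    have h1 := h u
    rw [pullbackForm_apply, hu] at h1
    simpa using h1

/-- The derivative of the pullback of a closed two-form under the sections `t σ`. -/
theorem hasDerivAt_pullback_smul [FiniteDimensional ℝ B] [FiniteDimensional ℝ F]
    {Θ : B × F → (B × F) →L[ℝ] (B × F) →L[ℝ] ℝ} {σ : B → F} {O : Set B} {y : B} (hO : IsOpen O)
    (hy : y ∈ O) (hσ : ContDiffOn ℝ ∞ σ O) (hΘ : ContDiffAt ℝ ∞ Θ (y, 0))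
    (hskew : ∀ a b, Θ (y, 0) a b = -Θ (y, 0) b a)
    (hcyc : ∀ a b c, fderiv ℝ Θ (y, 0) a b c - fderiv ℝ Θ (y, 0) b a c
      + fderiv ℝ Θ (y, 0) c a b = 0) {α : B → B →L[ℝ] ℝ}
    (hα : ∀ z ∈ O, ∀ v, α z v = Θ (z, 0) (0, σ z) (v, 0)) (v w : B) :
    HasDerivAt (fun t : ℝ => pullbackForm (Θ (y, t • σ y)) (shear (t • fderiv ℝ σ y)) (v, 0) (w, 0))
      (fderiv ℝ α y v w - fderiv ℝ α y w v) 0 := by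
  -- The graphs of `t • σ` as a family of embeddings. The velocity at `t = 0` is `(0, σ)`, so the
  -- form in Cartan's formula is `α`.
  let f : ℝ × B → B × F := fun p => (p.2, p.1 • σ p.2)
  have hf : ContDiffOn ℝ ∞ f (univ ×ˢ O) :=
    contDiffOn_snd.prodMk (contDiffOn_fst.smul (hσ.comp contDiffOn_snd fun p hp => hp.2))
  have hfd : ∀ (t : ℝ) (z : B), z ∈ O → ∀ (τ : ℝ) (v : B),
      fderivWithin ℝ f (univ ×ˢ O) (t, z) (τ, v) = (v, t • fderiv ℝ σ z v + τ • σ z) := by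
    intro t z hz τ v
    have h1 : HasFDerivAt σ (fderiv ℝ σ z) z :=
      ((hσ.contDiffAt (hO.mem_nhds hz)).differentiableAt (by simp)).hasFDerivAt
    have h2 : HasFDerivAt (fun p : ℝ × B => σ p.2)
        ((fderiv ℝ σ z).comp (ContinuousLinearMap.snd ℝ ℝ B)) (t, z) :=
      HasFDerivAt.comp (t, z) h1 hasFDerivAt_snd
    have h3 : HasFDerivAt f _ (t, z) := hasFDerivAt_snd.prodMk (hasFDerivAt_fst.smul h2)
    rw [fderivWithin_of_isOpen (isOpen_univ.prod hO) ⟨mem_univ _, hz⟩, h3.fderiv]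
    simp
  have hf0 : ∀ z, f (0, z) = (z, 0) := fun z => by simp [f]
  have h := hasDerivWithinAt_pullback (Θ := Θ) (f := f) uniqueDiffOn_univ (mem_univ (0 : ℝ))
    (by simp) hO hy hf (by rwa [hf0]) (by rwa [hf0]) (by rwa [hf0]) v w
  rw [hasDerivWithinAt_univ] at h
  have hα' : velocityForm Θ f (univ ×ˢ O) 0 =ᶠ[𝓝 y] α := by
    filter_upwards [hO.mem_nhds hy] with z hz
    refine ContinuousLinearMap.ext fun v => ?_
    rw [hα z hz, velocityForm]
    simp [hfd 0 z hz, hf0]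
  rw [hα'.fderiv_eq] at h
  refine h.congr_of_eventuallyEq (Filter.Eventually.of_forall fun t => ?_)
  beta_reduce
  rw [hfd t y hy, hfd t y hy, pullbackForm_apply, shear_apply, shear_apply]
  simp [f]

end Shear

/-! ### The bivector μ(s) in coordinates -/

section MaurerCartan

variable {B : Type*} [NormedAddCommGroup B] [NormedSpace ℝ B] [FiniteDimensional ℝ B]
  {C : Type*} [TopologicalSpace C] [ChartedSpace B C] [IsManifold 𝓘(ℝ, B) ∞ C]
  {F : Type*} [NormedAddCommGroup F] [NormedSpace ℝ F] [FiniteDimensional ℝ F]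
  {E : C → Type*} [TopologicalSpace (TotalSpace F E)] [∀ x, AddCommGroup (E x)]
  [∀ x, Module ℝ (E x)] [∀ x, TopologicalSpace (E x)]
  [FiberBundle F E] [VectorBundle ℝ F E] [ContMDiffVectorBundle ∞ F E 𝓘(ℝ, B)]

local notation "𝓘B" => modelWithCornersSelf ℝ B
local notation "𝓙" => ModelWithCorners.prod (modelWithCornersSelf ℝ B) (modelWithCornersSelf ℝ F)
local notation "𝟎" => graphMap (0 : Gam B F E)

variable {x₀ : C} {y : B} {w : F} {U : Set (TotalSpace F E)} {Ω : BilinField B F E}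

theorem extChartAt_shift (s : Gam B F E) (hy : y ∈ baseDom B F E x₀) :
    shift s ((extChartAt 𝓙 (𝟎 x₀)).symm (y, w)) ∈ (extChartAt 𝓙 (𝟎 x₀)).source ∧
      coordMap 𝓙 𝓙 (𝟎 x₀) (𝟎 x₀) (shift s) (y, w) = (y, w - sectCoord F x₀ s y) := by
  let s' : ∀ x, E x := fun x => (trivializationAt F E x₀).symm x w - s x
  have h : shift s ((extChartAt 𝓙 (𝟎 x₀)).symm (y, w))
      = ⟨(extChartAt 𝓘B x₀).symm y, s' ((extChartAt 𝓘B x₀).symm y)⟩ := by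
    rw [extChartAt_total_symm hy]
    rfl
  refine ⟨h ▸ graphMap_chart_mem s' hy, ?_⟩
  rw [coordMap, h, extChartAt_total_graph s' hy, sectCoord_eq s' hy, map_sub, ← sectCoord_eq s hy]
  congr 2
  exact (congrArg _ ((trivializationAt F E x₀).symmL_apply (R := ℝ) hy.2 w).symm).trans
    ((trivializationAt F E x₀).continuousLinearMapAt_symmL (R := ℝ) hy.2 w)

theorem hasFDerivAt_coordShift (s : Gam B F E) (hy : y ∈ baseDom B F E x₀) :
    HasFDerivAt (coordMap 𝓙 𝓙 (𝟎 x₀) (𝟎 x₀) (shift s)) (shear (-fderiv ℝ (sectCoord F x₀ s) y))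
      (y, w) := by
  have h1 : HasFDerivAt (sectCoord F x₀ s) (fderiv ℝ (sectCoord F x₀ s) y) y :=
    ((contDiffAt_sectCoord s hy).differentiableAt (by simp)).hasFDerivAt
  have h2 : HasFDerivAt (fun p : B × F => sectCoord F x₀ s p.1)
      ((fderiv ℝ (sectCoord F x₀ s) y).comp (ContinuousLinearMap.fst ℝ B F)) (y, w) :=
    HasFDerivAt.comp (f := Prod.fst) (g := sectCoord F x₀ s) (y, w) h1 hasFDerivAt_fst
  have h3 : HasFDerivAt (fun p : B × F => (p.1, p.2 - sectCoord F x₀ s p.1)) _ (y, w) :=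
    hasFDerivAt_fst.prodMk (hasFDerivAt_snd.sub h2)
  have h4 : coordMap 𝓙 𝓙 (𝟎 x₀) (𝟎 x₀) (shift s)
      =ᶠ[𝓝 (y, w)] fun p : B × F => (p.1, p.2 - sectCoord F x₀ s p.1) := by
    filter_upwards [(isOpen_extChartAt_target (I := 𝓙) (𝟎 x₀)).mem_nhds (mem_total_target hy)]
      with p hp
    rw [extChartAt_total_target] at hp
    exact (extChartAt_shift s hp.1).2
  refine (h3.congr_of_eventuallyEq h4).congr_fderiv ?_
  ext z <;> simp [shear_apply, sub_eq_add_neg]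

theorem mdifferentiableAt_shift (s : Gam B F E) (hy : y ∈ baseDom B F E x₀) :
    MDifferentiableAt 𝓙 𝓙 (shift s) ((extChartAt 𝓙 (𝟎 x₀)).symm (y, w)) := by
  have ht := mem_total_target (w := w) hy
  have hs := (extChartAt 𝓙 (𝟎 x₀)).map_target ht
  have hr := (extChartAt 𝓙 (𝟎 x₀)).right_inv ht
  have h2 := (extChartAt_shift (w := w) s hy).2
  have h1 : MDifferentiableAt 𝓘(ℝ, B × F) 𝓙 (extChartAt 𝓙 (𝟎 x₀)).symm
      (coordMap 𝓙 𝓙 (𝟎 x₀) (𝟎 x₀) (shift s)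
        (extChartAt 𝓙 (𝟎 x₀) ((extChartAt 𝓙 (𝟎 x₀)).symm (y, w)))) := by
    rw [hr, h2]
    exact mdifferentiableAt_chart_symm (mem_total_target hy)
  have h3 : MDifferentiableAt 𝓘(ℝ, B × F) 𝓘(ℝ, B × F) (coordMap 𝓙 𝓙 (𝟎 x₀) (𝟎 x₀) (shift s))
      (extChartAt 𝓙 (𝟎 x₀) ((extChartAt 𝓙 (𝟎 x₀)).symm (y, w))) := by
    rw [hr]
    exact (hasFDerivAt_coordShift s hy).differentiableAt.mdifferentiableAt
  have h4 := (contMDiffAt_chart hs).mdifferentiableAt (n := ∞) (by simp)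
  refine (MDifferentiableAt.comp (f := coordMap 𝓙 𝓙 (𝟎 x₀) (𝟎 x₀) (shift s) ∘
    extChartAt 𝓙 (𝟎 x₀)) ((extChartAt 𝓙 (𝟎 x₀)).symm (y, w)) h1 (h3.comp _ h4)).congr_of_eventuallyEq ?_
  filter_upwards [(isOpen_extChartAt_source (I := 𝓙) (𝟎 x₀)).mem_nhds hs] with p hp
  have h5 := (extChartAt 𝓙 (𝟎 x₀)).left_inv hp
  have h6 := (extChartAt 𝓙 (𝟎 x₀)).map_source hp
  rw [extChartAt_total_target] at h6
  have h7 := (extChartAt_shift (w := (extChartAt 𝓙 (𝟎 x₀) p).2) s h6.1).1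
  rw [Prod.mk.eta, h5] at h7
  rw [Function.comp_apply, Function.comp_apply, coordMap, h5]
  exact ((extChartAt 𝓙 (𝟎 x₀)).left_inv h7).symm

theorem mfderiv_shift (s : Gam B F E) (hy : y ∈ baseDom B F E x₀) (z : B × F) :
    (mfderiv 𝓙 𝓙 (shift s) ((extChartAt 𝓙 (𝟎 x₀)).symm (y, sectCoord F x₀ s y))
      (chartD 𝓙 (𝟎 x₀) (y, sectCoord F x₀ s y) z) : B × F)
      = chartD 𝓙 (𝟎 x₀) (y, (0 : F)) (shear (-fderiv ℝ (sectCoord F x₀ s) y) z) := by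
  have h1 := extChartAt_shift (w := sectCoord F x₀ s y) s hy
  have h := mfderiv_chartD (I' := 𝓙) (y₀ := 𝟎 x₀) (mem_total_target (w := sectCoord F x₀ s y) hy)
    (mdifferentiableAt_shift s hy) h1.1 z
  rw [h1.2, sub_self, (hasFDerivAt_coordShift s hy).fderiv] at h
  exact h

variable (x₀ Ω) in
/-- The coordinate expression of `(ψ_{-s})_* Ω` along the zero section. -/
def shiftedForm (s : Gam B F E) (y : B) : (B × F) →L[ℝ] (B × F) →L[ℝ] ℝ :=
  pullbackForm (coordBilin 𝓙 (𝟎 x₀) Ω (y, sectCoord F x₀ s y))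
    (shear (fderiv ℝ (sectCoord F x₀ s) y))

variable (x₀) in
/-- The coordinate expression of a covector along the zero section. -/
def coordCovec (y : B) (a : TT B (𝟎 ((extChartAt 𝓘B x₀).symm y)) →L[ℝ] ℝ) : (B × F) →L[ℝ] ℝ :=
  (a : (B × F) →L[ℝ] ℝ).comp (chartD 𝓙 (𝟎 x₀) (y, (0 : F)) : (B × F) →L[ℝ] (B × F))

theorem shiftedForm_isInvertible (hΩ : IsSymplecticOn 𝓙 U Ω) (s : Gam B F E)
    (hy : y ∈ baseDom B F E x₀) (hs : graphMap s ((extChartAt 𝓘B x₀).symm y) ∈ U) :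
    (shiftedForm x₀ Ω s y).IsInvertible :=
  pullbackForm_shear_isInvertible (hΩ.coordBilin_isInvertible (mem_total_target hy) (by
    rw [chart_symm_sectCoord s hy]; exact hs)) _

/-- Pushing $\Pi$ forward by $\psi_{-s}$ amounts to inverting the pullback of $\Omega$ by the
inverse of $D\psi_{-s}$, which is the shear by $Ds$. Inverses are carried first through the chart
and then through the shear. -/
theorem mu_chart (hΩ : IsSymplecticOn 𝓙 U Ω) (s : Gam B F E) (hy : y ∈ baseDom B F E x₀)
    (hs : graphMap s ((extChartAt 𝓘B x₀).symm y) ∈ U)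
    (a b : TT B (𝟎 ((extChartAt 𝓘B x₀).symm y)) →L[ℝ] ℝ) :
    mu Ω s ((extChartAt 𝓘B x₀).symm y) a b
      = -coordCovec x₀ y b ((shiftedForm x₀ Ω s y).inverse (coordCovec x₀ y a)) := by
  have hp := chart_symm_sectCoord s hy
  -- The base point is generalized so that it can be replaced by its chart expression, although the
  -- derivative of the shift is typed over it.
  have key : ∀ p, (extChartAt 𝓙 (𝟎 x₀)).symm (y, sectCoord F x₀ s y) = p → p ∈ U →
      poisson Ω p
        ((a : (B × F) →L[ℝ] ℝ) ∘L (mfderiv 𝓙 𝓙 (shift s) p : (B × F) →L[ℝ] (B × F)))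
        ((b : (B × F) →L[ℝ] ℝ) ∘L (mfderiv 𝓙 𝓙 (shift s) p : (B × F) →L[ℝ] (B × F)))
      = -coordCovec x₀ y b ((shiftedForm x₀ Ω s y).inverse (coordCovec x₀ y a)) := by
    rintro _ rfl hU
    have ht := mem_total_target (w := sectCoord F x₀ s y) hy
    set D := fderiv ℝ (sectCoord F x₀ s) y
    have hα : ∀ a : (B × F) →L[ℝ] ℝ, ((a ∘L (mfderiv 𝓙 𝓙 (shift s)
        ((extChartAt 𝓙 (𝟎 x₀)).symm (y, sectCoord F x₀ s y)) : (B × F) →L[ℝ] (B × F))).comp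
        (chartD 𝓙 (𝟎 x₀) (y, sectCoord F x₀ s y) : (B × F) →L[ℝ] (B × F)))
        = (a.comp (chartD 𝓙 (𝟎 x₀) (y, (0 : F)) : (B × F) →L[ℝ] (B × F))).comp (shear (-D)) :=
      fun a => ContinuousLinearMap.ext fun z => congrArg a (mfderiv_shift s hy z)
    have h1 := hΩ.inverse_chart ht hU ((a : (B × F) →L[ℝ] ℝ) ∘L (mfderiv 𝓙 𝓙 (shift s)
        ((extChartAt 𝓙 (𝟎 x₀)).symm (y, sectCoord F x₀ s y)) : (B × F) →L[ℝ] (B × F)))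
    have h2 := apply_inverse_pullbackForm (shear_surjective D) (hΩ.coordBilin_isInvertible ht hU)
      (shiftedForm_isInvertible hΩ s hy hs) ((coordCovec x₀ y a).comp (shear (-D)))
    have h3 : ((coordCovec x₀ y a).comp (shear (-D))).comp (shear D) = coordCovec x₀ y a :=
      ContinuousLinearMap.ext fun z => congrArg (coordCovec x₀ y a) (shear_neg_shear D z)
    rw [h3] at h2
    have h4 := DFunLike.congr_fun (hα b) ((coordBilin 𝓙 (𝟎 x₀) Ω (y, sectCoord F x₀ s y)).inverse
      ((coordCovec x₀ y a).comp (shear (-D))))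
    have h5 := hα a
    rw [poisson, h1]
    refine congrArg Neg.neg ?_
    refine Eq.trans (congrArg (fun c => ((b : (B × F) →L[ℝ] ℝ) ∘L (mfderiv 𝓙 𝓙 (shift s)
        ((extChartAt 𝓙 (𝟎 x₀)).symm (y, sectCoord F x₀ s y)) : (B × F) →L[ℝ] (B × F)))
        (chartD 𝓙 (𝟎 x₀) (y, sectCoord F x₀ s y)
          ((coordBilin 𝓙 (𝟎 x₀) Ω (y, sectCoord F x₀ s y)).inverse c) : B × F)) h5) ?_
    refine h4.trans ?_
    show coordCovec x₀ y b (shear (-D) _) = _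
    rw [← h2, shear_neg_shear]
    rfl
  exact key _ hp hs

theorem isConormal_iff_chart (hy : y ∈ baseDom B F E x₀)
    (a : TT B (𝟎 ((extChartAt 𝓘B x₀).symm y)) →L[ℝ] ℝ) :
    IsConormal B F E _ a ↔ ∃ β : F →L[ℝ] ℝ,
      coordCovec x₀ y a = β.comp (ContinuousLinearMap.snd ℝ B F) := by
  have h0 : ∀ v, a (zeroDeriv B F E _ (chartD 𝓘B x₀ y v)) = coordCovec x₀ y a (v, 0) := fun v =>
    congrArg (a : (B × F) →L[ℝ] ℝ) (zeroDeriv_chartD hy v)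
  constructor
  · intro h
    refine ⟨(coordCovec x₀ y a).comp (ContinuousLinearMap.inr ℝ B F), ?_⟩
    ext z
    · have h1 := (h0 z).symm.trans (h _)
      simp only [ContinuousLinearMap.comp_apply, ContinuousLinearMap.inl_apply, h1,
        ContinuousLinearMap.coe_snd', map_zero]
    · simp
  · rintro ⟨β, hβ⟩ v
    obtain ⟨v, rfl⟩ := chartD_surjective hy.1 v
    rw [h0, hβ]
    simp

theorem exists_conormal (hy : y ∈ baseDom B F E x₀) (β : F →L[ℝ] ℝ) :
    ∃ a : TT B (𝟎 ((extChartAt 𝓘B x₀).symm y)) →L[ℝ] ℝ,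
      coordCovec x₀ y a = β.comp (ContinuousLinearMap.snd ℝ B F) := by
  refine ⟨((β.comp (ContinuousLinearMap.snd ℝ B F)).comp (mfderiv 𝓙 𝓘(ℝ, B × F)
    (extChartAt 𝓙 (𝟎 x₀)) ((extChartAt 𝓙 (𝟎 x₀)).symm (y, 0)) : (B × F) →L[ℝ] (B × F)) :
      (B × F) →L[ℝ] ℝ), ?_⟩
  refine ContinuousLinearMap.ext fun z => ?_
  exact congrArg (β.comp (ContinuousLinearMap.snd ℝ B F))
    (mfderiv_chart_chartD (mem_total_target (w := 0) hy) z)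

end MaurerCartan

theorem contDiffAt_comp_form {V M : Type*} [NormedAddCommGroup V] [NormedSpace ℝ V]
    [NormedAddCommGroup M] [NormedSpace ℝ M] {Θ : M → M →L[ℝ] M →L[ℝ] ℝ} {f : V → M} {x : V}
    (hΘ : ContDiffAt ℝ ∞ Θ (f x)) (hf : ContDiffAt ℝ ∞ f x) :
    ContDiffAt ℝ ∞ (fun y => Θ (f y)) x := hΘ.comp x hf

/-- The derivative of the inverse of a family of skew forms. -/
theorem hasDerivAt_inverse_form {M : Type*} [NormedAddCommGroup M] [NormedSpace ℝ M]
    [FiniteDimensional ℝ M] {Θ : ℝ → M →L[ℝ] M →L[ℝ] ℝ} (hΘ : ContDiffAt ℝ ∞ Θ 0)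
    (hi : ∀ᶠ t in 𝓝 0, (Θ t).IsInvertible) (hskew : ∀ a b, Θ 0 a b = -Θ 0 b a)
    {a b : M →L[ℝ] ℝ} {u v : M} (hu : Θ 0 u = a) (hv : Θ 0 v = b) {c : ℝ}
    (hc : HasDerivAt (fun t => Θ t u v) c 0) :
    HasDerivAt (fun t => -b ((Θ t).inverse a)) (-c) 0 := by
  have hz : ContDiffAt ℝ ∞ (fun t => (Θ t).inverse a) 0 :=
    (ContDiffAt.comp 0 hi.self_of_nhds.contDiffAt_map_inverse hΘ).clm_apply contDiffAt_const
  have hz' := (hz.differentiableAt (by simp)).hasFDerivAt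
  have hΘ' := (hΘ.differentiableAt (by simp)).hasFDerivAt
  have h0 : (Θ 0).inverse a = u := by rw [← hu]; exact hi.self_of_nhds.inverse_apply_self u
  have h1 := (hΘ'.clm_apply hz').clm_apply (hasFDerivAt_const v (0 : ℝ))
  -- This function is constantly `a v`. Its derivative by the product rule is $c+\Theta_0(z',v)$
  -- with $z'$ the derivative of $\Theta_t^{-1}a$, and skewness turns the second term into $-b(z')$.
  have h2 : HasFDerivAt (fun t => Θ t ((Θ t).inverse a) v) (0 : ℝ →L[ℝ] ℝ) 0 := by
    refine (hasFDerivAt_const (a v) (0 : ℝ)).congr_of_eventuallyEq ?_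
    filter_upwards [hi] with t ht
    rw [ht.self_apply_inverse]
  have h3 := DFunLike.congr_fun (h1.unique h2) 1
  have h4 := DFunLike.congr_fun (((hΘ'.clm_apply (hasFDerivAt_const u (0 : ℝ))).clm_apply
    (hasFDerivAt_const v (0 : ℝ))).unique hc.hasFDerivAt) 1
  simp only [add_apply, ContinuousLinearMap.comp_apply, ContinuousLinearMap.flip_apply, zero_apply,
    map_zero, zero_add, h0, ContinuousLinearMap.toSpanSingleton_apply, one_smul] at h3 h4
  have h5 : b (fderiv ℝ (fun t => (Θ t).inverse a) 0 1) = c := by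
    rw [← hv, hskew]
    linarith
  have h6 := (b.hasFDerivAt.comp_hasDerivAt (0 : ℝ) hz'.hasDerivAt).neg
  rw [h5] at h6
  exact h6

/-! ### The equation for coisotropic sections and its linearization -/

section Equation

variable {B : Type*} [NormedAddCommGroup B] [NormedSpace ℝ B] [FiniteDimensional ℝ B]
  {C : Type*} [TopologicalSpace C] [ChartedSpace B C] [IsManifold 𝓘(ℝ, B) ∞ C]
  {F : Type*} [NormedAddCommGroup F] [NormedSpace ℝ F] [FiniteDimensional ℝ F]
  {E : C → Type*} [TopologicalSpace (TotalSpace F E)] [∀ x, AddCommGroup (E x)]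
  [∀ x, Module ℝ (E x)] [∀ x, TopologicalSpace (E x)]
  [FiberBundle F E] [VectorBundle ℝ F E] [ContMDiffVectorBundle ∞ F E 𝓘(ℝ, B)]

local notation "𝓘B" => modelWithCornersSelf ℝ B
local notation "𝓙" => ModelWithCorners.prod (modelWithCornersSelf ℝ B) (modelWithCornersSelf ℝ F)
local notation "𝟎" => graphMap (0 : Gam B F E)

variable {x₀ : C} {y : B} {w : F} {U : Set (TotalSpace F E)} {Ω : BilinField B F E}

theorem shiftedForm_apply (s : Gam B F E) (y : B) (a b : B × F) :
    shiftedForm x₀ Ω s y a b = coordBilin 𝓙 (𝟎 x₀) Ω (y, sectCoord F x₀ s y)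
      (shear (fderiv ℝ (sectCoord F x₀ s) y) a) (shear (fderiv ℝ (sectCoord F x₀ s) y) b) := rfl

theorem eq_comp_snd {c : (B × F) →L[ℝ] ℝ} (h : ∀ v, c (v, 0) = 0) :
    c = (c.comp (ContinuousLinearMap.inr ℝ B F)).comp (ContinuousLinearMap.snd ℝ B F) := by
  ext z
  · simp only [ContinuousLinearMap.comp_apply, ContinuousLinearMap.inl_apply, h,
      ContinuousLinearMap.coe_snd', map_zero]
  · rfl

/-- At a point, the coisotropy condition for the graph of `s` is the equation `μ(s) = 0`. -/
theorem mu_eq_zero_iff_chart (hΩ : IsSymplecticOn 𝓙 U Ω) (s : Gam B F E)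
    (hy : y ∈ baseDom B F E x₀) (hs : graphMap s ((extChartAt 𝓘B x₀).symm y) ∈ U) :
    (∀ a b, IsConormal B F E ((extChartAt 𝓘B x₀).symm y) a → IsConormal B F E _ b →
      mu Ω s ((extChartAt 𝓘B x₀).symm y) a b = 0) ↔
    ∀ z : B × F, (∀ v, coordBilin 𝓙 (𝟎 x₀) Ω (y, sectCoord F x₀ s y) z
      (v, fderiv ℝ (sectCoord F x₀ s) y v) = 0) → z.2 = fderiv ℝ (sectCoord F x₀ s) y z.1 := by
  have hi := shiftedForm_isInvertible hΩ s hy hs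
  have hshear : ∀ v, shear (fderiv ℝ (sectCoord F x₀ s) y) (v, 0)
      = (v, fderiv ℝ (sectCoord F x₀ s) y v) := fun v => by simp [shear_apply]
  constructor
  · intro h z hz
    obtain ⟨u, rfl⟩ := shear_surjective (fderiv ℝ (sectCoord F x₀ s) y) z
    have h1 := eq_comp_snd (c := shiftedForm x₀ Ω s y u) fun v => by
      rw [shiftedForm_apply, hshear]
      exact hz v
    -- The covector dual to `u` is conormal, and `mu` pairs it with an arbitrary conormal `β` to `-β
    -- u.2`.
    have h2 : u.2 = 0 := by
      refine SeparatingDual.eq_zero_of_forall_dual_eq_zero (R := ℝ) fun β => ?_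
      obtain ⟨a, ha⟩ := exists_conormal (x₀ := x₀) hy
        ((shiftedForm x₀ Ω s y u).comp (ContinuousLinearMap.inr ℝ B F))
      obtain ⟨b, hb⟩ := exists_conormal (x₀ := x₀) hy β
      have h3 := h a b ((isConormal_iff_chart hy a).2 ⟨_, ha⟩) ((isConormal_iff_chart hy b).2 ⟨_, hb⟩)
      rw [mu_chart hΩ s hy hs, ha, hb, ← h1, hi.inverse_apply_self, neg_eq_zero] at h3
      exact h3
    rw [shear_apply, h2, zero_add]
  · intro h a b ha hb
    obtain ⟨β, hβ⟩ := (isConormal_iff_chart hy a).1 ha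
    obtain ⟨β', hβ'⟩ := (isConormal_iff_chart hy b).1 hb
    rw [mu_chart hΩ s hy hs, hβ, hβ']
    set u := (shiftedForm x₀ Ω s y).inverse (β.comp (ContinuousLinearMap.snd ℝ B F)) with hu
    have h1 : shiftedForm x₀ Ω s y u = β.comp (ContinuousLinearMap.snd ℝ B F) :=
      hi.self_apply_inverse _
    have h2 := h (shear (fderiv ℝ (sectCoord F x₀ s) y) u) fun v => by
      rw [← hshear, ← shiftedForm_apply, h1]
      simp
    rw [shear_apply, add_eq_right] at h2
    rw [ContinuousLinearMap.comp_apply, ContinuousLinearMap.coe_snd', h2, map_zero, neg_zero]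

theorem defU_eq (hΩ : IsSymplecticOn 𝓙 U Ω) : DefU U Ω = {s | graph s ⊆ U ∧ MuEqZero Ω s} := by
  ext s
  refine and_congr_right fun hs => ?_
  have h := fun (x₀ : C) (y : B) (hy : y ∈ baseDom B F E x₀) => (coiso_at_iff (Ω := Ω) s hy).trans
    (mu_eq_zero_iff_chart hΩ s hy (hs ⟨_, rfl⟩)).symm
  constructor
  · exact fun h1 => forall_of_chart (B := B) (F := F) (E := E)
      (P := fun x => ∀ a b, IsConormal B F E x a → IsConormal B F E x b → mu Ω s x a b = 0)
      fun x₀ y hy => (h x₀ y hy).1 (h1 _)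
  · exact fun h1 => forall_of_chart (B := B) (F := F) (E := E)
      (P := fun x => ∀ v : TT B (graphMap s x), (∀ w : TangentSpace 𝓘B x,
        Ω (graphMap s x) v (mfderiv 𝓘B 𝓙 (graphMap s) x w) = 0) →
          ∃ u : TangentSpace 𝓘B x, mfderiv 𝓘B 𝓙 (graphMap s) x u = v)
      fun x₀ y hy => (h x₀ y hy).2 (h1 _)

theorem sectCoord_smul (t : ℝ) (σ : Gam B F E) (hy : y ∈ baseDom B F E x₀) :
    sectCoord F x₀ ((t • σ : Gam B F E) : ∀ x, E x) y = t • sectCoord F x₀ σ y := by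
  rw [sectCoord_eq _ hy, sectCoord_eq _ hy, ← map_smul]
  rfl

theorem fderiv_sectCoord_smul (t : ℝ) (σ : Gam B F E) (hy : y ∈ baseDom B F E x₀) :
    fderiv ℝ (sectCoord F x₀ ((t • σ : Gam B F E) : ∀ x, E x)) y
      = t • fderiv ℝ (sectCoord F x₀ σ) y := by
  have h : sectCoord F x₀ ((t • σ : Gam B F E) : ∀ x, E x) =ᶠ[𝓝 y]
      fun z => t • sectCoord F x₀ σ z := by
    filter_upwards [isOpen_baseDom.mem_nhds hy] with z hz using sectCoord_smul t σ hz
  rw [h.fderiv_eq, fderiv_fun_const_smul ((contDiffAt_sectCoord σ hy).differentiableAt (by simp))]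

theorem shiftedForm_smul (t : ℝ) (σ : Gam B F E) (hy : y ∈ baseDom B F E x₀) :
    shiftedForm x₀ Ω (t • σ) y = pullbackForm (coordBilin 𝓙 (𝟎 x₀) Ω (y, t • sectCoord F x₀ σ y))
      (shear (t • fderiv ℝ (sectCoord F x₀ σ) y)) := by
  rw [shiftedForm, sectCoord_smul t σ hy, fderiv_sectCoord_smul t σ hy]

theorem shiftedForm_zero_smul (σ : Gam B F E) (hy : y ∈ baseDom B F E x₀) :
    shiftedForm x₀ Ω ((0 : ℝ) • σ) y = coordBilin 𝓙 (𝟎 x₀) Ω (y, 0) := by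
  rw [shiftedForm_smul 0 σ hy, zero_smul, zero_smul]
  refine ContinuousLinearMap.ext fun a => ContinuousLinearMap.ext fun b => ?_
  rw [pullbackForm_apply, shear_apply, shear_apply]
  simp

theorem contDiffAt_shiftedForm_smul (hΩ : IsSymplecticOn 𝓙 U Ω)
    (hC : (0 : Gam B F E) ∈ DefU U Ω) (σ : Gam B F E) (hy : y ∈ baseDom B F E x₀) :
    ContDiffAt ℝ ∞ (fun t : ℝ => shiftedForm x₀ Ω (t • σ) y) 0 := by
  simp only [shiftedForm_smul _ σ hy]
  have h1 : ContDiffAt ℝ ∞ (fun t : ℝ => (y, t • sectCoord F x₀ σ y)) 0 :=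
    contDiffAt_const.prodMk (contDiffAt_id.smul contDiffAt_const)
  have h2 : ContDiffAt ℝ ∞ (coordBilin 𝓙 (𝟎 x₀) Ω) (y, (0 : ℝ) • sectCoord F x₀ σ y) := by
    rw [zero_smul]
    exact hΩ.contDiffAt_coordBilin (mem_total_target hy) (chart_zero_mem hC hy)
  exact contDiffAt_pullbackForm (contDiffAt_comp_form h2 h1)
    ((contDiff_shear (B := B) (F := F)).contDiffAt.comp 0 (contDiffAt_id.smul contDiffAt_const))

/-- For small $t$ the value of $t\sigma$ at this point stays in $U$, so `mu_chart` applies. The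
derivative of the inverse on conormal covectors is minus the derivative of the form on the dual
vectors, which lie in $K$, and Cartan's formula evaluates the latter as $d\alpha$. -/
theorem hasDerivAt_mu (hΩ : IsSymplecticOn 𝓙 U Ω) (hC : (0 : Gam B F E) ∈ DefU U Ω)
    (σ : Gam B F E) (hy : y ∈ baseDom B F E x₀)
    {a b : TT B (𝟎 ((extChartAt 𝓘B x₀).symm y)) →L[ℝ] ℝ} {β β' : F →L[ℝ] ℝ}
    (ha : coordCovec x₀ y a = β.comp (ContinuousLinearMap.snd ℝ B F))
    (hb : coordCovec x₀ y b = β'.comp (ContinuousLinearMap.snd ℝ B F)) :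
    HasDerivAt (fun t : ℝ => mu Ω (t • σ) ((extChartAt 𝓘B x₀).symm y) a b)
      (-(fderiv ℝ (coordForm 𝓘B x₀ (flatForm Ω σ)) y (kernelVec x₀ Ω β y) (kernelVec x₀ Ω β' y)
        - fderiv ℝ (coordForm 𝓘B x₀ (flatForm Ω σ)) y (kernelVec x₀ Ω β' y) (kernelVec x₀ Ω β y)))
      0 := by
  have ht := mem_total_target (w := (0 : F)) hy
  have h0 := chart_zero_mem hC hy
  have hU : ∀ᶠ t : ℝ in 𝓝 0, graphMap (t • σ) ((extChartAt 𝓘B x₀).symm y) ∈ U := by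
    have hc : Filter.Tendsto (fun t : ℝ => ((y, t • sectCoord F x₀ σ y) : B × F)) (𝓝 0)
        (𝓝 (y, 0)) := by
      have h1 : ContinuousAt (fun t : ℝ => ((y, t • sectCoord F x₀ σ y) : B × F)) 0 := by fun_prop
      simpa [ContinuousAt] using h1
    filter_upwards [hc.eventually ((isOpen_target_inter_preimage hΩ.isOpen (𝟎 x₀)).mem_nhds
      ⟨ht, h0⟩)] with t h
    have h2 := chart_symm_sectCoord ((t • σ : Gam B F E) : ∀ x, E x) hy
    rw [sectCoord_smul t σ hy] at h2
    have h3 : (extChartAt 𝓙 (𝟎 x₀)).symm (y, t • sectCoord F x₀ σ y) ∈ U := h.2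
    rw [h2] at h3
    exact h3
  have hz := shiftedForm_zero_smul (Ω := Ω) σ hy
  have hk : ∀ β : F →L[ℝ] ℝ, shiftedForm x₀ Ω ((0 : ℝ) • σ) y (kernelVec x₀ Ω β y, 0)
      = β.comp (ContinuousLinearMap.snd ℝ B F) := fun β => by
    rw [hz]
    exact ContinuousLinearMap.ext fun z => kernelVec_spec hΩ hC hy β z
  have hd := hasDerivAt_pullback_smul isOpen_baseDom hy
    (fun z hz => (contDiffAt_sectCoord σ hz).contDiffWithinAt)
    (hΩ.contDiffAt_coordBilin ht h0) (hΩ.coordBilin_skew h0) (hΩ.cyclic ht h0)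
    (α := coordForm 𝓘B x₀ (flatForm Ω σ)) (fun z hz v => coordForm_flatForm σ hz v)
    (kernelVec x₀ Ω β y) (kernelVec x₀ Ω β' y)
  simp only [← shiftedForm_smul _ σ hy] at hd
  refine (hasDerivAt_inverse_form (contDiffAt_shiftedForm_smul hΩ hC σ hy)
    (hU.mono fun t ht => shiftedForm_isInvertible hΩ _ hy ht) ?_ (hk β) (hk β') hd).congr_of_eventuallyEq ?_
  · rw [hz]
    exact hΩ.coordBilin_skew h0
  · filter_upwards [hU] with t ht
    rw [mu_chart hΩ _ hy ht, ha, hb]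

/-- The derivative of $\mu(t\sigma)$ on two conormal covectors is $-d\alpha$ on their duals, and
these duals run through all of $K$. -/
theorem linearizedSolutions_eq (hΩ : IsSymplecticOn 𝓙 U Ω) (hC : (0 : Gam B F E) ∈ DefU U Ω) :
    linearizedSolutions Ω = {σ | flat Ω σ ∈ closedFoliated (kernelDist Ω)} := by
  ext σ
  rw [mem_ofPred_eq, flat_mem_closedFoliated_iff hΩ hC]
  constructor
  · intro h x₀ y hy v w hv hw
    obtain ⟨a, ha⟩ := exists_conormal (x₀ := x₀) hy
      ((coordBilin 𝓙 (𝟎 x₀) Ω (y, 0) (v, 0)).comp (ContinuousLinearMap.inr ℝ B F))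
    obtain ⟨b, hb⟩ := exists_conormal (x₀ := x₀) hy
      ((coordBilin 𝓙 (𝟎 x₀) Ω (y, 0) (w, 0)).comp (ContinuousLinearMap.inr ℝ B F))
    have h1 := (h _ a b ((isConormal_iff_chart hy a).2 ⟨_, ha⟩)
      ((isConormal_iff_chart hy b).2 ⟨_, hb⟩)).unique (hasDerivAt_mu hΩ hC σ hy ha hb)
    rw [← eq_kernelVec hΩ hC hy hv, ← eq_kernelVec hΩ hC hy hw] at h1
    linarith
  · intro h
    refine forall_of_chart (B := B) (F := F) (E := E)
      (P := fun x => ∀ a b, IsConormal B F E x a → IsConormal B F E x b →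
        HasDerivAt (fun t : ℝ => mu Ω (t • σ) x a b) 0 0) fun x₀ y hy a b ha hb => ?_
    obtain ⟨β, hβ⟩ := (isConormal_iff_chart hy a).1 ha
    obtain ⟨β', hβ'⟩ := (isConormal_iff_chart hy b).1 hb
    have h1 := hasDerivAt_mu hΩ hC σ hy hβ hβ'
    have hk : ∀ β : F →L[ℝ] ℝ, ∀ u, coordBilin 𝓙 (𝟎 x₀) Ω (y, 0) (kernelVec x₀ Ω β y, 0) (u, 0)
        = 0 := fun β u => by
      rw [kernelVec_spec hΩ hC hy]
      exact map_zero β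
    rw [h x₀ y hy _ _ (hk β) (hk β'), sub_self, neg_zero] at h1
    exact h1

end Equation

/-! ### Smoothness, pullbacks and duals of one-forms -/

section OneForms

variable {B H : Type*} [NormedAddCommGroup B] [NormedSpace ℝ B] [FiniteDimensional ℝ B]
  [TopologicalSpace H] {I : ModelWithCorners ℝ B H} [I.Boundaryless]
  {N : Type*} [TopologicalSpace N] [ChartedSpace H N] [IsManifold I ∞ N]
  {B' H' : Type*} [NormedAddCommGroup B'] [NormedSpace ℝ B'] [FiniteDimensional ℝ B']
  [TopologicalSpace H'] {I' : ModelWithCorners ℝ B' H'} [I'.Boundaryless]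
  {N' : Type*} [TopologicalSpace N'] [ChartedSpace H' N'] [IsManifold I' ∞ N']
  {x₀ : N} {y₀ : N'} {q : B}

/-- A one-form is smooth if its coordinates are. -/
theorem contMDiffAt_oneForm_of_coord {α : ∀ p : N, TangentSpace I p →L[ℝ] ℝ}
    (h : ContDiffAt ℝ ∞ (coordForm I x₀ α) (extChartAt I x₀ x₀)) :
    ContMDiffAt I (I.prod 𝓘(ℝ, B →L[ℝ] ℝ)) ∞ (fun p => TotalSpace.mk' (B →L[ℝ] ℝ) p (α p)) x₀ := by
  refine (contMDiffAt_hom_bundle (E₁ := fun x : N => TangentSpace I x) (E₂ := Bundle.Trivial N ℝ)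
    (fun p => TotalSpace.mk' (B →L[ℝ] ℝ) p (α p))).2 ⟨contMDiffAt_id, ?_⟩
  have h1 : ContMDiffAt I 𝓘(ℝ, B →L[ℝ] ℝ) ∞ (fun y => coordForm I x₀ α (extChartAt I x₀ y)) x₀ :=
    h.contMDiffAt.comp x₀ (contMDiffAt_chart (mem_extChartAt_source x₀))
  refine h1.congr_of_eventuallyEq ?_
  filter_upwards [(isOpen_extChartAt_source (I := I) x₀).mem_nhds (mem_extChartAt_source x₀)]
    with y hy
  have hy' : y ∈ (chartAt H x₀).source := by rwa [extChartAt_source] at hy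
  have hl := (extChartAt I x₀).left_inv hy
  refine ContinuousLinearMap.ext fun v => ?_
  rw [ContinuousLinearMap.inCoordinates_eq (by simpa using hy') (by simp),
    Trivialization.symm_continuousLinearEquivAt_eq']
  change α y ((trivializationAt B (TangentSpace I) x₀).symmL ℝ y v) = _
  rw [TangentBundle.symmL_trivializationAt hy', I.range_eq_univ, mfderivWithin_univ]
  have key : ∀ z, z = y → (α y (mfderiv 𝓘(ℝ, B) I (extChartAt I x₀).symm (extChartAt I x₀ y) v : B))
    = α z (mfderiv 𝓘(ℝ, B) I (extChartAt I x₀).symm (extChartAt I x₀ y) v : B) := by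
    rintro _ rfl; rfl
  exact key _ hl

theorem contDiffAt_coordForm_of_smooth {W : Set N} (hW : IsOpen W)
    {α : ∀ p : N, TangentSpace I p →L[ℝ] ℝ} (hα : SmoothOneFormOn I W α)
    (hq : q ∈ (extChartAt I x₀).target) (hqW : (extChartAt I x₀).symm q ∈ W) :
    ContDiffAt ℝ ∞ (coordForm I x₀ α) q := by
  refine contDiffAt_clm_of_apply fun v => ?_
  have hs := (extChartAt I x₀).map_target hq
  have h2 : ContMDiffOn I (I.prod 𝓘(ℝ, ℝ)) ∞
      (fun m => TotalSpace.mk' ℝ (E := Bundle.Trivial N ℝ) m (α m (frame I x₀ v m)))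
      (W ∩ (extChartAt I x₀).source) :=
    ContMDiffOn.clm_bundle_apply (E₁ := fun x : N => TangentSpace I x) (E₂ := Bundle.Trivial N ℝ)
      (b := fun x => x) (hα.mono inter_subset_left)
      ((smoothFieldOn_frame v).mono inter_subset_right)
  have h3 := (h2.contMDiffAt ((hW.inter (isOpen_extChartAt_source x₀)).mem_nhds ⟨hqW, hs⟩))
  have h4 := ((Bundle.contMDiffAt_totalSpace.1 h3).2.comp q (contMDiffAt_chart_symm hq)).contDiffAt
  refine h4.congr_of_eventuallyEq ?_
  filter_upwards [(isOpen_extChartAt_target x₀).mem_nhds hq] with y hy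
  rw [coordForm_apply, ← frame_chart_symm hy]
  rfl

variable (I I') in
/-- The pullback of a one-form. -/
def pullForm (g : N → N') (β : ∀ p : N', TangentSpace I' p →L[ℝ] ℝ) (p : N) :
    TangentSpace I p →L[ℝ] ℝ :=
  (β (g p)).comp (mfderiv I I' g p)

variable {g : N → N'} {β : ∀ p : N', TangentSpace I' p →L[ℝ] ℝ}

theorem coordForm_pullForm (hq : q ∈ (extChartAt I x₀).target)
    (hg : MDifferentiableAt I I' g ((extChartAt I x₀).symm q))
    (hgq : g ((extChartAt I x₀).symm q) ∈ (extChartAt I' y₀).source) :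
    coordForm I x₀ (pullForm I I' g β) q
      = (coordForm I' y₀ β (coordMap I I' x₀ y₀ g q)).comp (fderiv ℝ (coordMap I I' x₀ y₀ g) q) := by
  refine ContinuousLinearMap.ext fun v => ?_
  have h := mfderiv_chartD hq hg hgq v
  have key : ∀ z, z = g ((extChartAt I x₀).symm q) →
      (β z (chartD I' y₀ (coordMap I I' x₀ y₀ g q) (fderiv ℝ (coordMap I I' x₀ y₀ g) q v) : B') : ℝ)
      = β (g ((extChartAt I x₀).symm q))
        (chartD I' y₀ (coordMap I I' x₀ y₀ g q) (fderiv ℝ (coordMap I I' x₀ y₀ g) q v) : B') := by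
    rintro _ rfl; rfl
  exact (congrArg (β (g ((extChartAt I x₀).symm q)) : B' →L[ℝ] ℝ) h).trans
    (key _ ((extChartAt I' y₀).left_inv hgq)).symm

theorem coordForm_pullForm_eventuallyEq {W : Set N} (hW : IsOpen W) (hg : ContMDiffOn I I' ∞ g W)
    (hq : q ∈ (extChartAt I x₀).target) (hqW : (extChartAt I x₀).symm q ∈ W)
    (hgq : g ((extChartAt I x₀).symm q) ∈ (extChartAt I' y₀).source) :
    coordForm I x₀ (pullForm I I' g β) =ᶠ[𝓝 q] fun z =>
      (coordForm I' y₀ β (coordMap I I' x₀ y₀ g z)).comp (fderiv ℝ (coordMap I I' x₀ y₀ g) z) := by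
  have hc : ContinuousAt (fun z => g ((extChartAt I x₀).symm z)) q :=
    ((hg.contMDiffAt (hW.mem_nhds hqW)).comp q (contMDiffAt_chart_symm hq)).continuousAt
  filter_upwards [(isOpen_target_inter_preimage hW x₀).mem_nhds ⟨hq, hqW⟩,
    hc.preimage_mem_nhds ((isOpen_extChartAt_source (I := I') y₀).mem_nhds hgq)] with z hz hz'
  exact coordForm_pullForm hz.1 ((hg.contMDiffAt (hW.mem_nhds hz.2)).mdifferentiableAt (by simp)) hz'

theorem contDiffAt_coordForm_pullForm {W : Set N} (hW : IsOpen W) (hg : ContMDiffOn I I' ∞ g W)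
    (hq : q ∈ (extChartAt I x₀).target) (hqW : (extChartAt I x₀).symm q ∈ W)
    (hgq : g ((extChartAt I x₀).symm q) ∈ (extChartAt I' y₀).source)
    (hβ : ContDiffAt ℝ ∞ (coordForm I' y₀ β) (coordMap I I' x₀ y₀ g q)) :
    ContDiffAt ℝ ∞ (coordForm I x₀ (pullForm I I' g β)) q :=
  (contDiffAt_pullback_form hβ (contDiffAt_coordMap hq (hg.contMDiffAt (hW.mem_nhds hqW))
    hgq)).congr_of_eventuallyEq (coordForm_pullForm_eventuallyEq hW hg hq hqW hgq)

/-- Pullbacks of closed one-forms are closed. -/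
theorem oneFormClosedOn_pullForm {W : Set N} (hW : IsOpen W) {W' : Set N'} (hW' : IsOpen W')
    (hg : ContMDiffOn I I' ∞ g W) (hgW : MapsTo g W W')
    (hβs : ∀ y₀ ∈ W', ContDiffAt ℝ ∞ (coordForm I' y₀ β) (extChartAt I' y₀ y₀))
    (hβ : OneFormClosedOn I' W' β) : OneFormClosedOn I W (pullForm I I' g β) := by
  refine oneFormClosedOn_of_chart fun x₀ hx₀ => ?_
  have hq := mem_extChartAt_target (I := I) x₀
  have hr := extChartAt_to_inv (I := I) x₀
  have hqW : (extChartAt I x₀).symm (extChartAt I x₀ x₀) ∈ W := by rwa [hr]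
  have hgq : g ((extChartAt I x₀).symm (extChartAt I x₀ x₀)) ∈ (extChartAt I' (g x₀)).source := by
    rw [hr]; exact mem_extChartAt_source _
  have hm : coordMap I I' x₀ (g x₀) g (extChartAt I x₀ x₀) = extChartAt I' (g x₀) (g x₀) := by
    rw [coordMap, hr]
  have hs : ContDiffAt ℝ ∞ (coordForm I' (g x₀) β)
      (coordMap I I' x₀ (g x₀) g (extChartAt I x₀ x₀)) := by
    rw [hm]; exact hβs _ (hgW hx₀)
  refine ⟨(contDiffAt_coordForm_pullForm hW hg hq hqW hgq hs).differentiableAt (by simp),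
    fun v w => ?_⟩
  rw [(coordForm_pullForm_eventuallyEq hW hg hq hqW hgq).fderiv_eq]
  refine fderiv_pullback_form_symm hs (contDiffAt_coordMap hq (hg.contMDiffAt (hW.mem_nhds hqW))
    hgq) (fun a b => ?_) v w
  rw [hm]
  refine hβ.symm_fderiv hW' (mem_extChartAt_target _) ?_ ((hβs _ (hgW hx₀)).differentiableAt
    (by simp)) a b
  rw [extChartAt_to_inv]
  exact hgW hx₀

/-- The differential of a function, as a one-form. -/
theorem contDiffAt_coordForm_mfderiv {W : Set N} (hW : IsOpen W) {f : N → ℝ}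
    (hf : ContMDiffOn I 𝓘(ℝ, ℝ) ∞ f W)
    (hq : q ∈ (extChartAt I x₀).target) (hqW : (extChartAt I x₀).symm q ∈ W) :
    ContDiffAt ℝ ∞ (coordForm I x₀ fun p => (mfderiv I 𝓘(ℝ, ℝ) f p : TangentSpace I p →L[ℝ] ℝ))
      q := by
  have h1 : ContDiffAt ℝ ∞ (fun y => f ((extChartAt I x₀).symm y)) q :=
    ((hf.contMDiffAt (hW.mem_nhds hqW)).comp q (contMDiffAt_chart_symm hq)).contDiffAt
  refine (h1.fderiv_right (m := ∞) (by simp)).congr_of_eventuallyEq ?_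
  filter_upwards [(isOpen_target_inter_preimage hW x₀).mem_nhds ⟨hq, hqW⟩] with y hy
  refine ContinuousLinearMap.ext fun v => ?_
  exact dirDeriv_chartD hy.1 ((hf.contMDiffAt (hW.mem_nhds hy.2)).mdifferentiableAt (by simp)) v

variable {Ω : ∀ p : N, TangentSpace I p →L[ℝ] TangentSpace I p →L[ℝ] ℝ} {U : Set N}

theorem coordForm_contraction (hq : q ∈ (extChartAt I x₀).target) (X : ∀ p : N, TangentSpace I p) :
    coordForm I x₀ (fun p => Ω p (X p)) q = coordBilin I x₀ Ω q (coordField I x₀ X q) := by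
  refine ContinuousLinearMap.ext fun v => ?_
  rw [coordForm_apply, coordBilin_apply, chartD_coordField hq]

theorem IsSymplecticOn.contDiffAt_contraction (hΩ : IsSymplecticOn I U Ω)
    {X : ∀ p : N, TangentSpace I p} (hq : q ∈ (extChartAt I x₀).target)
    (hqU : (extChartAt I x₀).symm q ∈ U)
    (hX : ContMDiffAt I I.tangent ∞ (fun p => (⟨p, X p⟩ : TangentBundle I N))
      ((extChartAt I x₀).symm q)) :
    ContDiffAt ℝ ∞ (coordForm I x₀ fun p => Ω p (X p)) q := by
  refine ((hΩ.contDiffAt_coordBilin hq hqU).clm_apply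
    (contDiffAt_coordField hq hX)).congr_of_eventuallyEq ?_
  filter_upwards [(isOpen_extChartAt_target x₀).mem_nhds hq] with y hy
  exact coordForm_contraction hy X

theorem IsSymplecticOn.smoothFieldOn_inverse (hΩ : IsSymplecticOn I U Ω)
    {α : ∀ p : N, TangentSpace I p →L[ℝ] ℝ}
    (hα : ∀ p ∈ U, ContDiffAt ℝ ∞ (coordForm I p α) (extChartAt I p p)) :
    SmoothFieldOn I U fun p => (Ω p).inverse (α p) := by
  intro p hp
  have h := hΩ.contMDiffAt_inverse (mem_extChartAt_target p) (by rwa [extChartAt_to_inv]) (hα p hp)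
  rw [extChartAt_to_inv] at h
  exact h.contMDiffWithinAt

end OneForms

/-! ### Normal parts of Hamiltonian and symplectic vector fields -/

section Directions

variable {B : Type*} [NormedAddCommGroup B] [NormedSpace ℝ B] [FiniteDimensional ℝ B]
  {C : Type*} [TopologicalSpace C] [ChartedSpace B C] [IsManifold 𝓘(ℝ, B) ∞ C]
  {F : Type*} [NormedAddCommGroup F] [NormedSpace ℝ F] [FiniteDimensional ℝ F]
  {E : C → Type*} [TopologicalSpace (TotalSpace F E)] [∀ x, AddCommGroup (E x)]
  [∀ x, Module ℝ (E x)] [∀ x, TopologicalSpace (E x)]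
  [FiberBundle F E] [VectorBundle ℝ F E] [ContMDiffVectorBundle ∞ F E 𝓘(ℝ, B)]

local notation "𝓘B" => modelWithCornersSelf ℝ B
local notation "𝓙" => ModelWithCorners.prod (modelWithCornersSelf ℝ B) (modelWithCornersSelf ℝ F)
local notation "𝟎" => graphMap (0 : Gam B F E)

variable {x₀ : C} {y : B} {U : Set (TotalSpace F E)} {Ω : BilinField B F E}

theorem omega_zeroDeriv_kernel (hΩ : IsSymplecticOn 𝓙 U Ω) (hC : (0 : Gam B F E) ∈ DefU U Ω) {x : C}
    (k : kernelDist Ω x) (u : TangentSpace 𝓘B x) :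
    Ω (𝟎 x) (zeroDeriv B F E x u) (zeroDeriv B F E x k) = 0 := by
  rw [hΩ.skew (graphMap_zero_mem hC x), k.2 u, neg_zero]

theorem exists_decomp (x : C) : ∀ t : TT B (𝟎 x), ∃ (e : E x) (u : TangentSpace 𝓘B x),
    t = vert B F E x e + zeroDeriv B F E x u := by
  refine forall_of_chart (B := B) (F := F) (E := E) (P := fun x => ∀ t : TT B (𝟎 x),
    ∃ (e : E x) (u : TangentSpace 𝓘B x), t = vert B F E x e + zeroDeriv B F E x u)
    (fun x₀ y hy t => ?_) x
  obtain ⟨a, ha⟩ := chartD_surjective (I := 𝓙) (mem_total_target (w := (0 : F)) hy) (t : B × F)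
  refine ⟨(trivializationAt F E x₀).symmL ℝ _ a.2, chartD 𝓘B x₀ y a.1, ?_⟩
  have h1 := vert_chart hy ((trivializationAt F E x₀).symmL ℝ ((extChartAt 𝓘B x₀).symm y) a.2)
  rw [Trivialization.continuousLinearMapAt_symmL _ hy.2] at h1
  have h2 := zeroDeriv_chartD (F := F) (E := E) hy a.1
  have h3 : chartD 𝓙 (𝟎 x₀) (y, (0 : F)) a = chartD 𝓙 (𝟎 x₀) (y, (0 : F)) (0, a.2)
      + chartD 𝓙 (𝟎 x₀) (y, (0 : F)) (a.1, 0) := by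
    rw [← map_add, Prod.mk_add_mk, zero_add, add_zero]
  have h4 : (t : B × F) = (chartD 𝓙 (𝟎 x₀) (y, (0 : F)) (0, a.2) : B × F)
      + (chartD 𝓙 (𝟎 x₀) (y, (0 : F)) (a.1, 0) : B × F) := ha.symm.trans h3
  rw [← h1, ← h2] at h4
  exact h4

/-- $TE|_C=E\oplus TC$, the summand $TC$ pairs trivially with $K$, and no nonzero vector of $E$
does. So the normal component is determined by the pairing with $K$. -/
theorem normal_iff (hΩ : IsSymplecticOn 𝓙 U Ω) (hC : (0 : Gam B F E) ∈ DefU U Ω) {x : C}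
    (t : TT B (𝟎 x)) (e : E x) :
    (∃ u : TangentSpace 𝓘B x, t = vert B F E x e + zeroDeriv B F E x u) ↔
      ∀ k : kernelDist Ω x, Ω (𝟎 x) t (zeroDeriv B F E x k)
        = Ω (𝟎 x) (vert B F E x e) (zeroDeriv B F E x k) := by
  constructor
  · rintro ⟨u, rfl⟩ k
    rw [map_add, add_apply, omega_zeroDeriv_kernel hΩ hC, add_zero]
  · intro h
    obtain ⟨e', u, rfl⟩ := exists_decomp x t
    refine ⟨u, ?_⟩
    have : e' - e = 0 := eq_zero_of_vert_kernelDist hΩ hC x _ fun k hk => by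
      have h1 := h ⟨k, hk⟩
      rw [map_add, add_apply, omega_zeroDeriv_kernel hΩ hC, add_zero] at h1
      rw [map_sub, map_sub, sub_apply, h1, sub_self]
    rw [sub_eq_zero.1 this]

theorem isNormalPart_iff (hΩ : IsSymplecticOn 𝓙 U Ω) (hC : (0 : Gam B F E) ∈ DefU U Ω)
    {X : ∀ p : TotalSpace F E, TT B p} {σ : Gam B F E} :
    IsNormalPart X σ ↔ ∀ x (k : kernelDist Ω x),
      Ω (𝟎 x) (X (𝟎 x)) (zeroDeriv B F E x k) = flat Ω σ x k :=
  forall_congr' fun _ => normal_iff hΩ hC _ _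

theorem contMDiff_graphMap (s : Gam B F E) : ContMDiff 𝓘B 𝓙 ∞ (graphMap s) := s.contMDiff

theorem contMDiff_total_proj : ContMDiff 𝓙 𝓘B ∞ (TotalSpace.proj : TotalSpace F E → C) :=
  contMDiff_proj E

theorem mfderiv_proj_zeroDeriv (x : C) (v : TangentSpace 𝓘B x) :
    (mfderiv 𝓙 𝓘B (TotalSpace.proj : TotalSpace F E → C) (𝟎 x) (zeroDeriv B F E x v) : B) = v := by
  have h := mfderiv_comp (I := 𝓘B) (I' := 𝓙) (I'' := 𝓘B) x
    ((contMDiff_total_proj (B := B) (F := F) (E := E)).mdifferentiableAt (x := 𝟎 x) (by simp))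
    ((contMDiff_graphMap (0 : Gam B F E)).mdifferentiableAt (x := x) (by simp))
  have h2 : (TotalSpace.proj : TotalSpace F E → C) ∘ 𝟎 = id := rfl
  rw [h2, mfderiv_id] at h
  exact (DFunLike.congr_fun h v).symm

theorem OneFormClosedOn.congr {W : Set (TotalSpace F E)}
    {α β : ∀ p : TotalSpace F E, TT B p →L[ℝ] ℝ} (hα : OneFormClosedOn 𝓙 W α)
    (h : ∀ p ∈ W, α p = β p) : OneFormClosedOn 𝓙 W β := by
  intro W' hW' hs X Y hX hY p hp
  have key : ∀ (X Z : ∀ p : TotalSpace F E, TT B p), dirDeriv 𝓙 (fun q => β q (Z q)) p (X p)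
      = dirDeriv 𝓙 (fun q => α q (Z q)) p (X p) := by
    intro X Z
    have : (fun q => β q (Z q)) =ᶠ[𝓝 p] fun q => α q (Z q) := by
      filter_upwards [hW'.mem_nhds hp] with q hq
      rw [h q (hs hq)]
    unfold dirDeriv
    rw [this.mfderiv_eq]
    rfl
  rw [key, key, ← h p (hs hp)]
  exact hα W' hW' hs X Y hX hY p hp

theorem dirDeriv_comp_zero {H : TotalSpace F E → ℝ} {x : C}
    (hH : MDifferentiableAt 𝓙 𝓘(ℝ, ℝ) H (𝟎 x)) (v : TangentSpace 𝓘B x) :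
    dirDeriv 𝓘B (fun x => H (𝟎 x)) x v = dirDeriv 𝓙 H (𝟎 x) (zeroDeriv B F E x v) := by
  have h := mfderiv_comp (I := 𝓘B) (I' := 𝓙) (I'' := 𝓘(ℝ, ℝ)) x hH
    ((contMDiff_graphMap (0 : Gam B F E)).mdifferentiableAt (x := x) (by simp))
  exact DFunLike.congr_fun h v

theorem self_apply_inverse (hΩ : IsSymplecticOn 𝓙 U Ω) {p : TotalSpace F E} (hp : p ∈ U)
    (a : TT B p →L[ℝ] ℝ) : Ω p ((Ω p).inverse a) = a :=
  (hΩ.isInvertible hp).self_apply_inverse a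

/-- A Hamiltonian restricts to a function on $C$. Conversely $f$ on $C$ extends to $f\circ\pi$,
whose Hamiltonian vector field on $U$ has the required pairing with $K$ along $C$. -/
theorem hamiltonianDirections_eq (hΩ : IsSymplecticOn 𝓙 U Ω) (hC : (0 : Gam B F E) ∈ DefU U Ω) :
    hamiltonianDirections U Ω = {σ | flat Ω σ ∈ exactFoliated (kernelDist Ω)} := by
  ext σ
  constructor
  · rintro ⟨V, X, H, hV, hCV, -, -, hH, hXH, hn⟩
    rw [isNormalPart_iff hΩ hC] at hn
    have hV0 : ∀ x, 𝟎 x ∈ V := fun x => hCV ⟨x, rfl⟩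
    refine ⟨fun x => H (𝟎 x), fun x => (hH.contMDiffAt (hV.mem_nhds (hV0 x))).comp x
      (contMDiffAt_graphMap 0 x), fun x k => ?_⟩
    rw [dirDeriv_comp_zero ((hH.contMDiffAt (hV.mem_nhds (hV0 x))).mdifferentiableAt (by simp)),
      ← hXH _ (hV0 x), hn x k]
  · rintro ⟨f, hf, hfσ⟩
    have hH : ContMDiff 𝓙 𝓘(ℝ, ℝ) ∞ (fun p : TotalSpace F E => f p.proj) :=
      hf.comp (contMDiff_total_proj (B := B) (F := F) (E := E))
    let β : ∀ p : TotalSpace F E, TT B p →L[ℝ] ℝ :=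
      fun p => mfderiv 𝓙 𝓘(ℝ, ℝ) (fun p : TotalSpace F E => f p.proj) p
    refine ⟨U, fun p => (Ω p).inverse (β p),
      fun p => f p.proj, hΩ.isOpen, hC.1, subset_rfl, ?_, hH.contMDiffOn, ?_, ?_⟩
    · refine hΩ.smoothFieldOn_inverse fun p _ => ?_
      exact contDiffAt_coordForm_mfderiv isOpen_univ hH.contMDiffOn (mem_extChartAt_target p)
        (mem_univ _)
    · intro p hp w
      rw [self_apply_inverse hΩ hp]
      rfl
    · rw [isNormalPart_iff hΩ hC]
      intro x k
      rw [self_apply_inverse hΩ (graphMap_zero_mem hC x), hfσ]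
      exact (dirDeriv_comp_zero (hH.mdifferentiableAt (by simp)) _).symm

/-- The restriction to the zero section of a closed one-form near the zero section. -/
theorem exists_closedOneForm {V : Set (TotalSpace F E)} (hCV : ∀ x, 𝟎 x ∈ V)
    (hV : IsOpen V) {β : ∀ p : TotalSpace F E, TT B p →L[ℝ] ℝ}
    (hβs : ∀ p ∈ V, ContDiffAt ℝ ∞ (coordForm 𝓙 p β) (extChartAt 𝓙 p p))
    (hβ : OneFormClosedOn 𝓙 V β) :
    ∃ γ ∈ closedOneForms B C, ∀ x v, γ x v = β (𝟎 x) (zeroDeriv B F E x v) := by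
  have hg := (contMDiff_graphMap (0 : Gam B F E)).contMDiffOn (s := univ)
  have hs : ContMDiff 𝓘B ((𝓘B).prod 𝓘(ℝ, B →L[ℝ] ℝ)) ∞
      (fun x => TotalSpace.mk' (B →L[ℝ] ℝ) x (pullForm 𝓘B 𝓙 𝟎 β x)) := by
    intro x
    refine contMDiffAt_oneForm_of_coord ?_
    have hr := extChartAt_to_inv (I := 𝓘B) x
    refine contDiffAt_coordForm_pullForm isOpen_univ hg (y₀ := 𝟎 x) (mem_extChartAt_target x)
      (mem_univ _) (by rw [hr]; exact mem_extChartAt_source _) ?_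
    rw [coordMap, hr]
    exact hβs _ (hCV x)
  refine ⟨⟨fun x => pullForm 𝓘B 𝓙 𝟎 β x, hs⟩, ?_, fun x v => rfl⟩
  exact oneFormClosedOn_pullForm isOpen_univ hV hg (fun x _ => hCV x) hβs hβ

/-- The same two constructions with closed forms: restrict $\Omega(X,\cdot)$ to the zero section, or
take the $\Omega$-dual of $\pi^*\gamma$, using that the projection is a left inverse of the zero
section. -/
theorem symplecticDirections_eq (hΩ : IsSymplecticOn 𝓙 U Ω) (hC : (0 : Gam B F E) ∈ DefU U Ω) :
    symplecticDirections U Ω =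
      {σ | ∃ γ ∈ closedOneForms B C, flat Ω σ = restrictToK (kernelDist Ω) γ} := by
  ext σ
  constructor
  · rintro ⟨V, X, hV, hCV, hVU, hX, hXc, hn⟩
    rw [isNormalPart_iff hΩ hC] at hn
    obtain ⟨γ, hγ, h⟩ := exists_closedOneForm (fun x => hCV ⟨x, rfl⟩) hV
      (β := fun p => Ω p (X p)) (fun p hp => by
        have hr := extChartAt_to_inv (I := 𝓙) p
        refine hΩ.contDiffAt_contraction (mem_extChartAt_target p) (by rw [hr]; exact hVU hp) ?_
        rw [hr]
        exact hX.contMDiffAt (hV.mem_nhds hp)) hXc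
    refine ⟨γ, hγ, ?_⟩
    funext x
    ext k
    exact (hn x k).symm.trans (h x k).symm
  · rintro ⟨γ, hγ, hσ⟩
    have hp := (contMDiff_total_proj (B := B) (F := F) (E := E)).contMDiffOn (s := U)
    have hγs : ∀ x : C, ContDiffAt ℝ ∞ (coordForm 𝓘B x fun z => γ z) (extChartAt 𝓘B x x) :=
      fun x => contDiffAt_coordForm_of_smooth isOpen_univ (γ.contMDiff.contMDiffOn)
        (mem_extChartAt_target x) (mem_univ _)
    let β := pullForm 𝓙 𝓘B (TotalSpace.proj : TotalSpace F E → C) (fun z => γ z)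
    refine ⟨U, fun p => (Ω p).inverse (β p), hΩ.isOpen, hC.1, subset_rfl, ?_, ?_, ?_⟩
    · refine hΩ.smoothFieldOn_inverse fun p hpU => ?_
      have hr := extChartAt_to_inv (I := 𝓙) p
      refine contDiffAt_coordForm_pullForm hΩ.isOpen hp (y₀ := p.proj) (mem_extChartAt_target p)
        (by rwa [hr]) (by rw [hr]; exact mem_extChartAt_source _) ?_
      rw [coordMap, hr]
      exact hγs _
    · have hβ : OneFormClosedOn 𝓙 U β := oneFormClosedOn_pullForm hΩ.isOpen isOpen_univ hp
        (fun _ _ => mem_univ _) (fun x _ => hγs x) hγ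
      exact hβ.congr fun p hpU => (self_apply_inverse hΩ hpU _).symm
    · rw [isNormalPart_iff hΩ hC]
      intro x k
      rw [self_apply_inverse hΩ (graphMap_zero_mem hC x), hσ]
      exact congrArg (γ x : B →L[ℝ] ℝ) (mfderiv_proj_zeroDeriv x (k : TangentSpace 𝓘B x))

end Directions

/-! ### Exact forms are closed -/

section ExactForms

variable {B H : Type*} [NormedAddCommGroup B] [NormedSpace ℝ B] [FiniteDimensional ℝ B]
  [TopologicalSpace H] {I : ModelWithCorners ℝ B H} [I.Boundaryless]
  {N : Type*} [TopologicalSpace N] [ChartedSpace H N] [IsManifold I ∞ N]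

/-- Differentials of functions are closed. -/
theorem oneFormClosedOn_mfderiv {W : Set N} (hW : IsOpen W) {f : N → ℝ}
    (hf : ContMDiffOn I 𝓘(ℝ, ℝ) ∞ f W) :
    OneFormClosedOn I W fun p => (mfderiv I 𝓘(ℝ, ℝ) f p : TangentSpace I p →L[ℝ] ℝ) := by
  refine oneFormClosedOn_of_chart fun x₀ hx₀ => ?_
  have hq := mem_extChartAt_target (I := I) x₀
  have hqW : (extChartAt I x₀).symm (extChartAt I x₀ x₀) ∈ W := by rwa [extChartAt_to_inv]
  refine ⟨(contDiffAt_coordForm_mfderiv hW hf hq hqW).differentiableAt (by simp), fun v w => ?_⟩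
  have h1 : ContDiffAt ℝ ∞ (fun y => f ((extChartAt I x₀).symm y)) (extChartAt I x₀ x₀) :=
    ((hf.contMDiffAt (hW.mem_nhds hqW)).comp _ (contMDiffAt_chart_symm hq)).contDiffAt
  have h2 : coordForm I x₀ (fun p => (mfderiv I 𝓘(ℝ, ℝ) f p : TangentSpace I p →L[ℝ] ℝ))
      =ᶠ[𝓝 (extChartAt I x₀ x₀)] fderiv ℝ (fun y => f ((extChartAt I x₀).symm y)) := by
    filter_upwards [(isOpen_target_inter_preimage hW x₀).mem_nhds ⟨hq, hqW⟩] with y hy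
    refine ContinuousLinearMap.ext fun v => ?_
    exact dirDeriv_chartD hy.1 ((hf.contMDiffAt (hW.mem_nhds hy.2)).mdifferentiableAt (by simp)) v
  rw [h2.fderiv_eq]
  exact (h1.isSymmSndFDerivAt (by
    rw [minSmoothness_of_isRCLikeNormedField]
    exact ENat.LEInfty.out)) v w

end ExactForms

/-! ### Formal tangent spaces of the moduli spaces -/

section Quotients

variable {B : Type*} [NormedAddCommGroup B] [NormedSpace ℝ B] [FiniteDimensional ℝ B]
  {C : Type*} [TopologicalSpace C] [ChartedSpace B C] [IsManifold 𝓘(ℝ, B) ∞ C]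
  {F : Type*} [NormedAddCommGroup F] [NormedSpace ℝ F] [FiniteDimensional ℝ F]
  {E : C → Type*} [TopologicalSpace (TotalSpace F E)] [∀ x, AddCommGroup (E x)]
  [∀ x, Module ℝ (E x)] [∀ x, TopologicalSpace (E x)]
  [FiberBundle F E] [VectorBundle ℝ F E] [ContMDiffVectorBundle ∞ F E 𝓘(ℝ, B)]

local notation "𝓘B" => modelWithCornersSelf ℝ B
local notation "𝓙" => ModelWithCorners.prod (modelWithCornersSelf ℝ B) (modelWithCornersSelf ℝ F)
local notation "𝟎" => graphMap (0 : Gam B F E)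

variable {U : Set (TotalSpace F E)} {Ω : BilinField B F E}

theorem exists_closedOneForm_dirDeriv {f : C → ℝ} (hf : ContMDiff 𝓘B 𝓘(ℝ, ℝ) ∞ f) :
    ∃ γ ∈ closedOneForms B C, ∀ x v, γ x v = dirDeriv 𝓘B f x v := by
  let α : ∀ x : C, TangentSpace 𝓘B x →L[ℝ] ℝ := fun x => mfderiv 𝓘B 𝓘(ℝ, ℝ) f x
  have hs : ContMDiff 𝓘B ((𝓘B).prod 𝓘(ℝ, B →L[ℝ] ℝ)) ∞
      (fun x => TotalSpace.mk' (B →L[ℝ] ℝ) x (α x)) := fun x =>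
    contMDiffAt_oneForm_of_coord (contDiffAt_coordForm_mfderiv isOpen_univ hf.contMDiffOn
      (mem_extChartAt_target x) (mem_univ _))
  exact ⟨⟨_, hs⟩, oneFormClosedOn_mfderiv isOpen_univ hf.contMDiffOn, fun _ _ => rfl⟩

theorem exists_restrict_of_mem_exactFoliated {K : ∀ x : C, Submodule ℝ (TangentSpace 𝓘B x)}
    {α : KForm K} (h : α ∈ exactFoliated K) : ∃ γ ∈ closedOneForms B C, α = restrictToK K γ := by
  obtain ⟨f, hf, hfα⟩ := h
  obtain ⟨γ, hγ, hγf⟩ := exists_closedOneForm_dirDeriv hf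
  refine ⟨γ, hγ, ?_⟩
  funext x
  ext k
  exact (hfα x k).trans (hγf x k).symm

/-- The set of linearized solutions is already a subspace, so the span in the definition adds
nothing. The same holds for the two spaces of directions below. -/
theorem formalTangentDef_eq (hΩ : IsSymplecticOn 𝓙 U Ω) (hC : (0 : Gam B F E) ∈ DefU U Ω) :
    formalTangentDef Ω = (closedFoliated (kernelDist Ω)).comap (flat Ω) := by
  rw [formalTangentDef, linearizedSolutions_eq hΩ hC]
  exact Submodule.span_eq ((closedFoliated (kernelDist Ω)).comap (flat Ω))

theorem span_hamiltonianDirections (hΩ : IsSymplecticOn 𝓙 U Ω) (hC : (0 : Gam B F E) ∈ DefU U Ω) :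
    Submodule.span ℝ (hamiltonianDirections U Ω)
      = (exactFoliated (kernelDist Ω)).comap (flat Ω) := by
  rw [hamiltonianDirections_eq hΩ hC]
  exact Submodule.span_eq ((exactFoliated (kernelDist Ω)).comap (flat Ω))

theorem span_symplecticDirections (hΩ : IsSymplecticOn 𝓙 U Ω) (hC : (0 : Gam B F E) ∈ DefU U Ω) :
    Submodule.span ℝ (symplecticDirections U Ω)
      = ((closedOneForms B C).map (restrictToK (kernelDist Ω))).comap (flat Ω) := by
  rw [symplecticDirections_eq hΩ hC, ← Submodule.span_eq
    (((closedOneForms B C).map (restrictToK (kernelDist Ω))).comap (flat Ω))]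
  congr 1
  ext σ
  exact exists_congr fun γ => and_congr_right fun _ => eq_comm

theorem exists_quotient_equiv {Z W : Type*} [AddCommGroup Z] [Module ℝ Z] [AddCommGroup W]
    [Module ℝ W] {P : Submodule ℝ Z} (g : Z →ₗ[ℝ] W) (hg : Function.Surjective g)
    (h : ∀ z, g z = 0 ↔ z ∈ P) :
    ∃ e : (Z ⧸ P) ≃ₗ[ℝ] W, ∀ z, e (Submodule.Quotient.mk z) = g z := by
  have hP : P = LinearMap.ker g := by
    ext z
    rw [LinearMap.mem_ker, h]
  subst hP
  exact ⟨g.quotKerEquivOfSurjective hg, fun z => rfl⟩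

/-- The identification of the formal tangent space with the closed foliated one-forms. -/
def flatClosed (hΩ : IsSymplecticOn 𝓙 U Ω) (hC : (0 : Gam B F E) ∈ DefU U Ω) :
    formalTangentDef Ω →ₗ[ℝ] closedFoliated (kernelDist Ω) :=
  (flat Ω).restrict fun σ hσ => by
    rw [formalTangentDef_eq hΩ hC] at hσ
    exact hσ

theorem flatClosed_surjective (hΩ : IsSymplecticOn 𝓙 U Ω) (hC : (0 : Gam B F E) ∈ DefU U Ω) :
    Function.Surjective (flatClosed hΩ hC) := by
  rintro ⟨α, hα⟩
  have h := hα.1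
  rw [← range_flat hΩ hC] at h
  obtain ⟨σ, rfl⟩ := h
  refine ⟨⟨σ, ?_⟩, rfl⟩
  rw [formalTangentDef_eq hΩ hC]
  exact hα

theorem exists_equiv_foliatedH1 (hΩ : IsSymplecticOn 𝓙 U Ω) (hC : (0 : Gam B F E) ∈ DefU U Ω) :
    ∃ e : FormalTangentHam U Ω ≃ₗ[ℝ] FoliatedH1 (kernelDist Ω),
      ∀ (σ : formalTangentDef Ω) (h : flat Ω σ ∈ closedFoliated (kernelDist Ω)),
        e (Submodule.Quotient.mk σ) = Submodule.Quotient.mk ⟨flat Ω σ, h⟩ := by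
  obtain ⟨e, he⟩ := exists_quotient_equiv
    (P := (Submodule.span ℝ (hamiltonianDirections U Ω)).submoduleOf (formalTangentDef Ω))
    ((Submodule.mkQ _ : _ →ₗ[ℝ] FoliatedH1 (kernelDist Ω)).comp (flatClosed hΩ hC))
    ((Submodule.mkQ_surjective _).comp (flatClosed_surjective hΩ hC)) (fun σ => by
      rw [LinearMap.comp_apply, Submodule.mkQ_apply, Submodule.Quotient.mk_eq_zero,
        span_hamiltonianDirections hΩ hC]
      rfl)
  exact ⟨e, fun σ h => he σ⟩

/-- Representatives of a class differ by some $d_{\mathfrak F}f$, which is the restriction of $df$.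
The correction can be absorbed in the closed form on $C$, so the condition holds for one
representative iff for all. -/
theorem mk_mem_range_rMap_iff {K : ∀ x : C, Submodule ℝ (TangentSpace 𝓘B x)}
    (α : closedFoliated K) : (Submodule.Quotient.mk α : FoliatedH1 K) ∈ LinearMap.range (rMap K) ↔
      ∃ γ ∈ closedOneForms B C, (α : KForm K) = restrictToK K γ := by
  constructor
  · rintro ⟨γ, hγ⟩
    obtain ⟨γ, rfl⟩ := Submodule.Quotient.mk_surjective _ γ
    have h1 : (Submodule.Quotient.mk (restrictClosed K γ) : FoliatedH1 K)
      = Submodule.Quotient.mk α := hγ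
    rw [Submodule.Quotient.eq] at h1
    obtain ⟨δ, hδ, h2⟩ := exists_restrict_of_mem_exactFoliated (α := restrictToK K γ - (α : KForm K)) h1
    refine ⟨(γ : OneForm (B := B) C) - δ, sub_mem γ.2 hδ, ?_⟩
    rw [map_sub, ← h2, sub_sub_cancel]
  · rintro ⟨γ, hγ, h⟩
    refine ⟨Submodule.Quotient.mk ⟨γ, hγ⟩, ?_⟩
    show (Submodule.Quotient.mk (restrictClosed K ⟨γ, hγ⟩) : FoliatedH1 K) = _
    congr 1
    exact Subtype.ext h.symm

theorem exists_equiv_coker (hΩ : IsSymplecticOn 𝓙 U Ω) (hC : (0 : Gam B F E) ∈ DefU U Ω) :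
    ∃ e : FormalTangentSym U Ω ≃ₗ[ℝ]
        FoliatedH1 (kernelDist Ω) ⧸ LinearMap.range (rMap (kernelDist Ω)),
      ∀ (σ : formalTangentDef Ω) (h : flat Ω σ ∈ closedFoliated (kernelDist Ω)),
        e (Submodule.Quotient.mk σ) =
          Submodule.Quotient.mk
            (Submodule.Quotient.mk ⟨flat Ω σ, h⟩ : FoliatedH1 (kernelDist Ω)) := by
  obtain ⟨e, he⟩ := exists_quotient_equiv
    (P := (Submodule.span ℝ (symplecticDirections U Ω)).submoduleOf (formalTangentDef Ω))
    ((Submodule.mkQ (LinearMap.range (rMap (kernelDist Ω)))).comp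
      ((Submodule.mkQ _ : _ →ₗ[ℝ] FoliatedH1 (kernelDist Ω)).comp (flatClosed hΩ hC)))
    ((Submodule.mkQ_surjective _).comp
      ((Submodule.mkQ_surjective _).comp (flatClosed_surjective hΩ hC))) (fun σ => by
      rw [LinearMap.comp_apply, LinearMap.comp_apply, Submodule.mkQ_apply, Submodule.mkQ_apply,
        Submodule.Quotient.mk_eq_zero, mk_mem_range_rMap_iff, span_symplecticDirections hΩ hC]
      exact exists_congr fun γ => and_congr_right fun _ => eq_comm)
  exact ⟨e, fun σ h => he σ⟩

end Quotients

/-! ### Smooth families of maps in coordinates -/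

section Families

variable {B H : Type*} [NormedAddCommGroup B] [NormedSpace ℝ B] [FiniteDimensional ℝ B]
  [TopologicalSpace H] {I : ModelWithCorners ℝ B H} [I.Boundaryless]
  {N : Type*} [TopologicalSpace N] [ChartedSpace H N] [IsManifold I ∞ N]
  {x₀ y₀ : N} {J : Set ℝ} {V : Set N} {φ : ℝ → N → N} {t₀ t : ℝ}

variable (I) in
/-- The velocity of the curve `t ↦ φ_t(p)`. -/
def curveVelocity (J : Set ℝ) (φ : ℝ → N → N) (t : ℝ) (p : N) : TangentSpace I (φ t p) :=
  mfderivWithin 𝓘(ℝ, ℝ) I (fun τ => φ τ p) J t (1 : ℝ)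

variable (I x₀ y₀) in
/-- The coordinate expression of a family of maps. -/
def coordFamily (φ : ℝ → N → N) (q : ℝ × B) : B := coordMap I I x₀ y₀ (φ q.1) q.2

theorem contMDiffAt_of_family (hV : IsOpen V)
    (hφ : ContMDiffOn (𝓘(ℝ, ℝ).prod I) I ∞ (fun q : ℝ × N => φ q.1 q.2) (J ×ˢ V)) (ht : t ∈ J)
    {p : N} (hp : p ∈ V) : ContMDiffAt I I ∞ (φ t) p := by
  have h : ContMDiffOn I I ∞ (φ t) V :=
    hφ.comp (f := fun p => (t, p)) (contMDiffOn_const.prodMk contMDiffOn_id) fun p hp => ⟨ht, hp⟩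
  exact h.contMDiffAt (hV.mem_nhds hp)

theorem contMDiffWithinAt_curve
    (hφ : ContMDiffOn (𝓘(ℝ, ℝ).prod I) I ∞ (fun q : ℝ × N => φ q.1 q.2) (J ×ˢ V)) (ht : t ∈ J)
    {p : N} (hp : p ∈ V) : ContMDiffWithinAt 𝓘(ℝ, ℝ) I ∞ (fun τ => φ τ p) J t := by
  have h : ContMDiffOn 𝓘(ℝ, ℝ) I ∞ (fun τ => φ τ p) J :=
    hφ.comp (f := fun τ => (τ, p)) (contMDiffOn_id.prodMk contMDiffOn_const) fun τ hτ => ⟨hτ, hp⟩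
  exact h t ht

/-- A smooth family has a smooth coordinate expression near a given time and point. -/
theorem exists_contDiffOn_coordFamily (hV : IsOpen V)
    (hφ : ContMDiffOn (𝓘(ℝ, ℝ).prod I) I ∞ (fun q : ℝ × N => φ q.1 q.2) (J ×ˢ V)) (ht₀ : t₀ ∈ J)
    (hx₀ : x₀ ∈ V) (hy₀ : φ t₀ x₀ ∈ (extChartAt I y₀).source) :
    ∃ T : Set ℝ, IsOpen T ∧ t₀ ∈ T ∧ ∃ O : Set B, IsOpen O ∧ extChartAt I x₀ x₀ ∈ O ∧
      O ⊆ (extChartAt I x₀).target ∧ (∀ z ∈ O, (extChartAt I x₀).symm z ∈ V) ∧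
      (∀ t ∈ J ∩ T, ∀ z ∈ O, φ t ((extChartAt I x₀).symm z) ∈ (extChartAt I y₀).source) ∧
      ContDiffOn ℝ ∞ (coordFamily I x₀ y₀ φ) ((J ∩ T) ×ˢ O) := by
  set q₀ := extChartAt I x₀ x₀ with hq₀
  have hr := extChartAt_to_inv (I := I) x₀
  have hO₁ := isOpen_target_inter_preimage (I := I) hV x₀
  set O₁ := (extChartAt I x₀).target ∩ (extChartAt I x₀).symm ⁻¹' V
  have hq₁ : q₀ ∈ O₁ := ⟨mem_extChartAt_target x₀, by rwa [mem_preimage, hr]⟩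
  have hg : ContMDiffOn 𝓘(ℝ, ℝ × B) I ∞ (fun q : ℝ × B => φ q.1 ((extChartAt I x₀).symm q.2))
      (J ×ˢ O₁) := by
    refine hφ.comp (f := fun q : ℝ × B => (q.1, (extChartAt I x₀).symm q.2))
      (ContMDiffOn.prodMk contDiff_fst.contMDiff.contMDiffOn ?_) fun q hq => ⟨hq.1, hq.2.2⟩
    exact (contMDiffOn_extChartAt_symm x₀).comp (f := fun q : ℝ × B => q.2)
      contDiff_snd.contMDiff.contMDiffOn fun q hq => hq.2.1
  have hc : ContinuousWithinAt (fun q : ℝ × B => φ q.1 ((extChartAt I x₀).symm q.2))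
    (J ×ˢ O₁) (t₀, q₀) := (hg _ ⟨ht₀, hq₁⟩).continuousWithinAt
  have hn : ∀ᶠ q in 𝓝[J ×ˢ O₁] ((t₀, q₀) : ℝ × B),
      φ q.1 ((extChartAt I x₀).symm q.2) ∈ (extChartAt I y₀).source :=
    hc.eventually ((isOpen_extChartAt_source (I := I) y₀).mem_nhds (by
      show φ t₀ ((extChartAt I x₀).symm q₀) ∈ _
      rwa [hr]))
  rw [eventually_nhdsWithin_iff] at hn
  obtain ⟨A, hA, Z, hZ, hAZ⟩ := mem_nhds_prod_iff.1 hn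
  obtain ⟨T, hTA, hT, htT⟩ := mem_nhds_iff.1 hA
  obtain ⟨Z', hZ'Z, hZ', hqZ⟩ := mem_nhds_iff.1 hZ
  have hsrc : ∀ t ∈ J ∩ T, ∀ z ∈ O₁ ∩ Z',
      φ t ((extChartAt I x₀).symm z) ∈ (extChartAt I y₀).source := fun t ht z hz =>
    hAZ (⟨hTA ht.2, hZ'Z hz.2⟩ : (t, z) ∈ A ×ˢ Z) ⟨ht.1, hz.1⟩
  refine ⟨T, hT, htT, O₁ ∩ Z', hO₁.inter hZ', ⟨hq₁, hqZ⟩, fun z hz => hz.1.1, fun z hz => hz.1.2,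
    hsrc, ?_⟩
  have hcd : ContMDiffOn 𝓘(ℝ, ℝ × B) 𝓘(ℝ, B) ∞ (coordFamily I x₀ y₀ φ) ((J ∩ T) ×ˢ (O₁ ∩ Z')) := by
    intro q hq
    exact (contMDiffAt_chart (hsrc _ hq.1 _ hq.2)).comp_contMDiffWithinAt q
      ((hg _ ⟨hq.1.1, hq.2.1⟩).mono (prod_mono inter_subset_left inter_subset_left))
  exact hcd.contDiffOn

theorem fderivWithin_coordFamily_space {S : Set ℝ} {O : Set B}
    (hO : IsOpen O) (hf : ContDiffOn ℝ ∞ (coordFamily I x₀ y₀ φ) (S ×ˢ O)) (ht : t ∈ S) {z : B}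
    (hz : z ∈ O) (v : B) : fderivWithin ℝ (coordFamily I x₀ y₀ φ) (S ×ˢ O) (t, z) (0, v)
      = fderiv ℝ (coordMap I I x₀ y₀ (φ t)) z v := by
  have h1 := ((hf (t, z) ⟨ht, hz⟩).differentiableWithinAt (by simp)).hasFDerivWithinAt
  have h2 := HasFDerivWithinAt.comp_hasFDerivAt (g := coordFamily I x₀ y₀ φ)
    (f := fun z : B => (t, z)) (t := S ×ˢ O) z h1 (hasFDerivAt_prodMk_right t z) (by
      filter_upwards [hO.mem_nhds hz] with z hz using ⟨ht, hz⟩)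
  exact (DFunLike.congr_fun h2.fderiv v).symm

theorem fderivWithin_coordFamily_time {S : Set ℝ} {O : Set B} (hS : UniqueDiffOn ℝ S) (hSJ : S ⊆ J)
    (hf : ContDiffOn ℝ ∞ (coordFamily I x₀ y₀ φ) (S ×ˢ O)) (ht : t ∈ S) {z : B}
    (hz : z ∈ O)
    (hc : MDifferentiableWithinAt 𝓘(ℝ, ℝ) I (fun τ => φ τ ((extChartAt I x₀).symm z)) J t)
    (hs : φ t ((extChartAt I x₀).symm z) ∈ (extChartAt I y₀).source) :
    chartD I y₀ (coordFamily I x₀ y₀ φ (t, z))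
        (fderivWithin ℝ (coordFamily I x₀ y₀ φ) (S ×ˢ O) (t, z) (1, 0))
      = (curveVelocity I J φ t ((extChartAt I x₀).symm z) : B) := by
  set p := (extChartAt I x₀).symm z
  have h1 := ((hf (t, z) ⟨ht, hz⟩).differentiableWithinAt (by simp)).hasFDerivWithinAt
  have h2 := HasFDerivWithinAt.comp_hasDerivWithinAt (l := coordFamily I x₀ y₀ φ)
    (f := fun τ : ℝ => (τ, z)) (t := S ×ˢ O) t h1
      ((hasDerivWithinAt_id t S).prodMk (hasDerivWithinAt_const t S z)) fun τ hτ => ⟨hτ, hz⟩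
  have hcS : HasMFDerivWithinAt 𝓘(ℝ, ℝ) I (fun τ => φ τ p) S t
      (mfderivWithin 𝓘(ℝ, ℝ) I (fun τ => φ τ p) J t) := hc.hasMFDerivWithinAt.mono hSJ
  have h3 := ((contMDiffAt_chart hs).mdifferentiableAt (by simp)).hasMFDerivAt.comp_hasMFDerivWithinAt
    t hcS
  let A : B →L[ℝ] B := mfderiv I 𝓘(ℝ, B) (extChartAt I y₀) (φ t p)
  let L : ℝ →L[ℝ] B := A.comp (mfderivWithin 𝓘(ℝ, ℝ) I (fun τ => φ τ p) J t)
  have h4 : HasFDerivWithinAt (coordFamily I x₀ y₀ φ ∘ fun τ : ℝ => (τ, z)) L S t :=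
    hasMFDerivWithinAt_iff_hasFDerivWithinAt.1 h3
  have h6 : L 1 = fderivWithin ℝ (coordFamily I x₀ y₀ φ) (S ×ˢ O) (t, z) (1, 0) :=
    (hS t ht).eq_deriv _ h4.hasDerivWithinAt h2
  have h7 : (mfderiv I 𝓘(ℝ, B) (extChartAt I y₀) (φ t p) (curveVelocity I J φ t p) : B)
      = fderivWithin ℝ (coordFamily I x₀ y₀ φ) (S ×ˢ O) (t, z) (1, 0) := h6
  have h8 := chartD_mfderiv_chart ((extChartAt I y₀).map_source hs)
  rw [← h7]
  have key : ∀ z' (hz' : z' = φ t p) (w : B),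
      (chartD I y₀ (extChartAt I y₀ (φ t p)) (mfderiv I 𝓘(ℝ, B) (extChartAt I y₀) z' w : B) : B)
      = chartD I y₀ (extChartAt I y₀ (φ t p))
        (mfderiv I 𝓘(ℝ, B) (extChartAt I y₀) (φ t p) w : B) := by
    rintro _ rfl _; rfl
  exact (key _ ((extChartAt I y₀).left_inv hs) _).symm.trans (h8 _)

end Families

/-! ### Cartan's formula for families of maps on a manifold -/

section Cartan

variable {B H : Type*} [NormedAddCommGroup B] [NormedSpace ℝ B] [FiniteDimensional ℝ B]
  [TopologicalSpace H] {I : ModelWithCorners ℝ B H} [I.Boundaryless]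
  {N : Type*} [TopologicalSpace N] [ChartedSpace H N] [IsManifold I ∞ N]
  {x₀ y₀ : N} {J : Set ℝ} {U V : Set N} {φ : ℝ → N → N} {t₀ t : ℝ}
  {Ω : ∀ p : N, TangentSpace I p →L[ℝ] TangentSpace I p →L[ℝ] ℝ}

theorem form_congr (Ω : ∀ p : N, TangentSpace I p →L[ℝ] TangentSpace I p →L[ℝ] ℝ) {p p' : N}
    (h : p = p') (a b : B) :
    (Ω p : B →L[ℝ] B →L[ℝ] ℝ) a b = (Ω p' : B →L[ℝ] B →L[ℝ] ℝ) a b := by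
  subst h; rfl

variable (I) in
/-- A smooth family of maps `φ_t : V → U`, `t ∈ J`. -/
structure IsSmoothFamily (J : Set ℝ) (U V : Set N) (φ : ℝ → N → N) : Prop where
  uniqueDiffOn : UniqueDiffOn ℝ J
  subset_closure : J ⊆ closure (interior J)
  isOpen : IsOpen V
  smooth : ContMDiffOn (𝓘(ℝ, ℝ).prod I) I ∞ (fun q : ℝ × N => φ q.1 q.2) (J ×ˢ V)
  mapsTo : ∀ t ∈ J, MapsTo (φ t) V U

/-- The pullback under `φ_t` of the contraction of `Ω` with the velocity of `φ_t`. -/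
def pullVelocityForm (Ω : ∀ p : N, TangentSpace I p →L[ℝ] TangentSpace I p →L[ℝ] ℝ) (J : Set ℝ)
    (φ : ℝ → N → N) (t : ℝ) (p : N) : TangentSpace I p →L[ℝ] ℝ :=
  (Ω (φ t p) (curveVelocity I J φ t p)).comp (mfderiv I I (φ t) p)

/-- The value of `φ_t^* Ω` on two tangent vectors. -/
def pullBilin (Ω : ∀ p : N, TangentSpace I p →L[ℝ] TangentSpace I p →L[ℝ] ℝ)
    (φ : ℝ → N → N) (t : ℝ) (p : N) (v w : TangentSpace I p) : ℝ :=
  Ω (φ t p) (mfderiv I I (φ t) p v) (mfderiv I I (φ t) p w)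

/-- Charts at `x₀` and at `φ t₀ x₀` express the family on a product of a time and a space
neighbourhood, where `hasDerivWithinAt_pullback` applies. Derivatives at `t₀` do not notice that `J`
was shrunk. -/
theorem IsSmoothFamily.cartan_aux (h : IsSmoothFamily I J U V φ) (hΩ : IsSymplecticOn I U Ω)
    (ht₀ : t₀ ∈ J) (hx₀ : x₀ ∈ V) :
    ContDiffAt ℝ ∞ (coordForm I x₀ (pullVelocityForm Ω J φ t₀)) (extChartAt I x₀ x₀) ∧
    ∀ v w : B, HasDerivWithinAt (fun t => pullBilin Ω φ t
        ((extChartAt I x₀).symm (extChartAt I x₀ x₀)) (chartD I x₀ (extChartAt I x₀ x₀) v)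
        (chartD I x₀ (extChartAt I x₀ x₀) w))
      (fderiv ℝ (coordForm I x₀ (pullVelocityForm Ω J φ t₀)) (extChartAt I x₀ x₀) v w
        - fderiv ℝ (coordForm I x₀ (pullVelocityForm Ω J φ t₀)) (extChartAt I x₀ x₀) w v) J t₀ := by
  set y₀ := φ t₀ x₀ with hy₀
  obtain ⟨T, hT, ht₀T, O, hO, hqO, hOt, hOV, hsrc, hf⟩ :=
    exists_contDiffOn_coordFamily (y₀ := y₀) h.isOpen h.smooth ht₀ hx₀ (mem_extChartAt_source y₀)
  set q₀ := extChartAt I x₀ x₀ with hq₀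
  set S := J ∩ T with hSdef
  have hS : UniqueDiffOn ℝ S := h.uniqueDiffOn.inter hT
  have ht₀S : t₀ ∈ S := ⟨ht₀, ht₀T⟩
  have hcl : t₀ ∈ closure (interior S) := by
    rw [hSdef, interior_inter, hT.interior_eq, inter_comm]
    exact hT.inter_closure ⟨ht₀T, h.subset_closure ht₀⟩
  have hsymm : ∀ t ∈ S, ∀ z ∈ O, (extChartAt I y₀).symm (coordFamily I x₀ y₀ φ (t, z))
      = φ t ((extChartAt I x₀).symm z) := fun t ht z hz =>
    (extChartAt I y₀).left_inv (hsrc t ht z hz)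
  have hmf : ∀ t ∈ S, ∀ z ∈ O, ∀ v : B,
      (mfderiv I I (φ t) ((extChartAt I x₀).symm z) (chartD I x₀ z v) : B)
      = chartD I y₀ (coordFamily I x₀ y₀ φ (t, z))
        (fderivWithin ℝ (coordFamily I x₀ y₀ φ) (S ×ˢ O) (t, z) (0, v)) := by
    intro t ht z hz v
    rw [fderivWithin_coordFamily_space hO hf ht hz]
    exact mfderiv_chartD (hOt hz) ((contMDiffAt_of_family h.isOpen h.smooth ht.1
      (hOV z hz)).mdifferentiableAt (by simp)) (hsrc t ht z hz) v
  have hΘ : ContDiffAt ℝ ∞ (coordBilin I y₀ Ω) (coordFamily I x₀ y₀ φ (t₀, q₀)) ∧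
      coordFamily I x₀ y₀ φ (t₀, q₀) ∈ (extChartAt I y₀).target ∧
      (extChartAt I y₀).symm (coordFamily I x₀ y₀ φ (t₀, q₀)) ∈ U := by
    have h1 : coordFamily I x₀ y₀ φ (t₀, q₀) ∈ (extChartAt I y₀).target :=
      (extChartAt I y₀).map_source (hsrc t₀ ht₀S q₀ hqO)
    have h2 : (extChartAt I y₀).symm (coordFamily I x₀ y₀ φ (t₀, q₀)) ∈ U := by
      rw [hsymm t₀ ht₀S q₀ hqO]
      exact h.mapsTo t₀ ht₀ (hOV q₀ hqO)
    exact ⟨hΩ.contDiffAt_coordBilin h1 h2, h1, h2⟩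
  have hvel : coordForm I x₀ (pullVelocityForm Ω J φ t₀) =ᶠ[𝓝 q₀]
      velocityForm (coordBilin I y₀ Ω) (coordFamily I x₀ y₀ φ) (S ×ˢ O) t₀ := by
    filter_upwards [hO.mem_nhds hqO] with z hz
    refine ContinuousLinearMap.ext fun v => ?_
    have h1 := fderivWithin_coordFamily_time hS inter_subset_left hf ht₀S hz
      ((contMDiffWithinAt_curve h.smooth ht₀ (hOV z hz)).mdifferentiableWithinAt (by simp))
      (hsrc t₀ ht₀S z hz)
    have h2 := hmf t₀ ht₀S z hz v
    have h3 := form_congr Ω (hsymm t₀ ht₀S z hz).symm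
      (curveVelocity I J φ t₀ ((extChartAt I x₀).symm z))
      (mfderiv I I (φ t₀) ((extChartAt I x₀).symm z) (chartD I x₀ z v))
    refine (show _ = _ from h3).trans ?_
    rw [h2, ← h1]
    rfl
  have hpb : ∀ t ∈ S, ∀ v w : B, pullBilin Ω φ t ((extChartAt I x₀).symm q₀) (chartD I x₀ q₀ v)
      (chartD I x₀ q₀ w) = coordBilin I y₀ Ω (coordFamily I x₀ y₀ φ (t, q₀))
        (fderivWithin ℝ (coordFamily I x₀ y₀ φ) (S ×ˢ O) (t, q₀) (0, v))
        (fderivWithin ℝ (coordFamily I x₀ y₀ φ) (S ×ˢ O) (t, q₀) (0, w)) := by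
    intro t ht v w
    have h3 := form_congr Ω (hsymm t ht q₀ hqO).symm
      (mfderiv I I (φ t) ((extChartAt I x₀).symm q₀) (chartD I x₀ q₀ v))
      (mfderiv I I (φ t) ((extChartAt I x₀).symm q₀) (chartD I x₀ q₀ w))
    refine (show _ = _ from h3).trans ?_
    rw [hmf t ht q₀ hqO, hmf t ht q₀ hqO]
    rfl
  refine ⟨(contDiffAt_velocityForm hS ht₀S hO hqO hf hΘ.1).congr_of_eventuallyEq hvel,
    fun v w => ?_⟩
  have hd := hasDerivWithinAt_pullback hS ht₀S hcl hO hqO hf hΘ.1 (hΩ.coordBilin_skew hΘ.2.2)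
    (hΩ.cyclic hΘ.2.1 hΘ.2.2) v w
  rw [hvel.fderiv_eq]
  exact (hd.congr (fun t ht => hpb t ht v w) (hpb t₀ ht₀S v w)).mono_of_mem_nhdsWithin
    (inter_mem_nhdsWithin J (hT.mem_nhds ht₀T))

/-- The pullbacks $\varphi_t^*\Omega$ are constant in $t$, so their derivative, the exterior
derivative of this form, vanishes. -/
theorem IsSmoothFamily.closed_pullVelocityForm (h : IsSmoothFamily I J U V φ)
    (hΩ : IsSymplecticOn I U Ω) (ht₀ : t₀ ∈ J)
    (hp : ∀ p ∈ V, ∀ v w : TangentSpace I p, ∀ t ∈ J, pullBilin Ω φ t p v w = Ω p v w) :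
    OneFormClosedOn I V (pullVelocityForm Ω J φ t₀) := by
  refine oneFormClosedOn_of_chart fun x₀ hx₀ => ?_
  obtain ⟨h1, h2⟩ := h.cartan_aux hΩ ht₀ hx₀
  refine ⟨h1.differentiableAt (by simp), fun v w => sub_eq_zero.1 ?_⟩
  have hV : (extChartAt I x₀).symm (extChartAt I x₀ x₀) ∈ V := by rwa [extChartAt_to_inv]
  have h3 := (h2 v w).congr (fun t ht => (hp _ hV _ _ t ht).symm) (hp _ hV _ _ t₀ ht₀).symm
  exact (h.uniqueDiffOn t₀ ht₀).eq_deriv _ h3 (hasDerivWithinAt_const t₀ J _)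

/-- The converse: closedness makes the time derivative of $\varphi_t^*\Omega$ vanish, and `J` is
convex. -/
theorem IsSmoothFamily.pullBilin_eq (h : IsSmoothFamily I J U V φ) (hJ : Convex ℝ J)
    (hΩ : IsSymplecticOn I U Ω)
    (hcl : ∀ t ∈ J, OneFormClosedOn I V (pullVelocityForm Ω J φ t)) {p : N} (hp : p ∈ V)
    (v w : TangentSpace I p) {t t' : ℝ} (ht : t ∈ J) (ht' : t' ∈ J) :
    pullBilin Ω φ t p v w = pullBilin Ω φ t' p v w := by
  have hd : ∀ s ∈ J, HasDerivWithinAt (fun t => pullBilin Ω φ t p v w) 0 J s := by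
    intro s hs
    obtain ⟨h1, h2⟩ := h.cartan_aux hΩ hs hp
    have hq := mem_extChartAt_target (I := I) p
    have key : ∀ v w : TangentSpace I ((extChartAt I p).symm (extChartAt I p p)),
        HasDerivWithinAt (fun t => pullBilin Ω φ t ((extChartAt I p).symm (extChartAt I p p)) v w)
          0 J s := by
      intro v w
      obtain ⟨v, rfl⟩ := chartD_surjective hq v
      obtain ⟨w, rfl⟩ := chartD_surjective hq w
      refine (h2 v w).congr_deriv (sub_eq_zero.2 ?_)
      exact (hcl s hs).symm_fderiv h.isOpen hq (by rwa [extChartAt_to_inv])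
        (h1.differentiableAt (by simp)) v w
    rw [extChartAt_to_inv] at key
    exact key v w
  refine hJ.is_const_of_fderivWithin_eq_zero (𝕜 := ℝ)
    (fun s hs => (hd s hs).differentiableWithinAt) (fun s hs => ?_) ht ht'
  rw [(hd s hs).hasFDerivWithinAt.fderivWithin (h.uniqueDiffOn s hs)]
  exact ContinuousLinearMap.ext fun c => by simp

end Cartan

/-! ### Velocities of curves in a chart -/

section Curves

variable {B H : Type*} [NormedAddCommGroup B] [NormedSpace ℝ B] [FiniteDimensional ℝ B]
  [TopologicalSpace H] {I : ModelWithCorners ℝ B H} [I.Boundaryless]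
  {N : Type*} [TopologicalSpace N] [ChartedSpace H N] [IsManifold I ∞ N]
  {y₀ : N} {J : Set ℝ} {t : ℝ}

theorem exists_hasDerivWithinAt_chart {c : ℝ → N} (hc : MDifferentiableWithinAt 𝓘(ℝ, ℝ) I c J t)
    (hs : c t ∈ (extChartAt I y₀).source) :
    ∃ D : B, HasDerivWithinAt (fun τ => extChartAt I y₀ (c τ)) D J t ∧
      chartD I y₀ (extChartAt I y₀ (c t)) D = (mfderivWithin 𝓘(ℝ, ℝ) I c J t (1 : ℝ) : B) := by
  have h3 := ((contMDiffAt_chart hs).mdifferentiableAt (by simp)).hasMFDerivAt.comp_hasMFDerivWithinAt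
    t hc.hasMFDerivWithinAt
  let A : B →L[ℝ] B := mfderiv I 𝓘(ℝ, B) (extChartAt I y₀) (c t)
  let L : ℝ →L[ℝ] B := A.comp (mfderivWithin 𝓘(ℝ, ℝ) I c J t)
  have h4 : HasFDerivWithinAt (fun τ => extChartAt I y₀ (c τ)) L J t :=
    hasMFDerivWithinAt_iff_hasFDerivWithinAt.1 h3
  refine ⟨L 1, h4.hasDerivWithinAt, ?_⟩
  have h8 := chartD_mfderiv_chart ((extChartAt I y₀).map_source hs)
  have key : ∀ z' (hz' : z' = c t) (w : B),
      (chartD I y₀ (extChartAt I y₀ (c t)) (mfderiv I 𝓘(ℝ, B) (extChartAt I y₀) z' w : B) : B)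
      = chartD I y₀ (extChartAt I y₀ (c t))
        (mfderiv I 𝓘(ℝ, B) (extChartAt I y₀) (c t) w : B) := by
    rintro _ rfl _; rfl
  exact (key _ ((extChartAt I y₀).left_inv hs) _).symm.trans (h8 _)

end Curves

/-! ### Initial velocity of a family of sections versus velocity of the isotopy -/

section Velocities

variable {B : Type*} [NormedAddCommGroup B] [NormedSpace ℝ B] [FiniteDimensional ℝ B]
  {C : Type*} [TopologicalSpace C] [ChartedSpace B C] [IsManifold 𝓘(ℝ, B) ∞ C]
  {F : Type*} [NormedAddCommGroup F] [NormedSpace ℝ F] [FiniteDimensional ℝ F]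
  {E : C → Type*} [TopologicalSpace (TotalSpace F E)] [∀ x, AddCommGroup (E x)]
  [∀ x, Module ℝ (E x)] [∀ x, TopologicalSpace (E x)]
  [FiberBundle F E] [VectorBundle ℝ F E] [ContMDiffVectorBundle ∞ F E 𝓘(ℝ, B)]

local notation "𝓘B" => modelWithCornersSelf ℝ B
local notation "𝓙" => ModelWithCorners.prod (modelWithCornersSelf ℝ B) (modelWithCornersSelf ℝ F)
local notation "𝟎" => graphMap (0 : Gam B F E)

variable {x₀ : C} {U V : Set (TotalSpace F E)} {Ω : BilinField B F E} {J : Set ℝ}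
  {s : ℝ → Gam B F E} {φ : ℝ → TotalSpace F E → TotalSpace F E}

theorem contDiffOn_sectCoord_family
    (hs : ContMDiffOn (𝓘(ℝ, ℝ).prod 𝓘B) 𝓙 ∞ (fun q : ℝ × C => graphMap (s q.1) q.2) (J ×ˢ univ)) :
    ContDiffOn ℝ ∞ (fun q : ℝ × B => sectCoord F x₀ (s q.1) q.2) (J ×ˢ baseDom B F E x₀) := by
  have hg : ContMDiffOn 𝓘(ℝ, ℝ × B) 𝓙 ∞
      (fun q : ℝ × B => graphMap (s q.1) ((extChartAt 𝓘B x₀).symm q.2)) (J ×ˢ baseDom B F E x₀) := by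
    refine hs.comp (f := fun q : ℝ × B => (q.1, (extChartAt 𝓘B x₀).symm q.2))
      (ContMDiffOn.prodMk contDiff_fst.contMDiff.contMDiffOn ?_) fun q hq => ⟨hq.1, mem_univ _⟩
    exact (contMDiffOn_extChartAt_symm x₀).comp (f := fun q : ℝ × B => q.2)
      contDiff_snd.contMDiff.contMDiffOn fun q hq => hq.2.1
  have hcd : ContMDiffOn 𝓘(ℝ, ℝ × B) 𝓘(ℝ, B × F) ∞ (fun q : ℝ × B => extChartAt 𝓙 (𝟎 x₀)
      (graphMap (s q.1) ((extChartAt 𝓘B x₀).symm q.2))) (J ×ˢ baseDom B F E x₀) := fun q hq =>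
    (contMDiffAt_chart (graphMap_chart_mem (s q.1) hq.2)).comp_contMDiffWithinAt q (hg q hq)
  exact hcd.contDiffOn.snd.congr fun q hq =>
    (congrArg Prod.snd (extChartAt_total_graph (s q.1) hq.2)).symm

/-- The initial velocity of a family of sections is the normal part of the velocity of an isotopy
that maps the zero section to their graphs. -/
theorem exists_initialVelocity_eq (h0 : (0 : ℝ) ∈ J) (hJ : UniqueDiffOn ℝ J)
    (hs : ContMDiffOn (𝓘(ℝ, ℝ).prod 𝓘B) 𝓙 ∞ (fun q : ℝ × C => graphMap (s q.1) q.2) (J ×ˢ univ))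
    (hs0 : s 0 = 0)
    (hφ : ContMDiffOn (𝓘(ℝ, ℝ).prod 𝓙) 𝓙 ∞ (fun q : ℝ × TotalSpace F E => φ q.1 q.2) (J ×ˢ V))
    (hφ0 : ∀ p ∈ V, φ 0 p = p) (hV : ∀ x, 𝟎 x ∈ V) (hgr : ∀ t ∈ J, ∀ x, φ t (𝟎 x) ∈ graph (s t))
    (x : C) : ∃ (e : E x) (u : TangentSpace 𝓘B x),
      HasDerivWithinAt (fun t => (trivializationAt F E x).continuousLinearMapAt ℝ x (s t x))
        ((trivializationAt F E x).continuousLinearMapAt ℝ x e) J 0 ∧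
      (curveVelocity 𝓙 J φ 0 (𝟎 x) : B × F)
        = (vert B F E x e : B × F) + (zeroDeriv B F E x u : B × F) := by
  have hy := mem_baseDom_self (B := B) (F := F) (E := E) (x₀ := x)
  have hr := extChartAt_to_inv (I := 𝓘B) x
  set y₀ : B := extChartAt 𝓘B x x with hy₀
  set c : ℝ → TotalSpace F E := fun τ => φ τ (𝟎 x) with hc
  have hc0 : c 0 = 𝟎 x := hφ0 _ (hV x)
  have hcs : ContMDiffWithinAt 𝓘(ℝ, ℝ) 𝓙 ∞ c J 0 := contMDiffWithinAt_curve hφ h0 (hV x)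
  have hsrc : c 0 ∈ (extChartAt 𝓙 (𝟎 x)).source := by rw [hc0]; exact mem_extChartAt_source _
  have hch0 : extChartAt 𝓙 (𝟎 x) (c 0) = (y₀, 0) := by
    have := extChartAt_total_graph ((0 : Gam B F E) : ∀ x, E x) hy
    rw [sectCoord_zero hy, hr] at this
    rw [hc0]
    exact this
  obtain ⟨D, hD, hvel⟩ := exists_hasDerivWithinAt_chart (y₀ := 𝟎 x)
    (hcs.mdifferentiableWithinAt (by simp)) hsrc
  -- the base point of the curve
  let y : ℝ → B := fun τ => extChartAt 𝓘B x (c τ).proj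
  have hpc : ContinuousWithinAt (fun τ => (c τ).proj) J 0 :=
    (FiberBundle.continuous_proj F E).continuousAt.comp_continuousWithinAt hcs.continuousWithinAt
  have hev : ∀ᶠ τ in 𝓝[J] (0 : ℝ), (c τ).proj ∈ baseNhd B F E x :=
    hpc.eventually (isOpen_baseNhd.mem_nhds (by
      show (c 0).proj ∈ _
      rw [hc0]
      exact ⟨mem_extChartAt_source x, mem_baseSet_trivializationAt F E x⟩))
  have hdom : ∀ τ, (c τ).proj ∈ baseNhd B F E x → y τ ∈ baseDom B F E x ∧
      (extChartAt 𝓘B x).symm (y τ) = (c τ).proj := by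
    intro τ hτ
    obtain ⟨z, hz, hzτ⟩ := exists_of_mem_baseNhd hτ
    have : y τ = z := by
      show extChartAt 𝓘B x (c τ).proj = z
      rw [← hzτ]
      exact (extChartAt 𝓘B x).right_inv hz.1
    rw [this]
    exact ⟨hz, hzτ⟩
  -- The curve runs on the graphs, so its fibre coordinate is the section `s τ` evaluated at the
  -- moving base point.
  have hcoord : ∀ᶠ τ in 𝓝[J] (0 : ℝ), y τ ∈ baseDom B F E x ∧
      extChartAt 𝓙 (𝟎 x) (c τ) = (y τ, sectCoord F x (s τ) (y τ)) := by
    filter_upwards [hev, self_mem_nhdsWithin] with τ hτ hτJ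
    obtain ⟨h1, h2⟩ := hdom τ hτ
    refine ⟨h1, ?_⟩
    obtain ⟨x', hx'⟩ := hgr τ hτJ x
    have hcx : c τ = graphMap (s τ) x' := hx'.symm
    have h3 : (extChartAt 𝓘B x).symm (y τ) = x' := by rw [h2, hcx]; rfl
    have h4 := extChartAt_total_graph (s τ) h1
    rw [h3] at h4
    rw [hcx]
    exact h4
  have hy0 : y 0 = y₀ := by
    show extChartAt 𝓘B x (c 0).proj = _
    rw [hc0]
    rfl
  have hyd : HasDerivWithinAt y D.1 J 0 := by
    have h1 : HasDerivWithinAt (fun τ => (extChartAt 𝓙 (𝟎 x) (c τ)).1) D.1 J 0 :=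
      (ContinuousLinearMap.fst ℝ B F).hasFDerivAt.comp_hasDerivWithinAt (0 : ℝ) hD
    refine h1.congr_of_eventuallyEq ?_ (by rw [hch0, hy0])
    filter_upwards [hcoord] with τ hτ
    rw [hτ.2]
  -- the derivative of the coordinate expression of the sections
  have hSd := ((contDiffOn_sectCoord_family (x₀ := x) hs (0, y₀) ⟨h0, hy⟩).differentiableWithinAt
    (by simp)).hasFDerivWithinAt
  set S' := fderivWithin ℝ (fun q : ℝ × B => sectCoord F x (s q.1) q.2) (J ×ˢ baseDom B F E x)
    (0, y₀)
  -- The initial section is zero, so the drift of the base point does not contribute to the vertical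
  -- velocity.
  have hS2 : ∀ v : B, S' (0, v) = 0 := by
    intro v
    have h1 := HasFDerivWithinAt.comp_hasFDerivAt
      (g := fun q : ℝ × B => sectCoord F x (s q.1) q.2) (f := fun z : B => ((0 : ℝ), z))
      (t := J ×ˢ baseDom B F E x) y₀ hSd (hasFDerivAt_prodMk_right (0 : ℝ) y₀) (by
        filter_upwards [isOpen_baseDom.mem_nhds hy] with z hz using ⟨h0, hz⟩)
    have h2 : HasFDerivAt ((fun q : ℝ × B => sectCoord F x (s q.1) q.2) ∘ fun z : B => ((0 : ℝ), z))
        (0 : B →L[ℝ] F) y₀ := by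
      refine (hasFDerivAt_const (0 : F) y₀).congr_of_eventuallyEq ?_
      filter_upwards [isOpen_baseDom.mem_nhds hy] with z hz
      show sectCoord F x (s 0) z = 0
      rw [hs0, sectCoord_zero hz]
    exact DFunLike.congr_fun (h1.unique h2) v
  have hS1 : HasDerivWithinAt (fun t => sectCoord F x (s t) y₀) (S' (1, 0)) J 0 :=
    HasFDerivWithinAt.comp_hasDerivWithinAt
      (l := fun q : ℝ × B => sectCoord F x (s q.1) q.2) (f := fun t : ℝ => (t, y₀))
      (t := J ×ˢ baseDom B F E x) (0 : ℝ) hSd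
      ((hasDerivWithinAt_id (0 : ℝ) J).prodMk (hasDerivWithinAt_const (0 : ℝ) J y₀))
      fun t ht => ⟨ht, hy⟩
  have hD2 : D.2 = S' (1, 0) := by
    have h1 : HasDerivWithinAt (fun τ => (extChartAt 𝓙 (𝟎 x) (c τ)).2) D.2 J 0 :=
      (ContinuousLinearMap.snd ℝ B F).hasFDerivAt.comp_hasDerivWithinAt (0 : ℝ) hD
    obtain ⟨A, hA, hA'⟩ := mem_nhdsWithin_iff_exists_mem_nhds_inter.1 hcoord
    have hAn : A ∩ J ∈ 𝓝[J] (0 : ℝ) := inter_comm J A ▸ inter_mem_nhdsWithin J hA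
    have hSd' : HasFDerivWithinAt (fun q : ℝ × B => sectCoord F x (s q.1) q.2) S'
        (J ×ˢ baseDom B F E x) (0, y 0) := by rw [hy0]; exact hSd
    have h2 := HasFDerivWithinAt.comp_hasDerivWithinAt (s := A ∩ J)
      (l := fun q : ℝ × B => sectCoord F x (s q.1) q.2) (f := fun t : ℝ => (t, y t))
      (t := J ×ˢ baseDom B F E x) (0 : ℝ) hSd'
      (((hasDerivWithinAt_id (0 : ℝ) J).prodMk hyd).mono inter_subset_right)
      fun t ht => ⟨ht.2, (hA' ht).1⟩
    have h3 := h2.mono_of_mem_nhdsWithin hAn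
    have h4 : HasDerivWithinAt (fun τ => (extChartAt 𝓙 (𝟎 x) (c τ)).2) (S' (1, D.1)) J 0 := by
      refine h3.congr_of_eventuallyEq ?_ ?_
      · filter_upwards [hcoord] with τ hτ
        rw [hτ.2]
        rfl
      · rw [hch0]
        show (0 : F) = sectCoord F x (s 0) (y 0)
        rw [hy0, hs0, sectCoord_zero hy]
    rw [(hJ 0 h0).eq_deriv _ h1 h4, show ((1 : ℝ), D.1) = (1, 0) + (0, D.1) by simp, map_add, hS2,
      add_zero]
  have hsc : ∀ σ : Gam B F E, sectCoord F x σ y₀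
      = (trivializationAt F E x).continuousLinearMapAt ℝ x (σ x) := by
    intro σ
    rw [sectCoord_eq _ hy, hr]
  have hb := mem_baseSet_trivializationAt F E x
  have hee := (trivializationAt F E x).continuousLinearMapAt_symmL (R := ℝ) hb D.2
  refine ⟨(trivializationAt F E x).symmL ℝ x D.2, chartD 𝓘B x y₀ D.1, ?_, ?_⟩
  · rw [hee, hD2]
    simp only [hsc] at hS1
    exact hS1
  · have key : ∀ x', x' = x → (∀ e : E x', (vert B F E x' e : B × F)
          = chartD 𝓙 (𝟎 x) (y₀, (0 : F))
            (0, (trivializationAt F E x).continuousLinearMapAt ℝ x' e)) →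
          (∀ v : B, (zeroDeriv B F E x' (chartD 𝓘B x y₀ v : B) : B × F)
            = chartD 𝓙 (𝟎 x) (y₀, (0 : F)) (v, 0)) →
          ∀ e : E x, (vert B F E x e : B × F) = chartD 𝓙 (𝟎 x) (y₀, (0 : F))
        (0, (trivializationAt F E x).continuousLinearMapAt ℝ x e) ∧ ∀ v : B,
        (zeroDeriv B F E x (chartD 𝓘B x y₀ v : B) : B × F)
          = chartD 𝓙 (𝟎 x) (y₀, (0 : F)) (v, 0) := by
      rintro _ rfl h1 h2 e
      exact ⟨h1 e, h2⟩
    obtain ⟨k1, k2⟩ := key _ hr (vert_chart (F := F) (E := E) hy)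
      (zeroDeriv_chartD (F := F) (E := E) hy) ((trivializationAt F E x).symmL ℝ x D.2)
    have hv : (curveVelocity 𝓙 J φ 0 (𝟎 x) : B × F) = chartD 𝓙 (𝟎 x) (y₀, (0 : F)) D := by
      rw [← hch0]
      exact hvel.symm
    rw [hee] at k1
    refine hv.trans ?_
    have hsplit : chartD 𝓙 (𝟎 x) (y₀, (0 : F)) D = chartD 𝓙 (𝟎 x) (y₀, (0 : F)) (0, D.2)
        + chartD 𝓙 (𝟎 x) (y₀, (0 : F)) (D.1, 0) := by
      rw [← map_add, Prod.mk_add_mk, zero_add, add_zero]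
    refine (show _ = _ from hsplit).trans ?_
    exact congrArg₂ (fun a b : B × F => a + b) k1.symm (k2 D.1).symm

end Velocities

/-! ### Families that are trivial under symplectic or Hamiltonian equivalence -/

section TrivialFamilies

variable {B : Type*} [NormedAddCommGroup B] [NormedSpace ℝ B] [FiniteDimensional ℝ B]
  {C : Type*} [TopologicalSpace C] [ChartedSpace B C] [IsManifold 𝓘(ℝ, B) ∞ C]
  {F : Type*} [NormedAddCommGroup F] [NormedSpace ℝ F] [FiniteDimensional ℝ F]
  {E : C → Type*} [TopologicalSpace (TotalSpace F E)] [∀ x, AddCommGroup (E x)]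
  [∀ x, Module ℝ (E x)] [∀ x, TopologicalSpace (E x)]
  [FiberBundle F E] [VectorBundle ℝ F E] [ContMDiffVectorBundle ∞ F E 𝓘(ℝ, B)]

local notation "𝓘B" => modelWithCornersSelf ℝ B
local notation "𝓙" => ModelWithCorners.prod (modelWithCornersSelf ℝ B) (modelWithCornersSelf ℝ F)
local notation "𝟎" => graphMap (0 : Gam B F E)

variable {U V : Set (TotalSpace F E)} {Ω : BilinField B F E} {J : Set ℝ}
  {s : ℝ → Gam B F E} {φ : ℝ → TotalSpace F E → TotalSpace F E}

theorem IsSymplecticIsotopy.isSmoothFamily (h : IsSymplecticIsotopy U Ω J V φ)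
    (hJ : UniqueDiffOn ℝ J) (hcl : J ⊆ closure (interior J)) : IsSmoothFamily 𝓙 J U V φ :=
  ⟨hJ, hcl, h.isOpen, h.smooth, h.mapsTo⟩

theorem mfderiv_eq_id_of_eqOn {ψ : TotalSpace F E → TotalSpace F E} (hV : IsOpen V)
    (hψ : ∀ p ∈ V, ψ p = p) {p : TotalSpace F E} (hp : p ∈ V) (v : TT B p) :
    (mfderiv 𝓙 𝓙 ψ p v : B × F) = v := by
  have h : ψ =ᶠ[𝓝 p] id := by filter_upwards [hV.mem_nhds hp] with q hq using hψ q hq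
  have h1 := h.mfderiv_eq (I := 𝓙) (I' := 𝓙)
  rw [mfderiv_id] at h1
  exact DFunLike.congr_fun h1 v

theorem pullVelocityForm_zero (h : IsSymplecticIsotopy U Ω J V φ) {p : TotalSpace F E} (hp : p ∈ V)
    (v : TT B p) : pullVelocityForm (I := 𝓙) Ω J φ 0 p v
      = (Ω p : (B × F) →L[ℝ] (B × F) →L[ℝ] ℝ) (curveVelocity 𝓙 J φ 0 p : B × F) v := by
  have h1 := mfderiv_eq_id_of_eqOn h.isOpen h.start hp v
  refine (omega_congr Ω (h.start p hp) (curveVelocity 𝓙 J φ 0 p) (mfderiv 𝓙 𝓙 (φ 0) p v)).trans ?_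
  rw [h1]

/-- Contracting $\Omega$ with the velocity at time zero gives a closed form near $C$; let $\gamma$
be its restriction to $C$. Surjectivity of `flat` yields a smooth `σ` with form $\gamma|_K$, and
`normal_iff` shows pointwise that it is the derivative of the family. No smoothness of that
derivative has to be proved separately. -/
theorem exists_initialVelocity (hΩ : IsSymplecticOn 𝓙 U Ω) (hC : (0 : Gam B F E) ∈ DefU U Ω)
    (h0 : (0 : ℝ) ∈ J) (hJ : UniqueDiffOn ℝ J) (hcl : J ⊆ closure (interior J))
    (hs : IsCoisotropicFamily U Ω J s) (hφ : IsSymplecticIsotopy U Ω J V φ)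
    (hV : graph (0 : Gam B F E) ⊆ V)
    (hgr : ∀ t ∈ J, φ t '' graph (0 : Gam B F E) = graph (s t)) :
    ∃ σ : Gam B F E, IsInitialVelocity J s σ ∧ ∃ γ ∈ closedOneForms B C,
      flat Ω σ = restrictToK (kernelDist Ω) γ ∧
      ∀ x v, γ x v = pullVelocityForm (I := 𝓙) Ω J φ 0 (𝟎 x) (zeroDeriv B F E x v) := by
  have hV' : ∀ x : C, 𝟎 x ∈ V := fun x => hV ⟨x, rfl⟩
  have hfam := hφ.isSmoothFamily hJ hcl
  obtain ⟨γ, hγ, hγβ⟩ := exists_closedOneForm hV' hφ.isOpen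
    (fun p hp => (hfam.cartan_aux hΩ h0 hp).1)
    (hfam.closed_pullVelocityForm hΩ h0 fun p hp v w t ht => hφ.symplectic t ht p hp v w)
  have hmem : restrictToK (kernelDist Ω) γ ∈ LinearMap.range (flat Ω) := by
    rw [range_flat hΩ hC]
    exact (restrictToK_closed _ γ hγ).1
  obtain ⟨σ, hσ⟩ := hmem
  refine ⟨σ, fun x => ?_, γ, hγ, hσ, hγβ⟩
  obtain ⟨e, u, hd, hvel⟩ := exists_initialVelocity_eq h0 hJ hs.smooth hs.start hφ.smooth hφ.start
    hV' (fun t ht x => hgr t ht ▸ mem_image_of_mem _ ⟨x, rfl⟩) x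
  have hn := (normal_iff hΩ hC (show TT B (𝟎 x) from (curveVelocity 𝓙 J φ 0 (𝟎 x) : B × F)) e).1
    ⟨u, hvel⟩
  have he : σ x - e = 0 := eq_zero_of_vert_kernelDist hΩ hC x _ fun k hk => by
    have h1 : Ω (𝟎 x) (vert B F E x (σ x)) (zeroDeriv B F E x k) = γ x k :=
      LinearMap.congr_fun (congrFun hσ x) ⟨k, hk⟩
    have h2 := hn ⟨k, hk⟩
    rw [map_sub, map_sub, sub_apply, h1, ← h2, hγβ,
      pullVelocityForm_zero hφ (hV' x), sub_eq_zero]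
  rw [sub_eq_zero.1 he]
  exact hd

/-- Here the closed form of `exists_initialVelocity` is the differential of the restriction to $C$
of the Hamiltonian at time zero. -/
theorem exists_initialVelocity_hamiltonian (hΩ : IsSymplecticOn 𝓙 U Ω)
    (hC : (0 : Gam B F E) ∈ DefU U Ω)
    (h0 : (0 : ℝ) ∈ J) (hJ : UniqueDiffOn ℝ J) (hcl : J ⊆ closure (interior J))
    (hs : IsCoisotropicFamily U Ω J s) (ht : HamiltonianTrivial U Ω J s) :
    ∃ σ : Gam B F E, IsInitialVelocity J s σ ∧ flat Ω σ ∈ exactFoliated (kernelDist Ω) := by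
  obtain ⟨V, φ, hφ, hV, hgr⟩ := ht
  obtain ⟨σ, hσ, γ, -, hσγ, hγ⟩ :=
    exists_initialVelocity hΩ hC h0 hJ hcl hs hφ.toIsSymplecticIsotopy hV hgr
  obtain ⟨G, hG, hGφ⟩ := hφ.hamiltonian
  have hG0 : ContMDiffOn 𝓙 𝓘(ℝ, ℝ) ∞ (G 0) V :=
    hG.comp (f := fun p => ((0 : ℝ), p)) (contMDiffOn_const.prodMk contMDiffOn_id)
      fun p hp => ⟨h0, p, hp, hφ.start p hp⟩
  have hV' : ∀ x : C, 𝟎 x ∈ V := fun x => hV ⟨x, rfl⟩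
  refine ⟨σ, hσ, fun x => G 0 (𝟎 x), fun x => (hG0.contMDiffAt (hφ.isOpen.mem_nhds (hV' x))).comp x
    (contMDiffAt_graphMap 0 x), fun x k => ?_⟩
  rw [dirDeriv_comp_zero ((hG0.contMDiffAt (hφ.isOpen.mem_nhds (hV' x))).mdifferentiableAt
    (by simp)), hσγ]
  refine (hγ x k).trans ?_
  rw [pullVelocityForm_zero hφ.toIsSymplecticIsotopy (hV' x)]
  have h1 := hGφ 0 h0 _ (hV' x) (zeroDeriv B F E x k : B × F)
  have h2 := omega_congr Ω (hφ.start _ (hV' x)) (curveVelocity 𝓙 J φ 0 (𝟎 x)) (zeroDeriv B F E x k)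
  refine h2.symm.trans (h1.trans ?_)
  have key : ∀ p p' : TotalSpace F E, p = p' → ∀ w : B × F, dirDeriv 𝓙 (G 0) p w
    = dirDeriv 𝓙 (G 0) p' w := by
    rintro _ _ rfl _; rfl
  exact key _ _ (hφ.start _ (hV' x)) _

theorem exists_initialVelocity_symplectic (hΩ : IsSymplecticOn 𝓙 U Ω)
    (hC : (0 : Gam B F E) ∈ DefU U Ω)
    (h0 : (0 : ℝ) ∈ J) (hJ : UniqueDiffOn ℝ J) (hcl : J ⊆ closure (interior J))
    (hs : IsCoisotropicFamily U Ω J s) (ht : SymplecticallyTrivial U Ω J s) :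
    ∃ σ : Gam B F E, IsInitialVelocity J s σ ∧
      ∃ γ ∈ closedOneForms B C, flat Ω σ = restrictToK (kernelDist Ω) γ := by
  obtain ⟨V, φ, hφ, hV, hgr⟩ := ht
  obtain ⟨σ, hσ, γ, hγ, h, -⟩ := exists_initialVelocity hΩ hC h0 hJ hcl hs hφ hV hgr
  exact ⟨σ, hσ, γ, hγ, h⟩

theorem IsInitialVelocity.eq (h0 : (0 : ℝ) ∈ J) (hJ : UniqueDiffOn ℝ J) {σ τ : Gam B F E}
    (hσ : IsInitialVelocity J s σ) (hτ : IsInitialVelocity J s τ) : σ = τ := by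
  ext x
  have h := (hJ 0 h0).eq_deriv _ (hσ x) (hτ x)
  have hb := mem_baseSet_trivializationAt F E x
  rw [← (trivializationAt F E x).symmL_continuousLinearMapAt (R := ℝ) hb (σ x), h,
    (trivializationAt F E x).symmL_continuousLinearMapAt (R := ℝ) hb (τ x)]

theorem Ico_subset_closure_interior {ε : ℝ} : Ico 0 ε ⊆ closure (interior (Ico 0 ε)) := by
  intro t ht
  rw [interior_Ico, closure_Ioo (ht.1.trans_lt ht.2).ne]
  exact Ico_subset_Icc_self ht

theorem hamiltonianVelocities_subset (hΩ : IsSymplecticOn 𝓙 U Ω) (hC : (0 : Gam B F E) ∈ DefU U Ω) :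
    hamiltonianVelocities U Ω ⊆ hamiltonianDirections U Ω := by
  rintro σ ⟨ε, hε, s, hs, ht, hσ⟩
  have h0 : (0 : ℝ) ∈ Ico 0 ε := ⟨le_rfl, hε⟩
  obtain ⟨τ, hτ, h⟩ := exists_initialVelocity_hamiltonian hΩ hC h0 (uniqueDiffOn_Ico 0 ε)
    Ico_subset_closure_interior hs ht
  rw [hamiltonianDirections_eq hΩ hC, hσ.eq h0 (uniqueDiffOn_Ico 0 ε) hτ]
  exact h

theorem symplecticVelocities_subset (hΩ : IsSymplecticOn 𝓙 U Ω) (hC : (0 : Gam B F E) ∈ DefU U Ω) :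
    symplecticVelocities U Ω ⊆ symplecticDirections U Ω := by
  rintro σ ⟨ε, hε, s, hs, ht, hσ⟩
  have h0 : (0 : ℝ) ∈ Ico 0 ε := ⟨le_rfl, hε⟩
  obtain ⟨τ, hτ, h⟩ := exists_initialVelocity_symplectic hΩ hC h0 (uniqueDiffOn_Ico 0 ε)
    Ico_subset_closure_interior hs ht
  rw [symplecticDirections_eq hΩ hC, hσ.eq h0 (uniqueDiffOn_Ico 0 ε) hτ]
  exact h

end TrivialFamilies

/-! ### Flows of symplectic vector fields are symplectic isotopies -/

section FlowIsotopies

variable {B : Type*} [NormedAddCommGroup B] [NormedSpace ℝ B] [FiniteDimensional ℝ B]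
  {C : Type*} [TopologicalSpace C] [ChartedSpace B C] [IsManifold 𝓘(ℝ, B) ∞ C]
  {F : Type*} [NormedAddCommGroup F] [NormedSpace ℝ F] [FiniteDimensional ℝ F]
  {E : C → Type*} [TopologicalSpace (TotalSpace F E)] [∀ x, AddCommGroup (E x)]
  [∀ x, Module ℝ (E x)] [∀ x, TopologicalSpace (E x)]
  [FiberBundle F E] [VectorBundle ℝ F E] [ContMDiffVectorBundle ∞ F E 𝓘(ℝ, B)]

local notation "𝓘B" => modelWithCornersSelf ℝ B
local notation "𝓙" => ModelWithCorners.prod (modelWithCornersSelf ℝ B) (modelWithCornersSelf ℝ F)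
local notation "𝟎" => graphMap (0 : Gam B F E)

variable {U U' V : Set (TotalSpace F E)} {Ω : BilinField B F E} {ε : ℝ}
  {X : ∀ p : TotalSpace F E, TT B p} {φ : ℝ → TotalSpace F E → TotalSpace F E}

theorem IsLocalFlow.curveVelocity_eq (h : IsLocalFlow 𝓙 U' X V ε φ) {J : Set ℝ}
    (hJ : UniqueDiffOn ℝ J) (hJε : J ⊆ Ioo (-ε) ε) {t : ℝ} (ht : t ∈ J) {p : TotalSpace F E}
    (hp : p ∈ V) : curveVelocity 𝓙 J φ t p = X (φ t p) := by
  have h1 := ((h.deriv p hp t (hJε ht)).hasMFDerivWithinAt (s := J)).mfderivWithin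
    (hJ t ht).uniqueMDiffWithinAt
  refine (DFunLike.congr_fun h1 (1 : ℝ)).trans ?_
  exact one_smul ℝ (X (φ t p) : B × F)

theorem IsLocalFlow.subset (h : IsLocalFlow 𝓙 U' X V ε φ) (hε : 0 < ε) : V ⊆ U' := fun p hp => by
  have := h.mem p hp 0 ⟨by linarith, hε⟩
  rwa [h.start p hp] at this

/-- The flow of a symplectic vector field is symplectic. -/
theorem IsLocalFlow.pullBilin_eq (hΩ : IsSymplecticOn 𝓙 U Ω) (h : IsLocalFlow 𝓙 U' X V ε φ)
    (hU' : IsOpen U') (hU'U : U' ⊆ U) (hε : 0 < ε) (hX : SmoothFieldOn 𝓙 U' X)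
    (hXc : OneFormClosedOn 𝓙 U' (fun p => Ω p (X p))) {t : ℝ} (ht : t ∈ Ioo (-ε) ε)
    {p : TotalSpace F E} (hp : p ∈ V) (v w : TT B p) :
    pullBilin (I := 𝓙) Ω φ t p v w = Ω p v w := by
  have hfam : IsSmoothFamily 𝓙 (Ioo (-ε) ε) U V φ :=
    ⟨uniqueDiffOn_Ioo _ _, by rw [interior_Ioo]; exact subset_closure, h.isOpen, h.smooth,
      fun t ht p hp => hU'U (h.mem p hp t ht)⟩
  -- The generating field does not depend on time, so the form in question is the pullback of the
  -- closed form $\Omega(X,\cdot)$ by $\varphi_t$.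
  have hcl : ∀ t ∈ Ioo (-ε) ε,
      OneFormClosedOn 𝓙 V (pullVelocityForm (I := 𝓙) Ω (Ioo (-ε) ε) φ t) := by
    intro t ht
    have hφ : ContMDiffOn 𝓙 𝓙 ∞ (φ t) V := fun p hp =>
      (contMDiffAt_of_family h.isOpen h.smooth ht hp).contMDiffWithinAt
    refine (oneFormClosedOn_pullForm h.isOpen hU' hφ (fun p hp => h.mem p hp t ht)
      (fun p hp => ?_) hXc).congr fun p hp => ?_
    · have hr := extChartAt_to_inv (I := 𝓙) p
      refine hΩ.contDiffAt_contraction (mem_extChartAt_target p) (by rw [hr]; exact hU'U hp) ?_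
      rw [hr]
      exact hX.contMDiffAt (hU'.mem_nhds hp)
    · rw [pullVelocityForm, h.curveVelocity_eq (uniqueDiffOn_Ioo _ _) subset_rfl ht hp]
      rfl
  have h0 : (0 : ℝ) ∈ Ioo (-ε) ε := ⟨by linarith, hε⟩
  rw [hfam.pullBilin_eq (convex_Ioo _ _) hΩ hcl hp v w ht h0]
  have h1 := mfderiv_eq_id_of_eqOn (B := B) h.isOpen h.start hp
  refine (omega_congr Ω (h.start p hp) (mfderiv 𝓙 𝓙 (φ 0) p v) (mfderiv 𝓙 𝓙 (φ 0) p w)).trans ?_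
  rw [h1 v, h1 w]

theorem IsLocalFlow.isSymplecticIsotopy [T2Space C] (hΩ : IsSymplecticOn 𝓙 U Ω)
    (h : IsLocalFlow 𝓙 U' X V ε φ)
    (hU' : IsOpen U') (hU'U : U' ⊆ U) (hε : 0 < ε) (hX : SmoothFieldOn 𝓙 U' X)
    (hXc : OneFormClosedOn 𝓙 U' (fun p => Ω p (X p))) {J : Set ℝ} (hJ : J ⊆ Ioo (-ε) ε) :
    IsSymplecticIsotopy U Ω J V φ where
  isOpen := h.isOpen
  subset := (h.subset hε).trans hU'U
  smooth := h.smooth.mono (prod_mono hJ subset_rfl)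
  start := h.start
  mapsTo t ht p hp := hU'U (h.mem p hp t (hJ ht))
  injOn t ht := by
    have := t2Space_totalSpace (F := F) (E := E)
    exact h.injOn hU' hX (hJ ht)
  symplectic t ht p hp v w := h.pullBilin_eq hΩ hU' hU'U hε hX hXc (hJ ht) hp v w

end FlowIsotopies

/-! ### Families near the identity on a compact manifold -/

section Diffeomorphisms

variable {B H : Type*} [NormedAddCommGroup B] [NormedSpace ℝ B] [FiniteDimensional ℝ B]
  [TopologicalSpace H] {I : ModelWithCorners ℝ B H} [I.Boundaryless]
  {N : Type*} [TopologicalSpace N] [ChartedSpace H N] [IsManifold I ∞ N]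
  {g : ℝ → N → N} {ε : ℝ}

theorem shear_isInvertible {V W : Type*} [NormedAddCommGroup V] [NormedSpace ℝ V]
    [NormedAddCommGroup W] [NormedSpace ℝ W] (L : V →L[ℝ] W) : (shear L).IsInvertible :=
  ⟨ContinuousLinearEquiv.equivOfInverse (shear L) (shear (-L)) (shear_neg_shear L)
    (shear_shear_neg L), rfl⟩

/-- A smooth family of maps that starts at the identity is locally injective and has local smooth
inverses. -/
theorem exists_local_inverse (hε : 0 < ε)
    (hg : ContMDiffOn (𝓘(ℝ, ℝ).prod I) I ∞ (fun q : ℝ × N => g q.1 q.2) (Ioo (-ε) ε ×ˢ univ))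
    (hg0 : ∀ x, g 0 x = x) (x₀ : N) :
    (∃ u ∈ 𝓝 ((0 : ℝ), x₀), InjOn (fun q : ℝ × N => (q.1, g q.1 q.2)) u) ∧
    ∃ A : Set (ℝ × N), IsOpen A ∧ ((0 : ℝ), x₀) ∈ A ∧ ∃ k : ℝ × N → N,
      ContMDiffOn (𝓘(ℝ, ℝ).prod I) I ∞ k A ∧ ∀ q ∈ A, g q.1 (k q) = q.2 := by
  have h0 : (0 : ℝ) ∈ Ioo (-ε) ε := ⟨by linarith, hε⟩
  obtain ⟨T, hT, h0T, O, hO, hqO, hOt, -, hsrc, hf⟩ := exists_contDiffOn_coordFamily (y₀ := x₀)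
    isOpen_univ hg h0 (mem_univ x₀) (by rw [hg0]; exact mem_extChartAt_source x₀)
  set z₀ := extChartAt I x₀ x₀ with hz₀
  set S := Ioo (-ε) ε ∩ T with hSdef
  have hS : IsOpen S := isOpen_Ioo.inter hT
  have h0S : (0 : ℝ) ∈ S := ⟨h0, h0T⟩
  have hSO : IsOpen (S ×ˢ O) := hS.prod hO
  -- Keeping the time as a coordinate makes the inverse smooth jointly in time and space. Since the
  -- family starts at the identity, the derivative at time zero is a shear, hence invertible.
  let f : ℝ × B → ℝ × B := fun q => (q.1, coordFamily I x₀ x₀ g q)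
  have hfs : ContDiffOn ℝ ∞ f (S ×ˢ O) := contDiffOn_fst.prodMk hf
  have hmem : ((0 : ℝ), z₀) ∈ S ×ˢ O := ⟨h0S, hqO⟩
  have hfd := ((hf.contDiffAt (hSO.mem_nhds hmem)).differentiableAt (by simp)).hasFDerivAt
  set D := fderiv ℝ (coordFamily I x₀ x₀ g) (0, z₀)
  have hD : ∀ v : B, D (0, v) = v := by
    intro v
    have h1 := HasFDerivAt.comp (f := fun z : B => ((0 : ℝ), z)) (g := coordFamily I x₀ x₀ g) z₀ hfd
      (hasFDerivAt_prodMk_right (0 : ℝ) z₀)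
    have h2 : HasFDerivAt (coordFamily I x₀ x₀ g ∘ fun z : B => ((0 : ℝ), z))
        (ContinuousLinearMap.id ℝ B) z₀ := by
      refine (hasFDerivAt_id z₀).congr_of_eventuallyEq ?_
      filter_upwards [hO.mem_nhds hqO] with z hz
      show extChartAt I x₀ (g 0 ((extChartAt I x₀).symm z)) = z
      rw [hg0, (extChartAt I x₀).right_inv (hOt hz)]
    exact DFunLike.congr_fun (h1.unique h2) v
  have hinv : (fderiv ℝ f (0, z₀)).IsInvertible := by
    have h1 : HasFDerivAt f ((ContinuousLinearMap.fst ℝ ℝ B).prod D) (0, z₀) :=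
      hasFDerivAt_fst.prodMk hfd
    have h2 : (ContinuousLinearMap.fst ℝ ℝ B).prod D
        = shear (D.comp (ContinuousLinearMap.inl ℝ ℝ B)) := by
      refine ContinuousLinearMap.ext fun w => ?_
      rw [shear_apply]
      refine Prod.ext rfl ?_
      show D w = w.2 + D (w.1, 0)
      conv_lhs => rw [show w = (0, w.2) + (w.1, 0) by simp, map_add, hD]
    rw [h1.fderiv, h2]
    exact shear_isInvertible _
  obtain ⟨e, hze, hes, hef, -, hsm⟩ := exists_openPartialHomeomorph_of_isInvertible hSO hfs hmem hinv
  let χ : ℝ × N → ℝ × B := fun q => (q.1, extChartAt I x₀ q.2)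
  have hχs : ContMDiffOn (𝓘(ℝ, ℝ).prod I) 𝓘(ℝ, ℝ × B) ∞ χ (univ ×ˢ (extChartAt I x₀).source) :=
    fun q hq => ContMDiffWithinAt.prodMk_space contMDiff_fst.contMDiffAt.contMDiffWithinAt
      ((contMDiffAt_chart hq.2).comp q contMDiff_snd.contMDiffAt).contMDiffWithinAt
  have hopen : IsOpen ((univ : Set ℝ) ×ˢ (extChartAt I x₀).source) :=
    isOpen_univ.prod (isOpen_extChartAt_source x₀)
  have hfχ : ∀ q : ℝ × N, χ q ∈ e.source → q.2 ∈ (extChartAt I x₀).source →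
      f (χ q) = χ (q.1, g q.1 q.2) := by
    intro q hq hq2
    show (q.1, extChartAt I x₀ (g q.1 ((extChartAt I x₀).symm (extChartAt I x₀ q.2)))) = _
    rw [(extChartAt I x₀).left_inv hq2]
  have hχ0 : χ (0, x₀) = (0, z₀) := rfl
  constructor
  · refine ⟨(univ ×ˢ (extChartAt I x₀).source) ∩ χ ⁻¹' e.source,
      (hχs.continuousOn.isOpen_inter_preimage hopen e.open_source).mem_nhds
        ⟨⟨mem_univ _, mem_extChartAt_source x₀⟩, hze⟩, ?_⟩
    rintro ⟨t, x⟩ ⟨⟨-, hx⟩, hxe⟩ ⟨t', x'⟩ ⟨⟨-, hx'⟩, hxe'⟩ heq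
    obtain ⟨rfl, h2⟩ := Prod.mk.inj heq
    have h3 : e (χ (t, x)) = e (χ (t, x')) := by
      rw [hef, hef, hfχ _ hxe hx, hfχ _ hxe' hx']
      exact congrArg (fun y => χ (t, y)) h2
    have h4 := (Prod.mk.inj (e.injOn hxe hxe' h3)).2
    exact Prod.ext rfl ((extChartAt I x₀).injOn hx hx' h4)
  · refine ⟨(univ ×ˢ (extChartAt I x₀).source) ∩ χ ⁻¹' e.target,
      hχs.continuousOn.isOpen_inter_preimage hopen e.open_target,
      ⟨⟨mem_univ _, mem_extChartAt_source x₀⟩, ?_⟩,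
      fun q => (extChartAt I x₀).symm (e.symm (χ q)).2, ?_, ?_⟩
    · have h1 := e.map_source hze
      have h2 : f (0, z₀) = χ (0, x₀) := by
        have := hfχ (0, x₀) hze (mem_extChartAt_source x₀)
        rw [hg0] at this
        exact this
      rw [hef, h2] at h1
      exact h1
    · intro q hq
      have h1 : ContMDiffAt (𝓘(ℝ, ℝ).prod I) 𝓘(ℝ, ℝ × B) ∞ χ q :=
        hχs.contMDiffAt (hopen.mem_nhds hq.1)
      have h2 : ContMDiffAt 𝓘(ℝ, ℝ × B) 𝓘(ℝ, ℝ × B) ∞ e.symm (χ q) :=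
        (hsm.contDiffAt (e.open_target.mem_nhds hq.2)).contMDiffAt
      have h3 : ContMDiffAt (𝓘(ℝ, ℝ).prod I) 𝓘(ℝ, B) ∞ (fun q => (e.symm (χ q)).2) q :=
        contDiff_snd.contMDiff.contMDiffAt.comp q (h2.comp q h1)
      exact ((contMDiffAt_chart_symm (hOt (hes (e.map_target hq.2)).2)).comp q h3).contMDiffWithinAt
    · rintro ⟨t, y⟩ ⟨⟨-, hy⟩, hye⟩
      have h1 := e.right_inv hye
      have h2 := hes (e.map_target hye)
      set w := e.symm (χ (t, y)) with hw
      rw [hef] at h1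
      obtain ⟨h3, h4⟩ := Prod.mk.inj h1
      have h5 := hsrc w.1 h2.1 w.2 h2.2
      rw [h3] at h5
      have h6 : extChartAt I x₀ (g t ((extChartAt I x₀).symm w.2)) = extChartAt I x₀ y := by
        rw [← h4, coordFamily, h3]
        rfl
      exact (extChartAt I x₀).injOn h5 hy h6

theorem exists_Ioo_prod_univ_subset [CompactSpace N] {A : Set (ℝ × N)} (hA : IsOpen A)
    (h0 : ∀ x, ((0 : ℝ), x) ∈ A) : ∃ δ > (0 : ℝ), Ioo (-δ) δ ×ˢ (univ : Set N) ⊆ A := by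
  obtain ⟨u, v, hu, -, h0u, hv, huv⟩ := generalized_tube_lemma (isCompact_singleton (x := (0 : ℝ)))
    isCompact_univ hA (by rintro ⟨t, x⟩ ⟨rfl, -⟩; exact h0 x)
  obtain ⟨δ, hδ, hδu⟩ := Metric.isOpen_iff.1 hu 0 (h0u rfl)
  refine ⟨δ, hδ, (prod_mono ?_ hv).trans huv⟩
  rwa [Real.ball_eq_Ioo, zero_sub, zero_add] at hδu

/-- On a compact manifold, a smooth family of maps that starts at the identity consists of
diffeomorphisms for small times. -/
theorem exists_inverse_family [CompactSpace N] [T2Space N] (hε : 0 < ε)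
    (hg : ContMDiffOn (𝓘(ℝ, ℝ).prod I) I ∞ (fun q : ℝ × N => g q.1 q.2) (Ioo (-ε) ε ×ˢ univ))
    (hg0 : ∀ x, g 0 x = x) :
    ∃ δ > (0 : ℝ), δ ≤ ε ∧ ∃ h : ℝ × N → N,
      ContMDiffOn (𝓘(ℝ, ℝ).prod I) I ∞ h (Ioo (-δ) δ ×ˢ univ) ∧
      (∀ t ∈ Ioo (-δ) δ, ∀ y, g t (h (t, y)) = y) ∧ ∀ t ∈ Ioo (-δ) δ, ∀ x, h (t, g t x) = x := by
  classical
  have h0 : (0 : ℝ) ∈ Ioo (-ε) ε := ⟨by linarith, hε⟩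
  have hopen : IsOpen (Ioo (-ε) ε ×ˢ (univ : Set N)) := isOpen_Ioo.prod isOpen_univ
  -- injectivity
  obtain ⟨D, hD, hDinj⟩ := InjOn.exists_mem_nhdsSet (f := fun q : ℝ × N => (q.1, g q.1 q.2))
    (s := {(0 : ℝ)} ×ˢ (univ : Set N))
    (by
      rintro ⟨t, x⟩ ⟨rfl, -⟩ ⟨t', x'⟩ ⟨rfl, -⟩ heq
      have := (Prod.mk.inj heq).2
      simp only [hg0] at this
      rw [this])
    (isCompact_singleton.prod isCompact_univ)
    (by
      rintro ⟨t, x⟩ ⟨rfl, -⟩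
      exact continuousAt_fst.prodMk
        (hg.contMDiffAt (hopen.mem_nhds ⟨h0, mem_univ _⟩)).continuousAt)
    (by
      rintro ⟨t, x⟩ ⟨rfl, -⟩
      exact (exists_local_inverse hε hg hg0 x).1)
  obtain ⟨D', hD'o, hD's, hD'D⟩ := mem_nhdsSet_iff_exists.1 hD
  obtain ⟨δ₁, hδ₁, hδ₁D⟩ := exists_Ioo_prod_univ_subset hD'o fun x => hD's ⟨rfl, mem_univ x⟩
  have hinj : ∀ t ∈ Ioo (-δ₁) δ₁, Function.Injective (g t) := by
    intro t ht x x' hxx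
    exact (Prod.mk.inj (hDinj (hD'D (hδ₁D ⟨ht, mem_univ x⟩)) (hD'D (hδ₁D ⟨ht, mem_univ x'⟩))
      (congrArg (Prod.mk t) hxx))).2
  -- local inverses
  choose A hA h0A k hk hgk using fun x => (exists_local_inverse hε hg hg0 x).2
  obtain ⟨δ₂, hδ₂, hδ₂A⟩ := exists_Ioo_prod_univ_subset (isOpen_iUnion hA) fun x =>
    mem_iUnion.2 ⟨x, h0A x⟩
  -- For small times a preimage exists, so the default is not reached. Injectivity makes `h` agree
  -- with each smooth local inverse `k x` where the latter is defined, whence its smoothness.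
  let h : ℝ × N → N := fun q => if H : ∃ x, g q.1 x = q.2 then H.choose else q.2
  set δ := min ε (min δ₁ δ₂)
  have hle : Ioo (-δ) δ ⊆ Ioo (-δ₁) δ₁ ∩ Ioo (-δ₂) δ₂ := fun t ht =>
    ⟨⟨(neg_le_neg ((min_le_right _ _).trans (min_le_left _ _))).trans_lt ht.1,
      ht.2.trans_le ((min_le_right _ _).trans (min_le_left _ _))⟩,
      ⟨(neg_le_neg ((min_le_right _ _).trans (min_le_right _ _))).trans_lt ht.1,
        ht.2.trans_le ((min_le_right _ _).trans (min_le_right _ _))⟩⟩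
  have hgh : ∀ t ∈ Ioo (-δ) δ, ∀ y, g t (h (t, y)) = y := by
    intro t ht y
    obtain ⟨x, hx⟩ := mem_iUnion.1 (hδ₂A (show (t, y) ∈ _ from ⟨(hle ht).2, mem_univ y⟩))
    have H : ∃ x', g t x' = y := ⟨k x (t, y), hgk x _ hx⟩
    have : h (t, y) = H.choose := dif_pos H
    rw [this]
    exact H.choose_spec
  refine ⟨δ, lt_min hε (lt_min hδ₁ hδ₂), min_le_left _ _, h, ?_, hgh, fun t ht x =>
    hinj t (hle ht).1 (hgh t ht _)⟩
  rintro ⟨t, y⟩ ⟨ht, -⟩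
  obtain ⟨x, hx⟩ := mem_iUnion.1 (hδ₂A (show (t, y) ∈ _ from ⟨(hle ht).2, mem_univ y⟩))
  have hn : A x ∩ (Ioo (-δ) δ ×ˢ univ) ∈ 𝓝 (t, y) :=
    ((hA x).inter (isOpen_Ioo.prod isOpen_univ)).mem_nhds ⟨hx, ht, mem_univ y⟩
  refine (((hk x).contMDiffAt ((hA x).mem_nhds hx)).congr_of_eventuallyEq ?_).contMDiffWithinAt
  filter_upwards [hn] with q hq
  exact hinj q.1 (hle hq.2.1).1 ((hgh q.1 hq.2.1 q.2).trans (hgk x q hq.1).symm)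

end Diffeomorphisms

/-! ### Compact C: realizing infinitesimal directions by isotopies -/

section CompactCase

variable {B : Type*} [NormedAddCommGroup B] [NormedSpace ℝ B] [FiniteDimensional ℝ B]
  {C : Type*} [TopologicalSpace C] [ChartedSpace B C] [IsManifold 𝓘(ℝ, B) ∞ C]
  {F : Type*} [NormedAddCommGroup F] [NormedSpace ℝ F] [FiniteDimensional ℝ F]
  {E : C → Type*} [TopologicalSpace (TotalSpace F E)] [∀ x, AddCommGroup (E x)]
  [∀ x, Module ℝ (E x)] [∀ x, TopologicalSpace (E x)]
  [FiberBundle F E] [VectorBundle ℝ F E] [ContMDiffVectorBundle ∞ F E 𝓘(ℝ, B)]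

local notation "𝓘B" => modelWithCornersSelf ℝ B
local notation "𝓙" => ModelWithCorners.prod (modelWithCornersSelf ℝ B) (modelWithCornersSelf ℝ F)
local notation "𝟎" => graphMap (0 : Gam B F E)

variable {U U' V : Set (TotalSpace F E)} {Ω : BilinField B F E} {ε : ℝ}
  {X : ∀ p : TotalSpace F E, TT B p} {φ : ℝ → TotalSpace F E → TotalSpace F E}

theorem exists_section_eq {c : C → TotalSpace F E} (hc : ContMDiff 𝓘B 𝓙 ∞ c)
    (hp : ∀ y, (c y).proj = y) : ∃ σ : Gam B F E, ∀ y, graphMap σ y = c y := by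
  have h : ∀ y, ∃ e : E y, (⟨y, e⟩ : TotalSpace F E) = c y := by
    intro y
    have key : ∀ p : TotalSpace F E, p.proj = y → ∃ e : E y, (⟨y, e⟩ : TotalSpace F E) = p := by
      rintro ⟨_, e⟩ rfl
      exact ⟨e, rfl⟩
    exact key _ (hp y)
  choose e he using h
  exact ⟨⟨e, by
    have : (fun y => TotalSpace.mk' F y (e y)) = c := funext he
    rw [this]
    exact hc⟩, he⟩

/-- The image of the zero section under a symplectic map is coisotropic. -/
theorem coisotropic_of_symplectic (hΩ : IsSymplecticOn 𝓙 U Ω) (hC : (0 : Gam B F E) ∈ DefU U Ω)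
    {s : Gam B F E} {ψ : TotalSpace F E → TotalSpace F E} {g : C → C} {x : C}
    (hψ : MDifferentiableAt 𝓙 𝓙 ψ (𝟎 x)) (hg : MDifferentiableAt 𝓘B 𝓘B g x)
    (hsg : ∀ x, graphMap s (g x) = ψ (𝟎 x))
    (hsym : ∀ v w : TT B (𝟎 x), Ω (ψ (𝟎 x)) (mfderiv 𝓙 𝓙 ψ (𝟎 x) v) (mfderiv 𝓙 𝓙 ψ (𝟎 x) w)
      = Ω (𝟎 x) v w) (v : TT B (graphMap s (g x)))
    (hv : ∀ w : TangentSpace 𝓘B (g x),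
      Ω (graphMap s (g x)) v (mfderiv 𝓘B 𝓙 (graphMap s) (g x) w) = 0) :
    ∃ u : TangentSpace 𝓘B (g x), mfderiv 𝓘B 𝓙 (graphMap s) (g x) u = v := by
  have hfun : graphMap s ∘ g = ψ ∘ 𝟎 := funext hsg
  have h1 := mfderiv_comp (I := 𝓘B) (I' := 𝓘B) (I'' := 𝓙) x
    ((contMDiffAt_graphMap s (g x)).mdifferentiableAt (by simp)) hg
  have h2 := mfderiv_comp (I := 𝓘B) (I' := 𝓙) (I'' := 𝓙) x hψ
    ((contMDiffAt_graphMap (0 : Gam B F E) x).mdifferentiableAt (by simp))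
  rw [hfun] at h1
  let A : (B × F) →L[ℝ] (B × F) := mfderiv 𝓙 𝓙 ψ (𝟎 x)
  have h3 : ∀ w : TangentSpace 𝓘B x, (A (zeroDeriv B F E x w) : B × F)
      = mfderiv 𝓘B 𝓙 (graphMap s) (g x) (mfderiv 𝓘B 𝓘B g x w) := fun w =>
    (DFunLike.congr_fun h2 w).symm.trans (DFunLike.congr_fun h1 w)
  -- A linear map that pulls a form back to a nondegenerate one is injective, hence surjective by
  -- dimension. So `v` has a preimage `a`, which is orthogonal to $T_xC$ and therefore tangent to
  -- $C$.
  have hinj : Function.Injective A := by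
    refine (injective_iff_map_eq_zero A).2 fun a ha => ?_
    refine hΩ.nondegenerate (𝟎 x) (graphMap_zero_mem hC x) a fun w => ?_
    refine (hsym a w).symm.trans ?_
    have : mfderiv 𝓙 𝓙 ψ (𝟎 x) a = 0 := ha
    rw [this, map_zero, zero_apply]
  obtain ⟨a, ha⟩ := (LinearMap.injective_iff_surjective (f := (A : (B × F) →ₗ[ℝ] (B × F)))).1 hinj v
  obtain ⟨u, hu⟩ := hC.2 x a fun w => by
    refine (hsym a (zeroDeriv B F E x w)).symm.trans ?_
    have h4 := hv (mfderiv 𝓘B 𝓘B g x w)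
    have h5 := omega_congr Ω (hsg x) v
      (mfderiv 𝓘B 𝓙 (graphMap s) (g x) (mfderiv 𝓘B 𝓘B g x w))
    rw [← h3 w] at h5
    refine Eq.trans ?_ (h5.symm.trans ((congrArg (fun z : B × F =>
      (Ω (graphMap s (g x)) : (B × F) →L[ℝ] (B × F) →L[ℝ] ℝ) v z) (h3 w)).trans h4))
    exact congrArg (fun z : B × F => (Ω (ψ (𝟎 x)) : (B × F) →L[ℝ] (B × F) →L[ℝ] ℝ) z
      (A (zeroDeriv B F E x w))) ha
  refine ⟨mfderiv 𝓘B 𝓘B g x u, ?_⟩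
  refine (h3 u).symm.trans ?_
  exact (congrArg A hu).trans ha

/-- On a compact manifold, the flow of a symplectic vector field moves the zero section through
graphs of coisotropic sections. -/
theorem exists_family_of_flow [CompactSpace C] [T2Space C] (hΩ : IsSymplecticOn 𝓙 U Ω)
    (hC : (0 : Gam B F E) ∈ DefU U Ω) (h : IsLocalFlow 𝓙 U' X V ε φ)
    (hU' : IsOpen U') (hU'U : U' ⊆ U) (hε : 0 < ε) (hX : SmoothFieldOn 𝓙 U' X)
    (hXc : OneFormClosedOn 𝓙 U' (fun p => Ω p (X p))) (hV : graph (0 : Gam B F E) ⊆ V)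
    {σ : Gam B F E} (hσ : IsNormalPart X σ) :
    ∃ δ > (0 : ℝ), δ ≤ ε ∧ ∃ s : ℝ → Gam B F E, IsCoisotropicFamily U Ω (Ico 0 δ) s ∧
      (∀ t ∈ Ico 0 δ, φ t '' graph (0 : Gam B F E) = graph (s t)) ∧
      IsInitialVelocity (Ico 0 δ) s σ := by
  classical
  have hV' : ∀ x : C, 𝟎 x ∈ V := fun x => hV ⟨x, rfl⟩
  -- The motion of base points. For small times it has a smooth inverse `k`, and
  -- $y\mapsto\varphi_t(k_t(y))$ is a section whose graph is the moved zero section.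
  let g : ℝ → C → C := fun t x => (φ t (𝟎 x)).proj
  have hφz : ContMDiffOn (𝓘(ℝ, ℝ).prod 𝓘B) 𝓙 ∞ (fun q : ℝ × C => φ q.1 (𝟎 q.2))
      (Ioo (-ε) ε ×ˢ univ) :=
    h.smooth.comp (f := fun q : ℝ × C => (q.1, 𝟎 q.2))
      (contMDiff_fst.contMDiffOn.prodMk
        ((contMDiff_graphMap (0 : Gam B F E)).comp contMDiff_snd).contMDiffOn)
      fun q hq => ⟨hq.1, hV' q.2⟩
  have hg : ContMDiffOn (𝓘(ℝ, ℝ).prod 𝓘B) 𝓘B ∞ (fun q : ℝ × C => g q.1 q.2)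
      (Ioo (-ε) ε ×ˢ univ) :=
    (contMDiff_total_proj (B := B) (F := F) (E := E)).comp_contMDiffOn hφz
  have hg0 : ∀ x, g 0 x = x := fun x => by
    show (φ 0 (𝟎 x)).proj = x
    rw [h.start _ (hV' x)]
    rfl
  obtain ⟨δ, hδ, hδε, k, hk, hgk, hkg⟩ := exists_inverse_family hε hg hg0
  have hsub : Ioo (-δ) δ ⊆ Ioo (-ε) ε := Ioo_subset_Ioo (neg_le_neg hδε) hδε
  have hIco : Ico 0 δ ⊆ Ioo (-δ) δ := fun t ht => ⟨by linarith [ht.1], ht.2⟩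
  have hcs : ContMDiffOn (𝓘(ℝ, ℝ).prod 𝓘B) 𝓙 ∞ (fun q : ℝ × C => φ q.1 (𝟎 (k q)))
      (Ioo (-δ) δ ×ˢ univ) :=
    hφz.comp (f := fun q : ℝ × C => (q.1, k q)) (contMDiff_fst.contMDiffOn.prodMk hk)
      fun q hq => ⟨hsub hq.1, mem_univ _⟩
  -- Outside the time interval the section is irrelevant and is set to zero.
  have hex : ∀ t, ∃ σ : Gam B F E, t ∈ Ioo (-δ) δ → ∀ y, graphMap σ y = φ t (𝟎 (k (t, y))) := by
    intro t
    by_cases ht : t ∈ Ioo (-δ) δ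
    · obtain ⟨σ, hσ⟩ := exists_section_eq (c := fun y => φ t (𝟎 (k (t, y))))
        (contMDiffOn_univ.1 (hcs.comp (f := fun y => (t, y))
          (contMDiffOn_const.prodMk contMDiffOn_id) fun y _ => ⟨ht, mem_univ y⟩)) (hgk t ht)
      exact ⟨σ, fun _ => hσ⟩
    · exact ⟨0, fun h => absurd h ht⟩
  choose s hs using hex
  have hsg : ∀ t ∈ Ioo (-δ) δ, ∀ x, graphMap (s t) (g t x) = φ t (𝟎 x) := by
    intro t ht x
    rw [hs t ht, hkg t ht]
  have h0 : (0 : ℝ) ∈ Ico 0 δ := ⟨le_rfl, hδ⟩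
  have hs0 : s 0 = 0 := by
    ext y
    have h1 := hsg 0 (hIco h0) y
    rw [hg0, h.start _ (hV' y)] at h1
    exact eq_of_heq (TotalSpace.mk.inj h1).2
  have hsmooth : ContMDiffOn (𝓘(ℝ, ℝ).prod 𝓘B) 𝓙 ∞ (fun q : ℝ × C => graphMap (s q.1) q.2)
      (Ico 0 δ ×ˢ univ) :=
    (hcs.mono (prod_mono hIco subset_rfl)).congr fun q hq => hs q.1 (hIco hq.1) q.2
  have hgr : ∀ t ∈ Ico 0 δ, φ t '' graph (0 : Gam B F E) = graph (s t) := by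
    intro t ht
    ext p
    constructor
    · rintro ⟨_, ⟨x, rfl⟩, rfl⟩
      exact ⟨g t x, hsg t (hIco ht) x⟩
    · rintro ⟨y, rfl⟩
      exact ⟨_, ⟨k (t, y), rfl⟩, (hs t (hIco ht) y).symm⟩
  refine ⟨δ, hδ, hδε, s, ⟨hsmooth, fun t ht => ⟨?_, fun y => ?_⟩, hs0⟩, hgr, fun x => ?_⟩
  · rintro _ ⟨y, rfl⟩
    rw [hs t (hIco ht)]
    exact hU'U (h.mem _ (hV' _) t (hsub (hIco ht)))
  · have ht' := hsub (hIco ht)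
    rw [← hgk t (hIco ht) y]
    refine coisotropic_of_symplectic hΩ hC (ψ := φ t) (x := k (t, y))
      ((contMDiffAt_of_family h.isOpen h.smooth ht' (hV' _)).mdifferentiableAt (by simp))
      ((contMDiffAt_of_family isOpen_univ hg ht' (mem_univ _)).mdifferentiableAt (by simp))
      (hsg t (hIco ht)) fun v w => ?_
    exact h.pullBilin_eq hΩ hU' hU'U hε hX hXc ht' (hV' _) v w
  · obtain ⟨e, u, hd, hvel⟩ := exists_initialVelocity_eq h0 (uniqueDiffOn_Ico 0 δ) hsmooth hs0
      (h.smooth.mono (prod_mono (hIco.trans hsub) subset_rfl)) h.start hV'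
      (fun t ht x => hgr t ht ▸ mem_image_of_mem _ ⟨x, rfl⟩) x
    rw [h.curveVelocity_eq (uniqueDiffOn_Ico 0 δ) (hIco.trans hsub) h0 (hV' x)] at hvel
    have hX0 : (X (φ 0 (𝟎 x)) : B × F) = X (𝟎 x) := by
      have key : ∀ p p' : TotalSpace F E, p = p' → (X p : B × F) = X p' := by
        rintro _ _ rfl; rfl
      exact key _ _ (h.start _ (hV' x))
    have hn := (normal_iff hΩ hC (X (𝟎 x)) e).1 ⟨u, hX0.symm.trans hvel⟩
    have hn' := (normal_iff hΩ hC (X (𝟎 x)) (σ x)).1 (hσ x)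
    have he : σ x - e = 0 := eq_zero_of_vert_kernelDist hΩ hC x _ fun l hl => by
      rw [map_sub, map_sub, sub_apply, ← hn ⟨l, hl⟩, ← hn' ⟨l, hl⟩, sub_self]
    rw [sub_eq_zero.1 he]
    exact hd

theorem isCompact_graph_zero [CompactSpace C] : IsCompact (graph (0 : Gam B F E)) :=
  isCompact_range (contMDiff_graphMap (0 : Gam B F E)).continuous

theorem symplecticDirections_subset [CompactSpace C] [T2Space C] (hΩ : IsSymplecticOn 𝓙 U Ω)
    (hC : (0 : Gam B F E) ∈ DefU U Ω) : symplecticDirections U Ω ⊆ symplecticVelocities U Ω := by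
  rintro σ ⟨U', X, hU', hCU', hU'U, hX, hXc, hσ⟩
  have := t2Space_totalSpace (F := F) (E := E)
  obtain ⟨V, ε, φ, hV, hε, h⟩ := exists_isLocalFlow_of_isCompact hU' hX isCompact_graph_zero hCU'
  obtain ⟨δ, hδ, hδε, s, hs, hgr, hσs⟩ :=
    exists_family_of_flow hΩ hC h hU' hU'U hε hX hXc hV hσ
  have hJ : Ico 0 δ ⊆ Ioo (-ε) ε := fun t ht => ⟨by linarith [ht.1], ht.2.trans_le hδε⟩
  exact ⟨δ, hδ, s, hs, ⟨V, φ, h.isSymplecticIsotopy hΩ hU' hU'U hε hX hXc hJ, hV, hgr⟩, hσs⟩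

theorem hamiltonianDirections_subset [CompactSpace C] [T2Space C] (hΩ : IsSymplecticOn 𝓙 U Ω)
    (hC : (0 : Gam B F E) ∈ DefU U Ω) : hamiltonianDirections U Ω ⊆ hamiltonianVelocities U Ω := by
  rintro σ ⟨U', X, G, hU', hCU', hU'U, hX, hG, hXG, hσ⟩
  have := t2Space_totalSpace (F := F) (E := E)
  have hXc : OneFormClosedOn 𝓙 U' (fun p => Ω p (X p)) :=
    (oneFormClosedOn_mfderiv hU' hG).congr fun p hp =>
      ContinuousLinearMap.ext fun w => (hXG p hp w).symm
  obtain ⟨V, ε, φ, hV, hε, h⟩ := exists_isLocalFlow_of_isCompact hU' hX isCompact_graph_zero hCU'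
  obtain ⟨δ, hδ, hδε, s, hs, hgr, hσs⟩ :=
    exists_family_of_flow hΩ hC h hU' hU'U hε hX hXc hV hσ
  have hJ : Ico 0 δ ⊆ Ioo (-ε) ε := fun t ht => ⟨by linarith [ht.1], ht.2.trans_le hδε⟩
  -- The field is autonomous, so the constant family `G` serves as time-dependent Hamiltonian.
  refine ⟨δ, hδ, s, hs, ⟨V, φ, ⟨h.isSymplecticIsotopy hΩ hU' hU'U hε hX hXc hJ, fun _ => G, ?_, ?_⟩,
    hV, hgr⟩, hσs⟩
  · refine hG.comp contMDiff_snd.contMDiffOn ?_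
    rintro ⟨t, q⟩ ⟨ht, p, hp, hq⟩
    have h1 := h.mem p hp t (hJ ht)
    rwa [show φ t p = q from hq] at h1
  · intro t ht p hp w
    have h1 := h.curveVelocity_eq (uniqueDiffOn_Ico 0 δ) hJ ht hp
    have h2 := hXG _ (h.mem p hp t (hJ ht)) w
    rw [← h1] at h2
    exact h2

end CompactCase

end Coiso

end

/-! ### The theorem -/

theorem mainTheorem10
    {B : Type*} [NormedAddCommGroup B] [NormedSpace ℝ B] [FiniteDimensional ℝ B]
    {C : Type*} [TopologicalSpace C] [T2Space C] [SecondCountableTopology C]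
    [ChartedSpace B C] [IsManifold 𝓘(ℝ, B) ∞ C]
    {F : Type*} [NormedAddCommGroup F] [NormedSpace ℝ F] [FiniteDimensional ℝ F]
    {E : C → Type*} [TopologicalSpace (TotalSpace F E)] [∀ x, AddCommGroup (E x)]
    [∀ x, Module ℝ (E x)] [∀ x, TopologicalSpace (E x)]
    [FiberBundle F E] [VectorBundle ℝ F E] [ContMDiffVectorBundle ∞ F E 𝓘(ℝ, B)]
    (U : Set (TotalSpace F E)) (Ω : BilinField B F E)
    (hΩ : IsSymplecticOn (𝓘(ℝ, B).prod 𝓘(ℝ, F)) U Ω)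
    (hC : (0 : Gam B F E) ∈ DefU U Ω) :
    -- the characteristic distribution is involutive, and `Γ(E) ≅ Ω¹_F(C)`
    Involutive (kernelDist Ω) ∧
    Function.Injective (flat Ω) ∧ LinearMap.range (flat Ω) = foliatedOneForms (kernelDist Ω) ∧
    -- families that are trivial under symplectic equivalence
    (∀ s : ℝ → Gam B F E, IsCoisotropicFamily U Ω (Icc 0 1) s →
      SymplecticallyTrivial U Ω (Icc 0 1) s →
      ∃ σ : Gam B F E, IsInitialVelocity (Icc 0 1) s σ ∧
        ∃ h : flat Ω σ ∈ closedFoliated (kernelDist Ω),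
          (Submodule.Quotient.mk ⟨flat Ω σ, h⟩ : FoliatedH1 (kernelDist Ω)) ∈
            LinearMap.range (rMap (kernelDist Ω))) ∧
    -- families that are trivial under Hamiltonian equivalence
    (∀ s : ℝ → Gam B F E, IsCoisotropicFamily U Ω (Icc 0 1) s →
      HamiltonianTrivial U Ω (Icc 0 1) s →
      ∃ σ : Gam B F E, IsInitialVelocity (Icc 0 1) s σ ∧
        ∃ h : flat Ω σ ∈ closedFoliated (kernelDist Ω),
          (Submodule.Quotient.mk ⟨flat Ω σ, h⟩ : FoliatedH1 (kernelDist Ω)) = 0) ∧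
    -- the equation for coisotropic sections and its formal tangent space
    DefU U Ω = {s | graph s ⊆ U ∧ MuEqZero Ω s} ∧
    linearizedSolutions Ω = {σ | flat Ω σ ∈ closedFoliated (kernelDist Ω)} ∧
    -- the infinitesimal actions of Hamiltonian and of symplectic vector fields
    hamiltonianDirections U Ω = {σ | flat Ω σ ∈ exactFoliated (kernelDist Ω)} ∧
    symplecticDirections U Ω =
      {σ | ∃ γ ∈ closedOneForms B C, flat Ω σ = restrictToK (kernelDist Ω) γ} ∧
    -- for compact `C` they are realized by isotopies
    (CompactSpace C →
      hamiltonianVelocities U Ω = hamiltonianDirections U Ω ∧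
      symplecticVelocities U Ω = symplecticDirections U Ω) ∧
    -- the formal tangent spaces of the moduli spaces
    (∃ e : FormalTangentHam U Ω ≃ₗ[ℝ] FoliatedH1 (kernelDist Ω),
      ∀ (σ : formalTangentDef Ω) (h : flat Ω σ ∈ closedFoliated (kernelDist Ω)),
        e (Submodule.Quotient.mk σ) = Submodule.Quotient.mk ⟨flat Ω σ, h⟩) ∧
    (∃ e : FormalTangentSym U Ω ≃ₗ[ℝ]
        FoliatedH1 (kernelDist Ω) ⧸ LinearMap.range (rMap (kernelDist Ω)),
      ∀ (σ : formalTangentDef Ω) (h : flat Ω σ ∈ closedFoliated (kernelDist Ω)),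
        e (Submodule.Quotient.mk σ) =
          Submodule.Quotient.mk
            (Submodule.Quotient.mk ⟨flat Ω σ, h⟩ : FoliatedH1 (kernelDist Ω))) := by
  have hcl : Icc (0 : ℝ) 1 ⊆ closure (interior (Icc 0 1)) := by
    rw [interior_Icc, closure_Ioo zero_ne_one]
  have h01 : (0 : ℝ) ∈ Icc (0 : ℝ) 1 := ⟨le_rfl, zero_le_one⟩
  refine ⟨kernelDist_involutive hΩ hC, flat_injective hΩ hC, range_flat hΩ hC, ?_, ?_, defU_eq hΩ,
    linearizedSolutions_eq hΩ hC, hamiltonianDirections_eq hΩ hC, symplecticDirections_eq hΩ hC, ?_,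
    exists_equiv_foliatedH1 hΩ hC, exists_equiv_coker hΩ hC⟩
  · intro s hs ht
    obtain ⟨σ, hσ, γ, hγ, h⟩ := exists_initialVelocity_symplectic hΩ hC h01
      (uniqueDiffOn_Icc zero_lt_one) hcl hs ht
    exact ⟨σ, hσ, h ▸ restrictToK_closed _ γ hγ, (mk_mem_range_rMap_iff _).2 ⟨γ, hγ, h⟩⟩
  · intro s hs ht
    obtain ⟨σ, hσ, h⟩ := exists_initialVelocity_hamiltonian hΩ hC h01
      (uniqueDiffOn_Icc zero_lt_one) hcl hs ht
    -- Only needed for closedness: an exact foliated form is the restriction of a closed form on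
    -- $C$.
    obtain ⟨γ, hγ, hγσ⟩ := exists_restrict_of_mem_exactFoliated h
    exact ⟨σ, hσ, hγσ ▸ restrictToK_closed _ γ hγ, (Submodule.Quotient.mk_eq_zero _).2 h⟩
  · intro _
    exact ⟨(hamiltonianVelocities_subset hΩ hC).antisymm (hamiltonianDirections_subset hΩ hC),
      (symplecticVelocities_subset hΩ hC).antisymm (symplecticDirections_subset hΩ hC)⟩
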